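/- Graphs are finite and may have loops and parallel edges. A \emph{planar graph} is a graph $G$ with a fixed drawing on the oriented sphere $S^2$ without edge crossings; the drawing of each connected component is recorded by its rotation system (the counterclockwise cyclic order of the half-edges around each vertex), where planarity means that each connected component satisfies Euler's formula $\#\text{vertices}-\#\text{edges}+\#\text{faces}=2$. Orient the edges of $G$ arbitrarily and let $\mathrm{Flow}(G)=\ker(\partial\colon C_1(G;\mathbb Z)\to C_0(G;\mathbb Z))$, with the inner product for which the oriented edges form an orthonormal basis of $C_1(G;\mathbb Z)$. A lattice is a \emph{2-cube tiling lattice} if, for some $n\ge 0$, it admits an inner-product-preserving embedding in $\mathbb Z^n$ whose image contains exactly one point of each unit cube $x+\{0,1\}^n$, $x\in\mathbb Z^n$. A graph is \emph{2-connected} if it is connected (in particular non-empty) and has no cut-vertex and no loop. A \emph{block} of $G$ is a maximal 2-connected subgraph of $G$, or a loop of $G$ together with its vertex; blocks inherit a drawing from $G$. Let $G_1,G_2$ be planar graphs with distinguished non-loop edges $f_1=(v_1,v_3)\in E(G_1)$ and $f_2=(v_2,v_4)\in E(G_2)$. Draw $G_1\sqcup G_2$ on $S^2$ so that $f_1$ and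 $f_2$ abut the same region, remove $f_1$ and $f_2$, and draw a 4-cycle $C$ through $v_1,v_2,v_3,v_4$ in this cyclic order, without crossings, so that $G_1\setminus f_1$ and $G_2\setminus f_2$ lie on different sides of $C$. The resulting planar graph is called a \emph{composition} of $G_1$ and $G_2$. (In terms of rotation systems: if $C$ has edges $e_1=v_1v_2$, $e_2=v_2v_3$, $e_3=v_3v_4$, $e_4=v_4v_1$, then, in counterclockwise order, the half-edge of $f_1$ is replaced by those of $e_4,e_1$ at $v_1$ and of $e_2,e_3$ at $v_3$, and the half-edge of $f_2$ is replaced by those of $e_2,e_1$ at $v_2$ and of $e_4,e_3$ at $v_4$; either labelling of the ends of $f_1$ and $f_2$ is allowed.) Let $\mathcal G$ be the smallest class of planar graphs, closed under isomorphism of drawn graphs, that contains the graph with one vertex and no edges and the graph with two vertices and one edge between them, and that contains every composition of two of its members. \textbf{Theorem.} Let $G$ be a finite planar graph. Then $\mathrm{Flow}(G)$ is a 2-cube tiling lattice if and only if every block of $G$ belongs to $\mathcal G$. Moreover, $G$ is 2-connected and $\mathrm{Flow}(G)$ is a 2-cube tiling lattice if and only if $G\in\mathcal G$. -/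

import Mathlib

universe u v

/-! ### Graph theory on Mathlib's multigraphs (`Graph α β`: loops and parallel edges allowed) -/

namespace Graph

/-- `G` is connected (in particular it has a vertex). -/
def IsConn {α : Type u} {β : Type v} (G : Graph α β) : Prop :=
  G.vertexSet.Nonempty ∧
    ∀ x ∈ G.vertexSet, ∀ y ∈ G.vertexSet, Relation.ReflTransGen G.Adj x y

/-- `x` is a cut-vertex of the connected graph `G`: two other vertices are not joined by a walk
that avoids `x`. -/
def IsCutVertex {α : Type u} {β : Type v} (G : Graph α β) (x : α) : Prop :=
  x ∈ G.vertexSet ∧ ∃ y ∈ G.vertexSet, ∃ z ∈ G.vertexSet, y ≠ x ∧ z ≠ x ∧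
    ¬ Relation.ReflTransGen (fun a b => G.Adj a b ∧ a ≠ x ∧ b ≠ x) y z

/-- `G` is 2-connected: connected, without cut-vertices and without loops.  The one-vertex graph
and the one-edge graph on two vertices are 2-connected. -/
def IsTwoConn {α : Type u} {β : Type v} (G : Graph α β) : Prop :=
  G.IsConn ∧ (∀ x, ¬ G.IsCutVertex x) ∧ ∀ e x, ¬ G.IsLoopAt e x

/-- `B` is a block of `G`: a maximal 2-connected subgraph of `G`, or a loop of `G` together with
its vertex. -/
def IsBlock {α : Type u} {β : Type v} (G B : Graph α β) : Prop :=
  Maximal (fun H : Graph α β => H ≤ G ∧ H.IsTwoConn) B ∨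
    (B ≤ G ∧ ∃ e x, G.IsLoopAt e x ∧ B.vertexSet = {x} ∧ B.edgeSet = {e})

theorem IsBlock.le {α : Type u} {β : Type v} {G B : Graph α β} (h : G.IsBlock B) : B ≤ G :=
  h.elim (fun h => h.1.1) (fun h => h.1)

end Graph

/-! ### First-return permutations -/

section FirstReturn

variable {α : Type u} [Finite α] (σ : Equiv.Perm α) (p : α → Prop)

theorem exists_return (a : {a // p a}) : ∃ k : ℕ, p ((σ ^ (k + 1)) a.1) := by
  refine ⟨orderOf σ - 1, ?_⟩
  have h : orderOf σ - 1 + 1 = orderOf σ := Nat.sub_add_cancel (orderOf_pos σ)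
  rw [h, pow_orderOf_eq_one]
  exact a.2

open Classical in
/-- The first of the points `σ a, σ (σ a), …` that satisfies `p`. -/
noncomputable def firstReturnFun (a : {a // p a}) : {a // p a} :=
  ⟨(σ ^ (Nat.find (exists_return σ p a) + 1)) a.1, Nat.find_spec (exists_return σ p a)⟩

theorem firstReturnFun_injective : Function.Injective (firstReturnFun σ p) := by
  classical
  have key : ∀ a b : {a // p a},
      Nat.find (exists_return σ p a) ≤ Nat.find (exists_return σ p b) →
      firstReturnFun σ p a = firstReturnFun σ p b → a = b := by
    intro a b hle h
    have h1 := congrArg Subtype.val h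
    simp only [firstReturnFun] at h1
    obtain ⟨d, hd⟩ := Nat.exists_eq_add_of_le hle
    rw [hd, add_right_comm, pow_add σ _ d, Equiv.Perm.mul_apply] at h1
    have h2 := (σ ^ (Nat.find (exists_return σ p a) + 1)).injective h1
    rcases Nat.eq_zero_or_pos d with h0 | h0
    · subst h0
      exact Subtype.ext (by simpa using h2)
    · exfalso
      refine Nat.find_min (exists_return σ p b) (m := d - 1) (by omega) ?_
      rw [Nat.sub_add_cancel h0, ← h2]
      exact a.2
  intro a b h
  rcases le_total (Nat.find (exists_return σ p a)) (Nat.find (exists_return σ p b)) with h' | h'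
  · exact key a b h' h
  · exact (key b a h' h.symm).symm

/-- The first-return permutation of `σ` on the set of points that satisfy `p`: the cyclic orders
given by the cycles of `σ`, restricted to that set. -/
noncomputable def firstReturn : Equiv.Perm {a // p a} :=
  Equiv.ofBijective (firstReturnFun σ p)
    (Finite.injective_iff_bijective.1 (firstReturnFun_injective σ p))

theorem firstReturn_sameCycle (a b : {a // p a}) :
    (firstReturn σ p).SameCycle a b ↔ σ.SameCycle a.1 b.1 := by
  classical
  have hstep : ∀ a : {a // p a}, ((firstReturn σ p) a).1
      = (σ ^ (Nat.find (exists_return σ p a) + 1)) a.1 := fun _ => rfl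
  constructor
  · intro h
    obtain ⟨n, -, hn⟩ := h.exists_pow_eq'
    have : ∀ n : ℕ, σ.SameCycle a.1 (((firstReturn σ p) ^ n) a).1 := by
      intro n
      induction n with
      | zero => simpa using Equiv.Perm.SameCycle.refl σ a.1
      | succ n ih =>
        rw [pow_succ', Equiv.Perm.mul_apply, hstep]
        exact ih.trans ⟨((Nat.find (exists_return σ p (((firstReturn σ p) ^ n) a)) + 1 : ℕ) : ℤ),
          by rw [zpow_natCast]⟩
    rw [← hn]
    exact this n
  · intro h
    obtain ⟨m, -, hm⟩ := h.exists_pow_eq'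
    induction m using Nat.strong_induction_on generalizing a with
    | _ m ih =>
      rcases Nat.eq_zero_or_pos m with h0 | h0
      · subst h0
        have : a = b := Subtype.ext (by simpa using hm)
        rw [this]
      · have hle : Nat.find (exists_return σ p a) + 1 ≤ m := by
          have := Nat.find_min' (exists_return σ p a) (m := m - 1)
            (by rw [Nat.sub_add_cancel h0, hm]; exact b.2)
          omega
        obtain ⟨d, rfl⟩ := Nat.exists_eq_add_of_le hle
        rw [add_comm, pow_add, Equiv.Perm.mul_apply, ← hstep] at hm
        have h3 := ih d (by omega) ((firstReturn σ p) a) ⟨d, by rw [zpow_natCast, hm]⟩ hm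
        exact (Equiv.Perm.sameCycle_apply_left).1 h3

end FirstReturn

/-! ### Drawings on closed oriented surfaces, given by rotation systems -/

/-- A graph with vertices `V` and oriented edges `E`, drawn on a closed oriented surface.
A dart `(e, b)` is one of the two half-edges of `e`: `(e, false)` is the half at the initial vertex
of `e` and `(e, true)` the half at its terminal vertex.  The drawing is recorded by the
counterclockwise cyclic order of the darts around each vertex. -/
structure RotationSystem (V : Type u) (E : Type v) where
  /-- The vertex at which a dart is attached. -/
  base : E × Bool → V
  /-- The next dart, counterclockwise, around the same vertex. -/
  rot : Equiv.Perm (E × Bool)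
  /-- The cycles of `rot` are the sets of all darts at a vertex. -/
  rot_sameCycle : ∀ a b : E × Bool, rot.SameCycle a b ↔ base a = base b

/-- The other half of the same edge. -/
def dartFlip (E : Type v) : Equiv.Perm (E × Bool) :=
  Equiv.prodCongr (Equiv.refl E) Equiv.boolNot

namespace RotationSystem

variable {V : Type u} {E : Type v}

/-- The underlying graph. -/
def toGraph (G : RotationSystem V E) : Graph V E where
  vertexSet := Set.univ
  edgeSet := Set.univ
  IsLink e x y := ∃ b : Bool, G.base (e, b) = x ∧ G.base (e, !b) = y
  isLink_symm := by
    rintro e -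
    refine ⟨?_⟩
    rintro x y ⟨b, h1, h2⟩
    exact ⟨!b, h2, by simpa using h1⟩
  eq_or_eq_of_isLink_of_isLink := by
    rintro e x y z w ⟨b, rfl, rfl⟩ ⟨c, rfl, rfl⟩
    cases b <;> cases c <;> simp
  edge_mem_iff_exists_isLink := fun e =>
    ⟨fun _ => ⟨_, _, false, rfl, rfl⟩, fun _ => Set.mem_univ e⟩
  left_mem_of_isLink := fun _ _ _ _ => Set.mem_univ _

/-- The boundary walks of the faces are the cycles of this permutation of the darts. -/
def faceNext (G : RotationSystem V E) : Equiv.Perm (E × Bool) :=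
  G.rot * dartFlip E

/-- The vertex set of the connected component of `x`. -/
def component (G : RotationSystem V E) (x : V) : Set V :=
  {y | Relation.ReflTransGen G.toGraph.Adj x y}

/-- The number of faces of the drawing of the component of `x`; an isolated vertex has one face,
though its boundary has no darts. -/
noncomputable def faceCount (G : RotationSystem V E) (x : V) : ℕ :=
  max 1 {F : Set (E × Bool) |
    ∃ a, G.base a ∈ G.component x ∧ F = {b | G.faceNext.SameCycle a b}}.ncard

/-- The drawing is a drawing on the sphere: each connected component satisfies Euler's formula
`#vertices - #edges + #faces = 2`. -/
def IsPlanar (G : RotationSystem V E) : Prop :=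
  ∀ x : V, (G.component x).ncard + G.faceCount x
    = {e : E | G.base (e, false) ∈ G.component x}.ncard + 2

/-- The drawing inherited by a subgraph `B`. -/
noncomputable def restrict [Finite E] (G : RotationSystem V E) (B : Graph V E)
    (hB : B ≤ G.toGraph) : RotationSystem B.vertexSet B.edgeSet where
  base a := ⟨G.base (a.1.1, a.2), by
    obtain ⟨x, y, h⟩ := B.exists_isLink_of_mem_edgeSet a.1.2
    have hl : G.toGraph.IsLink a.1.1 (G.base (a.1.1, a.2)) (G.base (a.1.1, !a.2)) :=
      ⟨a.2, rfl, rfl⟩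
    exact ((Graph.IsSubgraph.isLink_iff hB a.1.2).2 hl).left_mem⟩
  rot := (Equiv.prodSubtypeFstEquivSubtypeProd (p := fun e : E => e ∈ B.edgeSet)
    (β := Bool)).permCongr (firstReturn G.rot (fun a => a.1 ∈ B.edgeSet))
  rot_sameCycle := by
    intro a b
    set ε := (Equiv.prodSubtypeFstEquivSubtypeProd (p := fun e : E => e ∈ B.edgeSet)
      (β := Bool)) with hε
    have h1 : (ε.permCongr (firstReturn G.rot (fun a => a.1 ∈ B.edgeSet))).SameCycle a b ↔
        (firstReturn G.rot (fun a => a.1 ∈ B.edgeSet)).SameCycle (ε.symm a) (ε.symm b) := by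
      have hpow : ∀ n : ℤ, (ε.permCongr (firstReturn G.rot (fun a => a.1 ∈ B.edgeSet))) ^ n
          = ε.permCongr ((firstReturn G.rot (fun a => a.1 ∈ B.edgeSet)) ^ n) := fun n =>
        (map_zpow ε.permCongrHom _ n).symm
      simp only [Equiv.Perm.SameCycle, hpow, Equiv.permCongr_apply]
      exact exists_congr fun n => by rw [Equiv.eq_symm_apply]
    rw [h1, firstReturn_sameCycle, G.rot_sameCycle, Subtype.mk.injEq]
    rfl

end RotationSystem

/-! ### Flow lattices and 2-cube tiling lattices -/

open Classical in
/-- The cellular boundary map `C₁(G; ℤ) → C₀(G; ℤ)`, `e ↦ (terminal vertex) - (initial vertex)`. -/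
noncomputable def RotationSystem.boundary {V : Type u} {E : Type v} [Fintype E]
    (G : RotationSystem V E) : (E → ℤ) →ₗ[ℤ] (V → ℤ) :=
  Fintype.linearCombination ℤ
    (fun e : E => (Pi.single (G.base (e, true)) 1 - Pi.single (G.base (e, false)) 1 : V → ℤ))

/-- The lattice of integer flows, inside the Euclidean lattice `C₁(G; ℤ)` with orthonormal basis
the oriented edges. -/
noncomputable def RotationSystem.flow {V : Type u} {E : Type v} [Fintype E]
    (G : RotationSystem V E) : Submodule ℤ (E → ℤ) :=
  LinearMap.ker G.boundary

/-- The lattice `L`, with the restriction of the dot product of `ℤ^ι`, is a 2-cube tiling lattice: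
some embedding of lattices `L → ℤⁿ` has an image that contains exactly one point of each unit
cube `c + {0, 1}ⁿ`, `c ∈ ℤⁿ`. -/
def IsTwoCubeTilingLattice {ι : Type v} [Fintype ι] (L : Submodule ℤ (ι → ℤ)) : Prop :=
  ∃ (n : ℕ) (φ : L →ₗ[ℤ] (Fin n → ℤ)),
    (∀ x y : L, φ x ⬝ᵥ φ y = (x : ι → ℤ) ⬝ᵥ (y : ι → ℤ)) ∧
    ∀ c : Fin n → ℤ, ∃! z : Fin n → ℤ,
      z ∈ LinearMap.range φ ∧ ∀ i, z i = c i ∨ z i = c i + 1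

/-! ### Composition of drawn graphs -/

/-- The edges of a composition of graphs with distinguished edges `f₁` and `f₂`: all other edges of
the two graphs, and the edges of a 4-cycle. -/
abbrev CompEdge {E₁ E₂ : Type v} (f₁ : E₁) (f₂ : E₂) : Type v :=
  ({e : E₁ // e ≠ f₁} ⊕ {e : E₂ // e ≠ f₂}) ⊕ Fin 4

namespace CompEdge

variable {E₁ E₂ : Type v} {f₁ : E₁} {f₂ : E₂}

/-- The half at its initial vertex of the `i`-th edge of the 4-cycle. -/
def cycOut (i : Fin 4) : CompEdge f₁ f₂ × Bool := (Sum.inr i, false)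

/-- The half at its terminal vertex of the `i`-th edge of the 4-cycle. -/
def cycIn (i : Fin 4) : CompEdge f₁ f₂ × Bool := (Sum.inr i, true)

open Classical in
/-- Replace the darts of `f₁` by the given darts `x` (for `d₁`) and `y` (for the other half). -/
noncomputable def repl₁ (d₁ : E₁ × Bool) (x y : CompEdge d₁.1 f₂ × Bool) (a : E₁ × Bool) :
    CompEdge d₁.1 f₂ × Bool :=
  if h : a.1 = d₁.1 then (if a = d₁ then x else y) else (Sum.inl (Sum.inl ⟨a.1, h⟩), a.2)

open Classical in
/-- Replace the darts of `f₂` by the given darts `x` (for `d₂`) and `y` (for the other half). -/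
noncomputable def repl₂ (d₂ : E₂ × Bool) (x y : CompEdge f₁ d₂.1 × Bool) (a : E₂ × Bool) :
    CompEdge f₁ d₂.1 × Bool :=
  if h : a.1 = d₂.1 then (if a = d₂ then x else y) else (Sum.inl (Sum.inr ⟨a.1, h⟩), a.2)

end CompEdge

namespace RotationSystem

open CompEdge in
/-- `G` is the composition of `G₁` and `G₂` along the edges `f₁ = (v₁, v₃)` with halves `d₁` at `v₁`
and `dartFlip d₁` at `v₃`, and `f₂ = (v₂, v₄)` with halves `d₂` at `v₂` and `dartFlip d₂` at `v₄`.

`G` arises by removing `f₁` and `f₂` and drawing a 4-cycle `v₁ v₂ v₃ v₄`, with edges `e₀ = (v₁, v₂)`,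
`e₁ = (v₂, v₃)`, `e₂ = (v₃, v₄)`, `e₃ = (v₄, v₁)`, which has what remains of `G₁` and what remains
of `G₂` on different sides.  So, in the counterclockwise order, the half of `f₁` is replaced by
the consecutive halves of `e₃, e₀` at `v₁` and `e₁, e₂` at `v₃`, and the half of `f₂` by those of
`e₁, e₀` at `v₂` and `e₃, e₂` at `v₄`.  (The other way to place the 4-cycle is the case where
`d₁` and `dartFlip d₁` are exchanged.)  The bijections `φ` and `ψ` say that a composition is
determined only up to isomorphism of drawn graphs and that edge orientations are irrelevant. -/
def IsCompositionAlong {V V₁ V₂ : Type u} {E E₁ E₂ : Type v} (G : RotationSystem V E)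
    (G₁ : RotationSystem V₁ E₁) (G₂ : RotationSystem V₂ E₂)
    (d₁ : E₁ × Bool) (d₂ : E₂ × Bool) : Prop :=
  ∃ (φ : V₁ ⊕ V₂ ≃ V) (ψ : CompEdge d₁.1 d₂.1 × Bool ≃ E × Bool),
    (∀ a, ψ (dartFlip _ a) = dartFlip E (ψ a)) ∧
    (∀ a : E₁ × Bool,
      G.base (ψ (repl₁ d₁ (cycIn 3) (cycIn 1) a)) = φ (Sum.inl (G₁.base a)) ∧
      G.base (ψ (repl₁ d₁ (cycOut 0) (cycOut 2) a)) = φ (Sum.inl (G₁.base a)) ∧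
      G.rot (ψ (repl₁ d₁ (cycOut 0) (cycOut 2) a)) =
        ψ (repl₁ d₁ (cycIn 3) (cycIn 1) (G₁.rot a))) ∧
    (∀ a : E₂ × Bool,
      G.base (ψ (repl₂ d₂ (cycOut 1) (cycOut 3) a)) = φ (Sum.inr (G₂.base a)) ∧
      G.base (ψ (repl₂ d₂ (cycIn 0) (cycIn 2) a)) = φ (Sum.inr (G₂.base a)) ∧
      G.rot (ψ (repl₂ d₂ (cycIn 0) (cycIn 2) a)) =
        ψ (repl₂ d₂ (cycOut 1) (cycOut 3) (G₂.rot a))) ∧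
    G.rot (ψ (cycIn 3)) = ψ (cycOut 0) ∧ G.rot (ψ (cycIn 1)) = ψ (cycOut 2) ∧
    G.rot (ψ (cycOut 1)) = ψ (cycIn 0) ∧ G.rot (ψ (cycOut 3)) = ψ (cycIn 2)

/-- `G` is a composition of `G₁` and `G₂` along some edges that are not loops. -/
def IsComposition {V V₁ V₂ : Type u} {E E₁ E₂ : Type v} (G : RotationSystem V E)
    (G₁ : RotationSystem V₁ E₁) (G₂ : RotationSystem V₂ E₂) : Prop :=
  ∃ (d₁ : E₁ × Bool) (d₂ : E₂ × Bool),
    G₁.base d₁ ≠ G₁.base (dartFlip E₁ d₁) ∧ G₂.base d₂ ≠ G₂.base (dartFlip E₂ d₂) ∧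
    G.IsCompositionAlong G₁ G₂ d₁ d₂

/-- The class generated by the one-vertex graph and the one-edge graph on two vertices under
composition. -/
inductive CompositionClass : ∀ {V : Type u} {E : Type v}, RotationSystem V E → Prop
  | vertex {V : Type u} {E : Type v} (G : RotationSystem V E)
      (hV : Nat.card V = 1) (hE : IsEmpty E) : CompositionClass G
  | edge {V : Type u} {E : Type v} (G : RotationSystem V E)
      (hV : Nat.card V = 2) (hE : Nat.card E = 1)
      (h : ∀ e, G.base (e, false) ≠ G.base (e, true)) : CompositionClass G
  | comp {V V₁ V₂ : Type u} {E E₁ E₂ : Type v} (G : RotationSystem V E)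
      (G₁ : RotationSystem V₁ E₁) (G₂ : RotationSystem V₂ E₂)
      (h₁ : CompositionClass G₁) (h₂ : CompositionClass G₂)
      (h : G.IsComposition G₁ G₂) : CompositionClass G

end RotationSystem

/-! Lattice side. By the case of Hajós's theorem for factors with two elements, a sublattice of ℤⁿ
that tiles by cubes {0, 1}ⁿ, n > 0, contains some 2eᵢ (`TilesCubes.exists_single_two_mem`). This
vector has norm 4 and even products with the whole lattice, and forgetting the coordinate i leaves a
tiling of ℤⁿ⁻¹; conversely a coordinate can be put back if it is even on the vectors that the other
coordinates do not see (`Cubical.lift`). A non-zero vector has norm at least 4, and since 2eᵢ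
therefore cannot be split orthogonally, orthogonal summands of tiling lattices are tiling lattices
(`Cubical.of_prod`). Hajós's theorem itself follows by character sums from a bound of Mycielski for
irredundant coverings by cosets (`CharCovers.card_le`).

Graph side. If the flow lattice is a tiling lattice, short norms exclude loops, parallel edges and
triangles, and 2eᵢ is the unit flow along a 4-cycle C. Two adjacent vertices of C cannot be joined
off C, as this would give a flow through exactly one edge of C, with an odd product. So off C the
graph falls into a part at v₁, v₃ and a part at v₂, v₄: apart from the drawing it is a composition.
Flows of a composition are given by flows y₁, y₂ on the parts and the value c on one edge of C, and
the form is the orthogonal sum of the forms of the parts plus the square of 2c + y₂(f₂) - y₁(f₁),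
which is half the product with C (`IsJoin.dartForm_joinFlow`). Hence the tiling property passes from
the parts to the composition, and back if the projection along C is a tiling lattice.

Drawing side. Planarity enters only through the fact that each flow mod 2 bounds a set of faces
(`IsPlanar.hasPotentials`), which is Euler's formula read as a dimension count, and which subgraphs
and the sides of C inherit. The potential of C tells its two sides apart. By induction the parts
belong to the class, and in a member of the class the ends of an edge do not separate (`EndsConn`);
so all edges of one part leave C on the same side. A Jordan curve argument
(`IsCubicalCycle.potential_rotate_eq`) shows that the two parts leave C on different sides, so that
the drawing is that of a composition.

Blocks. No two vertices of a block are joined outside it, so a flow restricts to a flow on each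
block, and without loops the flow lattice is the orthogonal sum of those of the blocks. -/

/-! ### Coverings of cosets of characters -/

section CharacterCoverings

variable {A : Type u} [AddCommGroup A] [Finite A] {ι : Type v} (a : ι → A) (θ : ι → ℂ)

theorem exists_addChar_trivial_on_apply_ne_one (U : AddSubgroup A) {x : A} (hx : x ∉ U) :
    ∃ ψ : AddChar A ℂ, (∀ u ∈ U, ψ u = 1) ∧ ψ x ≠ 1 := by
  have h : (QuotientAddGroup.mk' U x) ≠ 0 := by
    rwa [Ne, QuotientAddGroup.mk'_apply, QuotientAddGroup.eq_zero_iff]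
  obtain ⟨ψ, hψ⟩ := AddChar.exists_apply_ne_zero.2 h
  refine ⟨ψ.compAddMonoidHom (QuotientAddGroup.mk' U), fun u hu => ?_, hψ⟩
  have : (QuotientAddGroup.mk' U u) = 0 := by
    rwa [QuotientAddGroup.mk'_apply, QuotientAddGroup.eq_zero_iff]
  rw [AddChar.compAddMonoidHom_apply, this, AddChar.map_zero_eq_one]

/-- The cosets of 0 and of h cover the larger group, because 2h lies in U. -/
theorem card_sup_zmultiples_le (U : AddSubgroup A) {h : A} (hh : 2 • h ∈ U) :
    Nat.card ↥(U ⊔ AddSubgroup.zmultiples h) ≤ 2 * Nat.card U := by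
  have hsub : ((U ⊔ AddSubgroup.zmultiples h : AddSubgroup A) : Set A) ⊆
      (U : Set A) ∪ (fun x => x + h) '' U := by
    intro x hx
    obtain ⟨u, hu, y, hy, rfl⟩ := AddSubgroup.mem_sup.1 hx
    obtain ⟨k, rfl⟩ := AddSubgroup.mem_zmultiples_iff.1 hy
    have h2 : ∀ m : ℤ, u + (2 * m) • h ∈ U := fun m => by
      have : (2 * m) • h = m • (2 • h) := by
        rw [mul_comm, mul_smul]; norm_cast
      rw [this]
      exact U.add_mem hu (U.zsmul_mem hh m)
    rcases Int.even_or_odd' k with ⟨m, rfl | rfl⟩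
    · exact Or.inl (h2 m)
    · refine Or.inr ⟨_, h2 m, ?_⟩
      simp only [add_smul, one_smul]; abel
  calc Nat.card ↥(U ⊔ AddSubgroup.zmultiples h)
      ≤ ((U : Set A) ∪ (fun x => x + h) '' U).ncard := Set.ncard_le_ncard hsub (Set.toFinite _)
    _ ≤ (U : Set A).ncard + ((fun x => x + h) '' (U : Set A)).ncard := Set.ncard_union_le _ _
    _ ≤ (U : Set A).ncard + (U : Set A).ncard :=
        Nat.add_le_add_left (Set.ncard_image_le (Set.toFinite _)) _
    _ = 2 * Nat.card U := by rw [two_mul]; rfl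

/-- Every character that agrees with `χ₀` on `U` takes the value `θ i` at `a i` for some `i ∈ s`. -/
def CharCovers (U : AddSubgroup A) (χ₀ : AddChar A ℂ) (s : Finset ι) : Prop :=
  ∀ χ : AddChar A ℂ, (∀ u ∈ U, χ u = χ₀ u) → ∃ i ∈ s, χ (a i) = θ i

variable {a θ}

omit [Finite A] in
theorem CharCovers.nonempty {U : AddSubgroup A} {χ₀ : AddChar A ℂ} {s : Finset ι}
    (h : CharCovers a θ U χ₀ s) : s.Nonempty := by
  obtain ⟨i, hi, -⟩ := h χ₀ fun _ _ => rfl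
  exact ⟨i, hi⟩

omit [Finite A] in
-- Doubling x repeatedly ends in U; the last multiple outside U is the one wanted. This is the only
-- place where the exponent of the group matters.
theorem exists_two_pow_smul_notMem {N : ℕ} (hA : ∀ x : A, 2 ^ N • x = 0) (U : AddSubgroup A)
    {x : A} (hx : x ∉ U) : ∃ k : ℕ, 2 ^ k • x ∉ U ∧ 2 • (2 ^ k • x) ∈ U := by
  classical
  have hex : ∃ k : ℕ, 2 ^ k • x ∈ U := ⟨N, by rw [hA]; exact U.zero_mem⟩
  have h0 : Nat.find hex ≠ 0 := fun h => hx (by simpa [h] using Nat.find_spec hex)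
  refine ⟨Nat.find hex - 1, Nat.find_min hex (by omega), ?_⟩
  have := Nat.find_spec hex
  rwa [← mul_smul, ← pow_succ', Nat.sub_add_cancel (Nat.pos_of_ne_zero h0)]

/-- The bound of Mycielski for irredundant coverings by cosets, in a 2-group of characters. -/
theorem CharCovers.card_le {N : ℕ} (hA : ∀ x : A, 2 ^ N • x = 0) (s : Finset ι) :
    ∀ (U : AddSubgroup A) (χ₀ : AddChar A ℂ), Minimal (CharCovers a θ U χ₀) s →
      2 * Nat.card ↥(U ⊔ AddSubgroup.closure (a '' s)) ≤ 2 ^ s.card * Nat.card U := by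
  classical
  induction s using Finset.strongInductionOn with
  | _ s ih =>
    intro U χ₀ hs
    set sp : Finset ι → AddSubgroup A := fun t => U ⊔ AddSubgroup.closure (a '' t) with hsp
    have hunion : ∀ t r : Finset ι, sp t ⊔ AddSubgroup.closure (a '' r) = sp (t ∪ r) := by
      intro t r
      simp only [hsp, sup_assoc, Finset.coe_union, Set.image_union, AddSubgroup.closure_union]
    -- A proper part W that satisfies the bound without the factor 2 can be enlarged, with the
    -- factor 2 regained. By minimality some character is missed by W; so is each character that
    -- agrees with it on `sp W`, and hence s \ W covers that coset. The induction hypothesis applies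
    -- to a minimal subcover, which is smaller than s because W is non-empty.
    have stepA : ∀ W ⊂ s, W.Nonempty → Nat.card (sp W) ≤ 2 ^ W.card * Nat.card U →
        ∃ W' ⊆ s, W ⊂ W' ∧ 2 * Nat.card (sp W') ≤ 2 ^ W'.card * Nat.card U := by
      intro W hW hne hcard
      have hnot : ¬ CharCovers a θ U χ₀ W := fun h => hW.2 (hs.2 h hW.1)
      simp only [CharCovers, not_forall, not_exists, not_and] at hnot
      obtain ⟨χ₁, hχ₁, hW1⟩ := hnot
      have hcov : CharCovers a θ (sp W) χ₁ (s \ W) := by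
        intro χ hχ
        obtain ⟨i, hi, hi'⟩ := hs.1 χ fun u hu =>
          (hχ u (AddSubgroup.mem_sup_left hu)).trans (hχ₁ u hu)
        refine ⟨i, Finset.mem_sdiff.2 ⟨hi, fun hiW => hW1 i hiW ?_⟩, hi'⟩
        rw [← hi', hχ _ (AddSubgroup.mem_sup_right (AddSubgroup.subset_closure ⟨i, hiW, rfl⟩))]
      obtain ⟨I, hIle, hI⟩ := exists_minimal_le_of_wellFoundedLT _ _ hcov
      have hIle : I ⊆ s \ W := hIle
      have hdisj : Disjoint W I := by
        rw [Finset.disjoint_left]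
        exact fun i hi hi' => (Finset.mem_sdiff.1 (hIle hi')).2 hi
      have hIs : I ⊂ s := by
        obtain ⟨w, hw⟩ := hne
        exact ⟨fun i hi => (Finset.mem_sdiff.1 (hIle hi)).1,
          fun h => Finset.disjoint_left.1 hdisj hw (h (hW.1 hw))⟩
      have h1 := ih I hIs (sp W) χ₁ hI
      rw [hunion] at h1
      obtain ⟨j, hj⟩ := hI.1.nonempty
      refine ⟨W ∪ I, Finset.union_subset hW.1 hIs.1, ⟨Finset.subset_union_left, fun h =>
        Finset.disjoint_left.1 hdisj (h (Finset.mem_union_right _ hj)) hj⟩, h1.trans ?_⟩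
      rw [Finset.card_union_of_disjoint hdisj, pow_add]
      calc 2 ^ I.card * Nat.card (sp W) ≤ 2 ^ I.card * (2 ^ W.card * Nat.card U) :=
            Nat.mul_le_mul_left _ hcard
        _ = _ := by ring
    obtain ⟨i, hi⟩ := hs.1.nonempty
    -- If a i lies in U, the i-th condition is constant on the coset: either it never holds, and i
    -- is superfluous, or it always holds, and i alone is a cover.
    by_cases hiU : a i ∈ U
    · have hval : χ₀ (a i) = θ i := by
        by_contra hne
        have hcov : CharCovers a θ U χ₀ (s.erase i) := by
          intro χ hχ
          obtain ⟨j, hj, hj'⟩ := hs.1 χ hχ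
          refine ⟨j, Finset.mem_erase.2 ⟨?_, hj⟩, hj'⟩
          rintro rfl
          exact hne (by rw [← hj', hχ _ hiU])
        exact Finset.notMem_erase i s (hs.2 hcov (Finset.erase_subset _ _) hi)
      have hcov : CharCovers a θ U χ₀ {i} := fun χ hχ =>
        ⟨i, Finset.mem_singleton_self i, by rw [hχ _ hiU, hval]⟩
      have hsi : s = {i} :=
        le_antisymm (hs.2 hcov (Finset.singleton_subset_iff.2 hi)) (Finset.singleton_subset_iff.2 hi)
      have : U ⊔ AddSubgroup.closure (a '' s) = U := by
        rw [sup_eq_left, AddSubgroup.closure_le, hsi]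
        simpa using hiU
      rw [this, hsi]; simp
    -- To find a first W, fix the value of the characters at a multiple h of a i so that the i-th
    -- condition fails. This costs at most a factor 2 in the order of U, which is exactly what the
    -- induction hypothesis for the remaining conditions gains.
    · obtain ⟨k, hk, hk2⟩ := exists_two_pow_smul_notMem hA U hiU
      set h := 2 ^ k • a i with hh
      obtain ⟨χ₁, hχ₁, hχ₁h⟩ : ∃ χ₁ : AddChar A ℂ, (∀ u ∈ U, χ₁ u = χ₀ u) ∧
          χ₁ h ≠ θ i ^ 2 ^ k := by
        by_cases hc : χ₀ h = θ i ^ 2 ^ k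
        · obtain ⟨ψ, hψ, hψh⟩ := exists_addChar_trivial_on_apply_ne_one U hk
          refine ⟨χ₀ * ψ, fun u hu => by rw [AddChar.mul_apply, hψ u hu, mul_one], ?_⟩
          rw [AddChar.mul_apply, ← hc]
          intro h'
          have hne : χ₀ h ≠ 0 := (χ₀.val_isUnit h).ne_zero
          exact hψh (mul_left_cancel₀ hne (by rw [h', mul_one]))
        · exact ⟨χ₀, fun _ _ => rfl, hc⟩
      set U' := U ⊔ AddSubgroup.zmultiples h with hU'
      have hcov : CharCovers a θ U' χ₁ (s.erase i) := by
        intro χ hχ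
        obtain ⟨j, hj, hj'⟩ := hs.1 χ fun u hu =>
          (hχ u (AddSubgroup.mem_sup_left hu)).trans (hχ₁ u hu)
        refine ⟨j, Finset.mem_erase.2 ⟨?_, hj⟩, hj'⟩
        rintro rfl
        refine hχ₁h ?_
        rw [← hj', ← AddChar.map_nsmul_eq_pow, ← hh,
          hχ h (AddSubgroup.mem_sup_right (AddSubgroup.mem_zmultiples h))]
      obtain ⟨I, hIle, hI⟩ := exists_minimal_le_of_wellFoundedLT _ _ hcov
      have hIle : I ⊆ s.erase i := hIle
      have hIs : I ⊂ s := lt_of_le_of_lt hIle (Finset.erase_ssubset hi)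
      have h1 := ih I hIs U' χ₁ hI
      have h2 : Nat.card (sp I) ≤ 2 ^ I.card * Nat.card U := by
        have h3 : Nat.card (sp I) ≤ Nat.card ↥(U' ⊔ AddSubgroup.closure (a '' I)) :=
          Nat.card_mono (Set.toFinite _) (sup_le_sup_right le_sup_left _ :
            sp I ≤ U' ⊔ AddSubgroup.closure (a '' I))
        have h4 := card_sup_zmultiples_le U hk2
        have : 2 * Nat.card (sp I) ≤ 2 * (2 ^ I.card * Nat.card U) :=
          calc 2 * Nat.card (sp I) ≤ 2 ^ I.card * Nat.card U' :=
                (Nat.mul_le_mul_left 2 h3).trans h1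
            _ ≤ 2 ^ I.card * (2 * Nat.card U) := Nat.mul_le_mul_left _ h4
            _ = _ := by ring
        omega
      -- Enlarging a proper W of maximal size can only lead to s itself.
      let F := s.powerset.filter fun W => W ⊂ s ∧ W.Nonempty ∧
        Nat.card (sp W) ≤ 2 ^ W.card * Nat.card U
      have hF : F.Nonempty := ⟨I, by
        simp only [F, Finset.mem_filter, Finset.mem_powerset]
        exact ⟨hIs.1, hIs, hI.1.nonempty, h2⟩⟩
      obtain ⟨W, hWF, hWmax⟩ := Finset.exists_max_image F Finset.card hF
      simp only [F, Finset.mem_filter, Finset.mem_powerset] at hWF hWmax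
      obtain ⟨W', hW's, hWW', hcard⟩ := stepA W hWF.2.1 hWF.2.2.1 hWF.2.2.2
      rcases eq_or_ne W' s with rfl | hne
      · exact hcard
      · exfalso
        have := hWmax W' ⟨hW's, hW's.ssubset_of_ne hne, hWF.2.2.1.mono hWW'.1, by omega⟩
        exact absurd (Finset.card_lt_card hWW') (by omega)

end CharacterCoverings

/-! ### Hajós's theorem for cubes of side 2 -/

section Hajos

/-- The product of the factors 1 + χ(a i) expands to the sum of χ over the group, which vanishes for
χ ≠ 1. -/
theorem exists_addChar_apply_eq_neg_one {A : Type u} [AddCommGroup A] [Finite A] {ι : Type v}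
    [Fintype ι] {a : ι → A} (ha : Function.Bijective fun s : Finset ι => ∑ i ∈ s, a i)
    {χ : AddChar A ℂ} (hχ : χ ≠ 1) : ∃ i, χ (a i) = -1 := by
  classical
  have := Fintype.ofFinite A
  have h1 : ∏ i, (1 + χ (a i)) = ∑ x, χ x := by
    rw [Finset.prod_one_add, Finset.powerset_univ, ← ha.sum_comp (fun x => χ x)]
    exact Finset.sum_congr rfl fun s _ => by
      have h := map_prod χ.toMonoidHom (fun i => Multiplicative.ofAdd (a i)) s
      rw [← ofAdd_sum] at h
      exact h.symm
  rw [AddChar.sum_eq_zero_of_ne_one hχ, Finset.prod_eq_zero_iff] at h1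
  obtain ⟨i, -, hi⟩ := h1
  exact ⟨i, by linear_combination hi⟩

/-- Hajós's theorem for factorizations into subsets with two elements. -/
theorem exists_two_smul_eq_zero_of_bijective_sum (n : ℕ) :
    ∀ (A : Type u) [AddCommGroup A] [Finite A] (ι : Type v) [Fintype ι] (a : ι → A),
      Fintype.card ι = n → Nonempty ι → Function.Bijective (fun s : Finset ι => ∑ i ∈ s, a i) →
        ∃ i, 2 • a i = 0 := by
  classical
  induction n using Nat.strong_induction_on with
  | _ n ih =>
    intro A _ _ ι _ a hn hne ha
    obtain ⟨i₀⟩ := hne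
    by_contra! hno
    have hcardA : Nat.card A = 2 ^ n := by
      rw [← Nat.card_congr (Equiv.ofBijective _ ha), Nat.card_eq_fintype_card, Fintype.card_finset,
        hn]
    have hA : ∀ x : A, 2 ^ n • x = 0 := fun x => by
      rw [← hcardA]; exact card_nsmul_eq_zero'
    obtain ⟨k, hk, hk2⟩ := exists_two_pow_smul_notMem hA ⊥ (x := 2 • a i₀)
      (by rw [AddSubgroup.mem_bot]; exact hno i₀)
    rw [AddSubgroup.mem_bot] at hk2
    -- h has order 2 and is an even multiple of a i₀. A character that is -1 at a i₀ is therefore 1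
    -- at h, so that the characters with the value χ₁ h ≠ 1 at h are covered without the help of i₀.
    set h := 2 ^ k • 2 • a i₀ with hh
    obtain ⟨χ₁, -, hχ₁⟩ := exists_addChar_trivial_on_apply_ne_one ⊥ hk
    set U := AddSubgroup.zmultiples h with hU
    have hUcard : Nat.card U ≤ 2 := by
      have := card_sup_zmultiples_le (⊥ : AddSubgroup A) (h := h) (by rw [hk2]; exact zero_mem _)
      rwa [bot_sup_eq, AddSubgroup.card_bot] at this
    have hcov : CharCovers a (fun _ => -1) U χ₁ (Finset.univ.erase i₀) := by
      intro χ hχ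
      have hχh := hχ h (AddSubgroup.mem_zmultiples h)
      obtain ⟨i, hi⟩ := exists_addChar_apply_eq_neg_one ha (χ := χ) (by
        rintro rfl
        exact hχ₁ (by rw [← hχh, AddChar.one_apply]))
      refine ⟨i, Finset.mem_erase.2 ⟨?_, Finset.mem_univ i⟩, hi⟩
      rintro rfl
      apply hχ₁
      rw [← hχh, hh, AddChar.map_nsmul_eq_pow, AddChar.map_nsmul_eq_pow, hi]
      simp
    obtain ⟨T, hTle, hT⟩ := exists_minimal_le_of_wellFoundedLT _ _ hcov
    have hTle : T ⊆ Finset.univ.erase i₀ := hTle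
    -- The factor 2 in `CharCovers.card_le` cancels against the order of U.
    have hcard : Nat.card ↥(AddSubgroup.closure (a '' T)) ≤ 2 ^ T.card := by
      have h1 := hT.1.nonempty
      have h2 := CharCovers.card_le hA T U χ₁ hT
      have h3 : Nat.card ↥(AddSubgroup.closure (a '' T)) ≤
          Nat.card ↥(U ⊔ AddSubgroup.closure (a '' T)) :=
        Nat.card_mono (Set.toFinite _) (le_sup_right :
          AddSubgroup.closure (a '' T) ≤ U ⊔ AddSubgroup.closure (a '' T))
      have h4 : 2 ^ T.card * Nat.card U ≤ 2 ^ T.card * 2 := Nat.mul_le_mul_left _ hUcard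
      omega
    have hTn : T.card < n := by
      rw [← hn, ← Finset.card_univ]
      exact Finset.card_lt_card (lt_of_le_of_lt hTle (Finset.erase_ssubset (Finset.mem_univ _)))
    let b : T → AddSubgroup.closure (a '' T) := fun i =>
      ⟨a i, AddSubgroup.subset_closure ⟨i, i.2, rfl⟩⟩
    -- Sums over different subsets of T stay different, and the generated subgroup has no room for
    -- more elements; so T factorizes a smaller group and the induction applies.
    have hinj : Function.Injective fun s : Finset T => ∑ i ∈ s, b i := by
      intro s t hst
      have h1 := congrArg (Subtype.val) hst
      simp only [AddSubgroup.val_finsetSum, b] at h1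
      have h2 : ∀ s : Finset T, ∑ i ∈ s, a i = ∑ i ∈ s.map (Function.Embedding.subtype _), a i :=
        fun s => by rw [Finset.sum_map]; rfl
      rw [h2 s, h2 t] at h1
      exact Finset.map_injective _ (ha.1 h1)
    have hbij : Function.Bijective fun s : Finset T => ∑ i ∈ s, b i := by
      have := Fintype.ofFinite ↥(AddSubgroup.closure (a '' T))
      refine (Fintype.bijective_iff_injective_and_card _).2 ⟨hinj, le_antisymm
        (Fintype.card_le_of_injective _ hinj) ?_⟩
      rw [Fintype.card_finset, Fintype.card_coe, ← Nat.card_eq_fintype_card]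
      exact hcard
    obtain ⟨t, ht⟩ := hT.1.nonempty
    obtain ⟨i, hi⟩ := ih T.card hTn _ _ b (Fintype.card_coe T) ⟨⟨t, ht⟩⟩ hbij
    exact hno i (by simpa [b] using congrArg Subtype.val hi)

/-- The translates of the cube `{0, 1}^ι` by the elements of `L` tile `ℤ^ι`. -/
def TilesCubes {ι : Type v} (L : Set (ι → ℤ)) : Prop :=
  ∀ c : ι → ℤ, ∃! z : ι → ℤ, z ∈ L ∧ ∀ i, z i = c i ∨ z i = c i + 1

/-- Both points lie in the cube whose lowest corner is their coordinatewise minimum. -/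
theorem TilesCubes.eq_of_abs_sub_le_one {ι : Type v} {L : Set (ι → ℤ)} (hL : TilesCubes L)
    {z w : ι → ℤ} (hz : z ∈ L) (hw : w ∈ L) (h : ∀ i, |z i - w i| ≤ 1) : z = w := by
  refine (hL fun i => min (z i) (w i)).unique ⟨hz, fun i => ?_⟩ ⟨hw, fun i => ?_⟩ <;>
  · have := abs_le.1 (h i)
    omega

/-- That L tiles means that each class of ℤ^ι modulo L has exactly one representative in {0, 1}^ι,
so the classes of the unit vectors factorize the quotient, and Hajós's theorem applies to them. -/
theorem TilesCubes.exists_single_two_mem {ι : Type v} [Fintype ι] [DecidableEq ι] [Nonempty ι]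
    (L : Submodule ℤ (ι → ℤ)) (hL : TilesCubes (L : Set (ι → ℤ))) :
    ∃ i, (Pi.single i 2 : ι → ℤ) ∈ L := by
  let a : ι → (ι → ℤ) ⧸ L := fun i => L.mkQ (Pi.single i 1)
  have hsum : ∀ s : Finset ι, ∑ i ∈ s, a i = L.mkQ (fun i => if i ∈ s then 1 else 0) := by
    intro s
    rw [← map_sum]
    congr 1
    ext j
    simp [Finset.sum_apply, Pi.single_apply]
  have hbij : Function.Bijective fun s : Finset ι => ∑ i ∈ s, a i := by
    constructor
    · intro s t hst
      simp only [hsum] at hst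
      rw [← sub_eq_zero, ← map_sub, Submodule.mkQ_apply, Submodule.Quotient.mk_eq_zero] at hst
      have := hL.eq_of_abs_sub_le_one hst L.zero_mem fun i => by
        simp only [Pi.sub_apply, Pi.zero_apply]; split_ifs <;> simp
      ext i
      have hi := congrFun this i
      simp only [Pi.sub_apply, Pi.zero_apply] at hi
      split_ifs at hi <;> simp_all
    · intro x
      obtain ⟨c, rfl⟩ := L.mkQ_surjective x
      -- The corner is c - 1 because the representative in {0, 1}^ι is the difference c - z.
      obtain ⟨z, ⟨hz, hzc⟩, -⟩ := hL fun i => c i - 1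
      refine ⟨Finset.univ.filter fun i => z i = c i - 1, ?_⟩
      simp only [hsum]
      rw [← sub_eq_zero, ← map_sub, Submodule.mkQ_apply, Submodule.Quotient.mk_eq_zero]
      convert L.neg_mem hz using 1
      ext i
      simp only [Pi.sub_apply, Pi.neg_apply, Finset.mem_filter, Finset.mem_univ, true_and]
      rcases hzc i with h | h <;> rw [h] <;> simp
      omega
  have : Finite ((ι → ℤ) ⧸ L) := Finite.of_surjective _ hbij.2
  obtain ⟨i, hi⟩ := exists_two_smul_eq_zero_of_bijective_sum _ _ ι a rfl inferInstance hbij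
  refine ⟨i, ?_⟩
  rw [← map_nsmul, Submodule.mkQ_apply, Submodule.Quotient.mk_eq_zero] at hi
  convert hi using 1
  ext j
  simp [Pi.single_apply]

end Hajos

/-! ### Integral forms that embed as 2-cube tilings -/

section Cubical

/-- The form `B` on `M` is the pull-back of the dot product along a homomorphism to some `ℤⁿ` whose
image tiles `ℤⁿ` by translates of the cube `{0, 1}ⁿ`. -/
def Cubical (M : Type u) [AddCommGroup M] (B : M → M → ℤ) : Prop :=
  ∃ (n : ℕ) (φ : M →+ (Fin n → ℤ)), (∀ x y, φ x ⬝ᵥ φ y = B x y) ∧ TilesCubes (Set.range φ)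

variable {M : Type u} [AddCommGroup M] {N : Type v} [AddCommGroup N]

theorem TilesCubes.image_equiv {ι κ : Type*} (e : ι ≃ κ) {L : Set (ι → ℤ)} (hL : TilesCubes L) :
    TilesCubes ((fun (z : ι → ℤ) (k : κ) => z (e.symm k)) '' L) := by
  intro c
  obtain ⟨z, ⟨hz, hzc⟩, huniq⟩ := hL fun i => c (e i)
  refine ⟨fun k => z (e.symm k), ⟨⟨z, hz, rfl⟩, fun k => by simpa using hzc (e.symm k)⟩, ?_⟩
  rintro _ ⟨⟨w, hw, rfl⟩, hwc⟩
  rw [huniq w ⟨hw, fun i => by simpa using hwc (e i)⟩]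

/-- Reindexing of integer vectors along a map of the index types. -/
def reindexHom {ι κ : Type*} (f : κ → ι) : (ι → ℤ) →+ (κ → ℤ) where
  toFun x k := x (f k)
  map_zero' := rfl
  map_add' _ _ := rfl

theorem Cubical.of_fintype {ι : Type*} [Fintype ι] {B : M → M → ℤ} (φ : M →+ (ι → ℤ))
    (hφ : ∀ x y, φ x ⬝ᵥ φ y = B x y) (ht : TilesCubes (Set.range φ)) : Cubical M B := by
  let e := Fintype.equivFin ι
  refine ⟨Fintype.card ι, (reindexHom e.symm).comp φ, fun x y => ?_, ?_⟩
  · rw [← hφ x y]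
    exact e.symm.sum_comp fun i => φ x i * φ y i
  · have := ht.image_equiv e
    rwa [← Set.range_comp] at this

theorem eq_zero_of_dotProduct_self {ι : Type*} [Fintype ι] {x : ι → ℤ} (h : x ⬝ᵥ x = 0) : x = 0 :=
  dotProduct_self_eq_zero.1 h

/-- A vector in the kernel of r has norm 0, so any φ with the right form kills it and factors
through r. Degenerate forms are admitted so that projections of a lattice need no quotient. -/
theorem Cubical.comp_iff {BM : M → M → ℤ} {BN : N → N → ℤ} (r : M →+ N)
    (hr : Function.Surjective r) (hB : ∀ x y, BM x y = BN (r x) (r y)) :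
    Cubical M BM ↔ Cubical N BN := by
  constructor
  · rintro ⟨n, φ, hφ, ht⟩
    have hker : r.ker ≤ φ.ker := by
      intro x hx
      rw [AddMonoidHom.mem_ker] at hx ⊢
      apply eq_zero_of_dotProduct_self
      rw [hφ, hB, hx, ← map_zero r, ← hB, ← hφ]
      simp
    let ψ : N →+ (Fin n → ℤ) := r.liftOfSurjective hr ⟨φ, hker⟩
    have hψ : ∀ x, ψ (r x) = φ x :=
      fun x => r.liftOfRightInverse_comp_apply _ (Function.rightInverse_surjInv hr) ⟨φ, hker⟩ x
    refine ⟨n, ψ, fun x y => ?_, ?_⟩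
    · obtain ⟨x, rfl⟩ := hr x
      obtain ⟨y, rfl⟩ := hr y
      rw [hψ, hψ, hφ, hB]
    · have : Set.range ψ = Set.range φ := by
        rw [← hr.range_comp]
        exact congrArg _ (funext hψ)
      rwa [this]
  · rintro ⟨n, φ, hφ, ht⟩
    refine ⟨n, φ.comp r, fun x y => by rw [hB, ← hφ]; rfl, ?_⟩
    rwa [AddMonoidHom.coe_comp, hr.range_comp]

theorem abs_le_one_of_dotProduct_self_le {ι : Type*} [Fintype ι] {x : ι → ℤ} (h : x ⬝ᵥ x ≤ 3)
    (i : ι) : |x i| ≤ 1 := by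
  have h1 : x i * x i ≤ x ⬝ᵥ x :=
    Finset.single_le_sum (f := fun i => x i * x i) (fun j _ => mul_self_nonneg (x j))
      (Finset.mem_univ i)
  rw [abs_le]
  constructor <;> nlinarith

/-- Norm at most 3 forces all coordinates into {-1, 0, 1}, which is too close to the lattice point
0. -/
theorem TilesCubes.eq_zero_of_dotProduct_self_le {ι : Type*} [Fintype ι] {φ : M →+ (ι → ℤ)}
    (ht : TilesCubes (Set.range φ)) {x : M} (h : φ x ⬝ᵥ φ x ≤ 3) : φ x = 0 :=
  ht.eq_of_abs_sub_le_one ⟨x, rfl⟩ ⟨0, map_zero φ⟩ fun i => by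
    simpa using abs_le_one_of_dotProduct_self_le h i

theorem Cubical.norm_eq_zero {B : M → M → ℤ} (h : Cubical M B) {x : M} (hx : B x x ≤ 3) :
    B x x = 0 := by
  obtain ⟨n, φ, hφ, ht⟩ := h
  rw [← hφ, ht.eq_zero_of_dotProduct_self_le (by rwa [hφ]), zero_dotProduct]

/-- Forgetting a coordinate `i` with `2 eᵢ` in the image. -/
theorem TilesCubes.drop {n : ℕ} {φ : M →+ (Fin (n + 1) → ℤ)} (ht : TilesCubes (Set.range φ))
    {w : M} {i : Fin (n + 1)} (hw : φ w = Pi.single i 2) :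
    TilesCubes (Set.range ((reindexHom i.succAbove).comp φ)) := by
  intro c
  obtain ⟨z, ⟨⟨x, rfl⟩, hx⟩, -⟩ := ht (i.insertNth 0 c)
  have key : ∀ y : M, ∃ k : ℤ, φ (y + k • w) i = 0 ∨ φ (y + k • w) i = 1 := by
    intro y
    -- The floor of the quotient leaves the remainder mod 2 in coordinate i. It then lies in {0, 1},
    -- as for the point found with the inserted corner coordinate 0, and uniqueness in the larger
    -- lattice applies.
    refine ⟨-(φ y i / 2), ?_⟩
    rw [map_add, map_zsmul, hw]
    simp only [Pi.add_apply, Pi.smul_apply, Pi.single_eq_same, smul_eq_mul]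
    omega
  refine ⟨_, ⟨⟨x, rfl⟩, fun j => by
    have := hx (i.succAbove j)
    rwa [Fin.insertNth_apply_succAbove] at this⟩, ?_⟩
  rintro _ ⟨⟨y, rfl⟩, hy⟩
  obtain ⟨k, hk⟩ := key y
  have hj : ∀ j, φ (y + k • w) (i.succAbove j) = φ y (i.succAbove j) := by
    intro j
    rw [map_add, map_zsmul, hw]
    simp
  have heq : φ (y + k • w) = φ x := by
    refine ht.eq_of_abs_sub_le_one ⟨_, rfl⟩ ⟨_, rfl⟩ fun l => ?_
    rw [abs_le]
    rcases Fin.eq_self_or_eq_succAbove i l with rfl | ⟨j, rfl⟩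
    · have h1 := hx l
      rw [Fin.insertNth_apply_same] at h1
      omega
    · have h1 := hx (i.succAbove j)
      rw [Fin.insertNth_apply_succAbove] at h1
      have h2 : φ y (i.succAbove j) = c j ∨ φ y (i.succAbove j) = c j + 1 := hy j
      rw [hj]
      omega
  ext j
  change φ y (i.succAbove j) = φ x (i.succAbove j)
  rw [← hj, heq]

theorem dotProduct_eq_add_drop {n : ℕ} (x y : Fin (n + 1) → ℤ) (i : Fin (n + 1)) :
    reindexHom i.succAbove x ⬝ᵥ reindexHom i.succAbove y = x ⬝ᵥ y - x i * y i := by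
  rw [eq_sub_iff_add_eq, add_comm]
  rw [dotProduct, dotProduct, Fin.sum_univ_succAbove _ i]; rfl

/-- Adding a coordinate `s` to a homomorphism to `ℤⁿ`. -/
def consHom {n : ℕ} (s : M →+ ℤ) (ψ : M →+ (Fin n → ℤ)) : M →+ (Fin (n + 1) → ℤ) where
  toFun x := Fin.cons (s x) (ψ x)
  map_zero' := by ext j; refine Fin.cases ?_ (fun j => ?_) j <;> simp
  map_add' x y := by ext j; refine Fin.cases ?_ (fun j => ?_) j <;> simp

/-- Adding a coordinate `s` that takes the value 2 on the kernel but not the value 1. -/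
theorem TilesCubes.cons {n : ℕ} {ψ : M →+ (Fin n → ℤ)} (ht : TilesCubes (Set.range ψ))
    (s : M →+ ℤ) {w : M} (hw : ψ w = 0) (hsw : s w = 2)
    (hs : ∀ u, ψ u = 0 → |s u| ≤ 1 → s u = 0) : TilesCubes (Set.range (consHom s ψ)) := by
  intro c
  obtain ⟨z, ⟨⟨x, rfl⟩, hx⟩, huniq⟩ := ht fun j => c j.succ
  -- The multiple of w moves the new coordinate, in steps of 2, to c 0 or c 0 + 1; the other
  -- coordinates do not notice.
  set x' := x + ((c 0 + 1 - s x) / 2) • w with hx'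
  have hψ : ψ x' = ψ x := by rw [hx', map_add, map_zsmul, hw, smul_zero, add_zero]
  have hs' : s x' = c 0 ∨ s x' = c 0 + 1 := by
    rw [hx', map_add, map_zsmul, hsw, smul_eq_mul]; omega
  refine ⟨_, ⟨⟨x', rfl⟩, Fin.forall_fin_succ.2 ⟨hs', fun j => ?_⟩⟩, ?_⟩
  · change ψ x' j = _ ∨ ψ x' j = _
    rw [hψ]; exact hx j
  · rintro _ ⟨⟨y, rfl⟩, hy⟩
    rw [Fin.forall_fin_succ] at hy
    have h0 : s y = c 0 ∨ s y = c 0 + 1 := hy.1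
    have h1 : ψ y = ψ x' := (huniq _ ⟨⟨y, rfl⟩, hy.2⟩).trans hψ.symm
    have h2 := hs (y - x') (by rw [map_sub, h1, sub_self]) (by rw [map_sub, abs_le]; omega)
    rw [map_sub, sub_eq_zero] at h2
    change (Fin.cons (s y) (ψ y) : Fin (n + 1) → ℤ) = Fin.cons (s x') (ψ x')
    rw [h1, h2]

theorem dotProduct_consHom {n : ℕ} (s : M →+ ℤ) (ψ : M →+ (Fin n → ℤ)) (x y : M) :
    consHom s ψ x ⬝ᵥ consHom s ψ y = ψ x ⬝ᵥ ψ y + s x * s y := by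
  rw [dotProduct, Fin.sum_univ_succ, add_comm]; rfl

/-- The inverse of projecting along a vector of norm 4: s becomes a new coordinate. Adding w moves s
by 2, which gives existence of a point in each cube; that s avoids ±1 on the null vectors of the
projected form gives uniqueness. -/
theorem Cubical.lift {B : M → M → ℤ} {BN : N → N → ℤ} (hN : Cubical N BN) (r : M →+ N)
    (hr : Function.Surjective r) (s : M →+ ℤ)
    (hB : ∀ x y, B x y = BN (r x) (r y) + s x * s y) {w : M} (hw : BN (r w) (r w) = 0)
    (hsw : s w = 2) (hs : ∀ u, BN (r u) (r u) = 0 → |s u| ≤ 1 → s u = 0) : Cubical M B := by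
  obtain ⟨n, ψ, hψ, ht⟩ := hN
  have ht' : TilesCubes (Set.range (ψ.comp r)) := by rwa [AddMonoidHom.coe_comp, hr.range_comp]
  have h0 : ψ (r w) = 0 := eq_zero_of_dotProduct_self (by rw [hψ, hw])
  refine ⟨n + 1, _, fun x y => ?_, ht'.cons s (w := w) h0 hsw fun u hu => hs u ?_⟩
  · rw [dotProduct_consHom, hB, ← hψ]; rfl
  · rw [← hψ]
    have : ψ (r u) = 0 := hu
    rw [this, zero_dotProduct]

/-- The form has a vector of norm 4 that has even products with all vectors, and the orthogonal
projection along this vector is again cubical. -/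
theorem Cubical.exists_norm_four {B : M → M → ℤ} (h : Cubical M B) (hB : ∃ x, B x x ≠ 0) :
    ∃ (w : M) (s : M →+ ℤ), B w w = 4 ∧ (∀ x, B w x = 2 * s x) ∧
      Cubical M fun x y => B x y - s x * s y := by
  obtain ⟨n, φ, hφ, ht⟩ := h
  obtain _ | n := n
  · obtain ⟨x, hx⟩ := hB
    exact absurd (by rw [← hφ]; simp [dotProduct]) hx
  obtain ⟨i, w, hw⟩ :=
    TilesCubes.exists_single_two_mem (LinearMap.range φ.toIntLinearMap) (by
      convert ht using 1; ext; simp)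
  replace hw : φ w = Pi.single i 2 := hw
  refine ⟨w, (Pi.evalAddMonoidHom _ i).comp φ, ?_, fun x => ?_, n, _, fun x y => ?_, ht.drop hw⟩
  · rw [← hφ, hw]; simp
  · rw [← hφ, hw]; simp
  · rw [AddMonoidHom.comp_apply, AddMonoidHom.comp_apply, dotProduct_eq_add_drop _ _ i, hφ]; rfl

/-- The condition on null vectors in `Cubical.lift` holds here because such a vector with |s| ≤ 1
has norm at most 1 in the original lattice, and hence is sent to 0. -/
theorem Cubical.of_prod_drop {B₁ : M → M → ℤ} {B₂ : N → N → ℤ} {n : ℕ}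
    (φ : M × N →+ (Fin n → ℤ)) (hφ : ∀ x y, φ x ⬝ᵥ φ y = B₁ x.1 y.1 + B₂ x.2 y.2)
    (h₂ : B₂ 0 0 = 0) (ht : TilesCubes (Set.range φ)) {i : Fin n} {w : M}
    (hw : φ (w, 0) = Pi.single i 2)
    (h : Cubical M fun x y => B₁ x y - φ (x, 0) i * φ (y, 0) i) : Cubical M B₁ := by
  have hB : ∀ x, B₁ x x = φ (x, 0) ⬝ᵥ φ (x, 0) := fun x => by rw [hφ, h₂, add_zero]
  refine h.lift (AddMonoidHom.id M) Function.surjective_id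
    (((Pi.evalAddMonoidHom _ i).comp φ).comp (AddMonoidHom.inl M N)) (w := w) (fun x y => ?_)
    ?_ ?_ fun u hu hu' => ?_
  · simp
  · simp [hB, hw]
  · simp [hw]
  · have h1 : |φ (u, 0) i| ≤ 1 := hu'
    have h2 : φ (u, 0) ⬝ᵥ φ (u, 0) = φ (u, 0) i * φ (u, 0) i := by
      rw [← hB]; simpa [sub_eq_zero] using hu
    have h3 : φ (u, 0) = 0 := by
      refine ht.eq_zero_of_dotProduct_self_le ?_
      rw [h2]
      have := abs_le.1 h1
      nlinarith
    change φ (u, 0) i = 0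
    rw [h3]; rfl

/-- Induction on the dimension. The vector 2eᵢ must lie in one summand; by orthogonality the
coordinate i then vanishes on the other. After this coordinate is dropped, the image still comes
from an orthogonal sum, and the coordinate is put back on the one summand that it belongs to. -/
theorem Cubical.prod_aux (n : ℕ) : ∀ {B₁ : M → M → ℤ} {B₂ : N → N → ℤ}
    (φ : M × N →+ (Fin n → ℤ)), (∀ x y, φ x ⬝ᵥ φ y = B₁ x.1 y.1 + B₂ x.2 y.2) →
    B₁ 0 0 = 0 → B₂ 0 0 = 0 →
    TilesCubes (Set.range φ) → Cubical M B₁ ∧ Cubical N B₂ := by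
  induction n with
  | zero =>
    intro B₁ B₂ φ hφ h₁ h₂ ht
    refine ⟨⟨0, 0, fun x y => ?_, fun c => ⟨0, ⟨⟨0, rfl⟩, fun i => i.elim0⟩,
        fun y _ => Subsingleton.elim _ _⟩⟩, ⟨0, 0, fun x y => ?_, fun c => ⟨0, ⟨⟨0, rfl⟩,
        fun i => i.elim0⟩, fun y _ => Subsingleton.elim _ _⟩⟩⟩
    · have := hφ (x, 0) (y, 0)
      rw [h₂, add_zero] at this
      rw [← this]; simp [dotProduct]
    · have := hφ (0, x) (0, y)
      rw [h₁, zero_add] at this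
      rw [← this]; simp [dotProduct]
  | succ n ih =>
    intro B₁ B₂ φ hφ h₁ h₂ ht
    obtain ⟨i, ⟨w₁, w₂⟩, hw⟩ :=
      TilesCubes.exists_single_two_mem (LinearMap.range φ.toIntLinearMap) (by
        convert ht using 1; ext; simp)
    replace hw : φ (w₁, w₂) = Pi.single i 2 := hw
    have hadd : ∀ x y, φ (x, y) = φ (x, 0) + φ (0, y) := fun x y => by
      rw [← map_add]; simp
    have hB₁ : ∀ x, B₁ x 0 = 0 := fun x => by
      have := hφ (x, 0) 0
      rw [map_zero, dotProduct_zero] at this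
      simpa [h₂] using this.symm
    have hB₂ : ∀ x, B₂ 0 x = 0 := fun x => by
      have := hφ 0 (0, x)
      rw [map_zero, zero_dotProduct] at this
      simpa [h₁] using this.symm
    have horth : ∀ x y, φ (x, 0) ⬝ᵥ φ (0, y) = 0 := fun x y => by
      rw [hφ, hB₁, hB₂, add_zero]
    have hdrop : ∀ x y, ((reindexHom i.succAbove).comp φ) x ⬝ᵥ ((reindexHom i.succAbove).comp φ) y
        = B₁ x.1 y.1 + B₂ x.2 y.2 - φ x i * φ y i := fun x y => by
      rw [AddMonoidHom.comp_apply, AddMonoidHom.comp_apply, dotProduct_eq_add_drop, hφ]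
    have hnorm : φ (w₁, 0) ⬝ᵥ φ (w₁, 0) + φ (0, w₂) ⬝ᵥ φ (0, w₂) = 4 := by
      have h4 : φ (w₁, w₂) ⬝ᵥ φ (w₁, w₂) = 4 := by rw [hw]; simp
      rw [hadd, add_dotProduct, dotProduct_add, dotProduct_add, horth,
        dotProduct_comm (φ (0, w₂)) (φ (w₁, 0)), horth] at h4
      linarith
    -- The norms of the two components add up to 4, so one of them is at most 3 and that component
    -- has image 0.
    have hcase : φ (0, w₂) = 0 ∨ φ (w₁, 0) = 0 := by
      rcases le_or_gt (φ (0, w₂) ⬝ᵥ φ (0, w₂)) 3 with h | h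
      · exact Or.inl (ht.eq_zero_of_dotProduct_self_le h)
      · exact Or.inr (ht.eq_zero_of_dotProduct_self_le (by omega))
    rcases hcase with hz | hz
    · have hw₁ : φ (w₁, 0) = Pi.single i 2 := by rw [← hw, hadd w₁ w₂, hz, add_zero]
      have hi : ∀ y, φ (0, y) i = 0 := fun y => by
        have := horth w₁ y
        rw [hw₁] at this
        simpa using this
      have key := ih (B₁ := fun x y => B₁ x y - φ (x, 0) i * φ (y, 0) i) (B₂ := B₂)
        ((reindexHom i.succAbove).comp φ) (fun x y => by
          rw [hdrop, ← Prod.mk.eta (p := x), ← Prod.mk.eta (p := y), hadd x.1, hadd y.1]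
          simp only [Pi.add_apply, hi]; ring) (by
          change B₁ 0 0 - φ 0 i * φ 0 i = 0
          simp [h₁]) h₂ (ht.drop hw)
      exact ⟨Cubical.of_prod_drop φ hφ h₂ ht hw₁ key.1, key.2⟩
    · have hw₂ : φ (0, w₂) = Pi.single i 2 := by rw [← hw, hadd w₁ w₂, hz, zero_add]
      have hi : ∀ x, φ (x, 0) i = 0 := fun x => by
        have := horth x w₂
        rw [hw₂] at this
        simpa using this
      have key := ih (B₁ := B₁) (B₂ := fun x y => B₂ x y - φ (0, x) i * φ (0, y) i)
        ((reindexHom i.succAbove).comp φ) (fun x y => by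
          rw [hdrop, ← Prod.mk.eta (p := x), ← Prod.mk.eta (p := y), hadd x.1, hadd y.1]
          simp only [Pi.add_apply, hi]; ring) h₁ (by
          change B₂ 0 0 - φ 0 i * φ 0 i = 0
          simp [h₂]) (ht.drop hw)
      refine ⟨key.1, Cubical.of_prod_drop (φ.comp (AddEquiv.prodComm (M := N) (N := M)).toAddMonoidHom)
        (fun x y => (hφ _ _).trans (add_comm _ _)) h₁ ?_ hw₂ key.2⟩
      rw [AddMonoidHom.coe_comp]
      exact (AddEquiv.prodComm (M := N) (N := M)).surjective.range_comp φ ▸ ht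

/-- The summands of an orthogonal sum that is cubical are cubical. -/
theorem Cubical.of_prod {B₁ : M → M → ℤ} {B₂ : N → N → ℤ} (h₁ : B₁ 0 0 = 0) (h₂ : B₂ 0 0 = 0)
    (h : Cubical (M × N) fun x y => B₁ x.1 y.1 + B₂ x.2 y.2) : Cubical M B₁ ∧ Cubical N B₂ := by
  obtain ⟨n, φ, hφ, ht⟩ := h
  exact Cubical.prod_aux n φ hφ h₁ h₂ ht

/-- An orthogonal sum of cubical forms is cubical. -/
theorem Cubical.pi {κ : Type*} [Fintype κ] {P : κ → Type*} [∀ k, AddCommGroup (P k)]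
    {B : ∀ k, P k → P k → ℤ} (h : ∀ k, Cubical (P k) (B k)) :
    Cubical (∀ k, P k) fun x y => ∑ k, B k (x k) (y k) := by
  choose n φ hφ ht using h
  refine Cubical.of_fintype (ι := Σ k, Fin (n k))
    { toFun := fun x i => φ i.1 (x i.1) i.2
      map_zero' := by ext; simp
      map_add' := fun x y => by ext; simp } (fun x y => ?_) fun c => ?_
  · change ∑ i : Σ k, Fin (n k), φ i.1 (x i.1) i.2 * φ i.1 (y i.1) i.2 = _
    rw [Fintype.sum_sigma]
    exact Finset.sum_congr rfl fun k _ => hφ k (x k) (y k)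
  · choose z hz huniq using fun k => ht k fun i => c ⟨k, i⟩
    choose x hx using fun k => (hz k).1
    refine ⟨fun i => z i.1 i.2, ⟨⟨x, ?_⟩, fun i => (hz i.1).2 i.2⟩, ?_⟩
    · ext i
      exact congrFun (hx i.1) i.2
    · rintro _ ⟨⟨y, rfl⟩, hy⟩
      ext i
      exact congrFun (huniq i.1 _ ⟨⟨y i.1, rfl⟩, fun j => hy ⟨i.1, j⟩⟩) i.2

end Cubical

theorem Cubical.prod {M : Type u} [AddCommGroup M] {N : Type v} [AddCommGroup N]
    {B₁ : M → M → ℤ} {B₂ : N → N → ℤ} (h₁ : Cubical M B₁) (h₂ : Cubical N B₂) :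
    Cubical (M × N) fun x y => B₁ x.1 y.1 + B₂ x.2 y.2 := by
  obtain ⟨n, φ, hφ, hn⟩ := h₁
  obtain ⟨m, ψ, hψ, hm⟩ := h₂
  refine Cubical.of_fintype (ι := Fin n ⊕ Fin m)
    { toFun := fun x => Sum.elim (φ x.1) (ψ x.2)
      map_zero' := by ext (i | i) <;> simp
      map_add' := fun x y => by ext (i | i) <;> simp } (fun x y => ?_) fun c => ?_
  · rw [← hφ, ← hψ]
    exact Fintype.sum_sum_type _
  · obtain ⟨_, ⟨⟨x, rfl⟩, hx⟩, hux⟩ := hn fun i => c (Sum.inl i)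
    obtain ⟨_, ⟨⟨y, rfl⟩, hy⟩, huy⟩ := hm fun i => c (Sum.inr i)
    refine ⟨_, ⟨⟨(x, y), rfl⟩, fun i => ?_⟩, ?_⟩
    · rcases i with i | i
      · exact hx i
      · exact hy i
    · rintro _ ⟨⟨z, rfl⟩, hz⟩
      have h1 := hux _ ⟨⟨z.1, rfl⟩, fun i => hz (Sum.inl i)⟩
      have h2 := huy _ ⟨⟨z.2, rfl⟩, fun i => hz (Sum.inr i)⟩
      change Sum.elim (φ z.1) (ψ z.2) = Sum.elim (φ x) (ψ y)
      rw [h1, h2]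

/-! ### Flows as antisymmetric functions on the darts -/

@[simp] theorem dartFlip_dartFlip {E : Type v} (d : E × Bool) : dartFlip E (dartFlip E d) = d := by
  obtain ⟨e, b⟩ := d
  cases b <;> rfl

@[simp] theorem dartFlip_fst {E : Type v} (d : E × Bool) : (dartFlip E d).1 = d.1 := rfl

@[simp] theorem dartFlip_mk {E : Type v} (e : E) (b : Bool) : dartFlip E (e, b) = (e, !b) := rfl

theorem dartFlip_ne {E : Type v} (d : E × Bool) : dartFlip E d ≠ d := by
  obtain ⟨e, b⟩ := d
  cases b <;> simp

theorem eq_or_eq_dartFlip {E : Type v} {a d : E × Bool} (h : a.1 = d.1) :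
    a = d ∨ a = dartFlip E d := by
  obtain ⟨e, b⟩ := a
  obtain ⟨e', b'⟩ := d
  obtain rfl : e = e' := h
  cases b <;> cases b' <;> simp

theorem dartFlip_eq_iff {E : Type v} {a d : E × Bool} : dartFlip E a = d ↔ a = dartFlip E d :=
  ⟨fun h => by rw [← h, dartFlip_dartFlip], fun h => by rw [h, dartFlip_dartFlip]⟩

namespace RotationSystem

section Flows

variable {V : Type u} {E : Type v} [Fintype E] {R : Type*} [AddCommGroup R]

open Classical in
/-- The sum of the values of a dart function over the darts at a vertex. -/
noncomputable def netFlow (G : RotationSystem V E) (y : E × Bool → R) (v : V) : R :=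
  ∑ d, if G.base d = v then y d else 0

/-- Flows with values in `R`: antisymmetric functions on the darts that satisfy the law of
conservation at each vertex. -/
def dartFlows (G : RotationSystem V E) (R : Type*) [AddCommGroup R] :
    AddSubgroup (E × Bool → R) where
  carrier := {y | (∀ d, y (dartFlip E d) = -y d) ∧ ∀ v, G.netFlow y v = 0}
  zero_mem' := by simp [netFlow]
  add_mem' := by
    rintro a b ⟨h1, h2⟩ ⟨h3, h4⟩
    refine ⟨fun d => by simp [h1, h3, add_comm], fun v => ?_⟩
    have := congrArg₂ (· + ·) (h2 v) (h4 v)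
    simp only [netFlow, ← Finset.sum_add_distrib, add_zero] at this ⊢
    refine (Finset.sum_congr rfl fun d _ => ?_).trans this
    split_ifs <;> simp
  neg_mem' := by
    rintro a ⟨h1, h2⟩
    refine ⟨fun d => by simp [h1], fun v => ?_⟩
    have := congrArg (- ·) (h2 v)
    simp only [netFlow, ← Finset.sum_neg_distrib, neg_zero] at this ⊢
    refine (Finset.sum_congr rfl fun d _ => ?_).trans this
    split_ifs <;> simp

theorem mem_dartFlows {G : RotationSystem V E} {y : E × Bool → R} : y ∈ G.dartFlows R ↔
    (∀ d, y (dartFlip E d) = -y d) ∧ ∀ v, G.netFlow y v = 0 := Iff.rfl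

theorem netFlow_add (G : RotationSystem V E) (y z : E × Bool → R) (v : V) :
    G.netFlow (y + z) v = G.netFlow y v + G.netFlow z v := by
  simp only [netFlow, ← Finset.sum_add_distrib]
  refine Finset.sum_congr rfl fun d _ => ?_
  split_ifs <;> simp

/-- The standard inner product of antisymmetric dart functions. -/
def dartForm (y z : E × Bool → ℤ) : ℤ := ∑ e, y (e, false) * z (e, false)

theorem sum_dart_mul {y z : E × Bool → ℤ} (hy : ∀ d, y (dartFlip E d) = -y d)
    (hz : ∀ d, z (dartFlip E d) = -z d) : ∑ d, y d * z d = 2 * dartForm y z := by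
  rw [Fintype.sum_prod_type, dartForm, Finset.mul_sum]
  refine Finset.sum_congr rfl fun e _ => ?_
  have h1 : y (e, true) = -y (e, false) := hy (e, false)
  have h2 : z (e, true) = -z (e, false) := hz (e, false)
  rw [Fintype.sum_bool, h1, h2]
  ring

theorem sq_le_dartForm {y : E × Bool → ℤ} (hy : ∀ d, y (dartFlip E d) = -y d) (d : E × Bool) :
    y d * y d ≤ dartForm y y := by
  have h : y d * y d = y (d.1, false) * y (d.1, false) := by
    obtain ⟨e, b⟩ := d
    cases b
    · rfl
    · have h1 : y (e, true) = -y (e, false) := hy (e, false)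
      rw [h1]; ring
  rw [h]
  exact Finset.single_le_sum (f := fun e => y (e, false) * y (e, false))
    (fun e _ => mul_self_nonneg _) (Finset.mem_univ _)

/-- The flow lattice is a 2-cube tiling lattice. -/
def CubicalFlow (G : RotationSystem V E) : Prop :=
  Cubical (G.dartFlows ℤ) fun y z => dartForm y.1 z.1

/-- The antisymmetric dart function of an edge function. -/
def signedDarts : (E → ℤ) →+ (E × Bool → ℤ) where
  toFun x d := bif d.2 then -x d.1 else x d.1
  map_zero' := by ext d; cases h : d.2 <;> simp
  map_add' x y := by ext d; cases h : d.2 <;> simp [h]; ring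

theorem boundary_apply (G : RotationSystem V E) (x : E → ℤ) (v : V) :
    G.boundary x v = -G.netFlow (signedDarts x) v := by
  classical
  rw [netFlow, Fintype.sum_prod_type, ← Finset.sum_neg_distrib, boundary,
    Fintype.linearCombination_apply, Finset.sum_apply]
  refine Finset.sum_congr rfl fun e _ => ?_
  simp only [Pi.smul_apply, Pi.sub_apply, Pi.single_apply, smul_eq_mul, Fintype.sum_bool,
    signedDarts, AddMonoidHom.coe_mk, ZeroHom.coe_mk, cond_true, cond_false]
  by_cases h1 : G.base (e, true) = v <;> by_cases h2 : G.base (e, false) = v <;>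
    simp [h1, h2, eq_comm (a := v)]

theorem signedDarts_mem_iff (G : RotationSystem V E) (x : E → ℤ) :
    signedDarts x ∈ G.dartFlows ℤ ↔ x ∈ G.flow := by
  rw [mem_dartFlows, flow, LinearMap.mem_ker]
  constructor
  · rintro ⟨-, h⟩
    ext v
    rw [boundary_apply, h, neg_zero]; rfl
  · intro h
    refine ⟨fun d => ?_, fun v => ?_⟩
    · obtain ⟨e, b⟩ := d
      cases b <;> simp [signedDarts]
    · have := congrFun h v
      rw [boundary_apply] at this
      simpa using this

theorem isTwoCubeTilingLattice_iff (G : RotationSystem V E) :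
    IsTwoCubeTilingLattice G.flow ↔ G.CubicalFlow := by
  have h1 : IsTwoCubeTilingLattice G.flow ↔
      Cubical G.flow fun x y => (x : E → ℤ) ⬝ᵥ (y : E → ℤ) := by
    constructor
    · rintro ⟨n, φ, hφ, ht⟩
      exact ⟨n, φ.toAddMonoidHom, hφ, ht⟩
    · rintro ⟨n, φ, hφ, ht⟩
      refine ⟨n, { φ with map_smul' := fun k x => map_zsmul φ k x }, hφ, ht⟩
  rw [h1]
  let r : G.flow →+ G.dartFlows ℤ :=
    { toFun := fun x => ⟨signedDarts x.1, (signedDarts_mem_iff G x.1).2 x.2⟩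
      map_zero' := Subtype.ext (map_zero _)
      map_add' := fun x y => Subtype.ext (map_add _ _ _) }
  refine Cubical.comp_iff r (fun y => ?_) fun x y => rfl
  have hy : signedDarts (fun e => y.1 (e, false)) = y.1 := by
    ext ⟨e, b⟩
    cases b
    · rfl
    · exact (y.2.1 (e, false)).symm
  exact ⟨⟨fun e => y.1 (e, false), (signedDarts_mem_iff G _).1 (hy ▸ y.2)⟩, Subtype.ext hy⟩

theorem CubicalFlow.eq_zero {G : RotationSystem V E} (h : G.CubicalFlow) {y : E × Bool → ℤ}
    (hy : y ∈ G.dartFlows ℤ) (hn : dartForm y y ≤ 3) : y = 0 := by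
  have h0 : dartForm y y = 0 := Cubical.norm_eq_zero h (x := ⟨y, hy⟩) hn
  ext d
  have := sq_le_dartForm hy.1 d
  rw [h0] at this
  exact mul_self_eq_zero.1 (le_antisymm this (mul_self_nonneg _))

open Classical in
/-- The unit flow along a dart. -/
noncomputable def dartUnit (d : E × Bool) : E × Bool → ℤ :=
  Pi.single d 1 - Pi.single (dartFlip E d) 1

omit [Fintype E] in
theorem dartUnit_flip (d a : E × Bool) : dartUnit d (dartFlip E a) = -dartUnit d a := by
  classical
  simp only [dartUnit, Pi.sub_apply, Pi.single_apply]
  rw [if_congr dartFlip_eq_iff rfl rfl, if_congr (dartFlip E).injective.eq_iff rfl rfl, neg_sub]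

omit [Fintype E] in
theorem dartUnit_of_ne {d a : E × Bool} (h : a.1 ≠ d.1) : dartUnit d a = 0 := by
  have h1 : a ≠ d := fun h' => h (congrArg _ h')
  have h2 : a ≠ dartFlip E d := fun h' => h (by rw [h', dartFlip_fst])
  simp [dartUnit, h1, h2]

omit [Fintype E] in
@[simp] theorem dartUnit_self (d : E × Bool) : dartUnit d d = 1 := by
  simp [dartUnit, (dartFlip_ne d).symm]

open Classical in
theorem netFlow_dartUnit (G : RotationSystem V E) (d : E × Bool) (v : V) :
    G.netFlow (dartUnit d) v =
      (if G.base d = v then 1 else 0) - (if G.base (dartFlip E d) = v then 1 else 0) := by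
  have h : ∀ a, (if G.base a = v then dartUnit d a else 0) =
      (if a = d then (if G.base d = v then (1 : ℤ) else 0) else 0) -
      (if a = dartFlip E d then (if G.base (dartFlip E d) = v then (1 : ℤ) else 0) else 0) := by
    intro a
    simp only [dartUnit, Pi.sub_apply, Pi.single_apply]
    by_cases h1 : a = d
    · subst h1; simp [(dartFlip_ne a).symm]
    · by_cases h2 : a = dartFlip E d
      · subst h2; simp [dartFlip_ne, apply_ite]
      · simp [h1, h2]
  simp only [netFlow, h, Finset.sum_sub_distrib, Finset.sum_ite_eq', Finset.mem_univ, if_true]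

end Flows

/-! ### Connectivity -/

section Connectivity

variable {V : Type u} {E : Type v}

/-- `a` and `b` are outside `R` and are joined by an edge in `F`. -/
def Step (G : RotationSystem V E) (F : Set E) (R : Set V) (a b : V) : Prop :=
  ∃ d, G.base d = a ∧ G.base (dartFlip E d) = b ∧ d.1 ∈ F ∧ a ∉ R ∧ b ∉ R

/-- A walk from `a` to `b` along edges in `F` that avoids the vertices in `R`. -/
def Reach (G : RotationSystem V E) (F : Set E) (R : Set V) : V → V → Prop :=
  Relation.ReflTransGen (G.Step F R)

/-- The graph without the vertices in `R` is connected (or empty). -/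
def ConnOff (G : RotationSystem V E) (R : Set V) : Prop :=
  ∀ a b, a ∉ R → b ∉ R → G.Reach Set.univ R a b

variable {G : RotationSystem V E} {F F' : Set E} {R R' : Set V} {a b c : V}

theorem Step.symm (h : G.Step F R a b) : G.Step F R b a := by
  obtain ⟨d, rfl, rfl, h1, h2, h3⟩ := h
  exact ⟨dartFlip E d, rfl, by simp, h1, h3, h2⟩

theorem Reach.symm (h : G.Reach F R a b) : G.Reach F R b a :=
  have : Std.Symm (G.Step F R) := ⟨fun _ _ => Step.symm⟩
  Relation.ReflTransGen.stdSymm.symm _ _ h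

theorem Reach.trans (h : G.Reach F R a b) (h' : G.Reach F R b c) : G.Reach F R a c :=
  Relation.ReflTransGen.trans h h'

theorem Reach.of_dart (d : E × Bool) (h1 : d.1 ∈ F) (h2 : G.base d ∉ R)
    (h3 : G.base (dartFlip E d) ∉ R) : G.Reach F R (G.base d) (G.base (dartFlip E d)) :=
  Relation.ReflTransGen.single ⟨d, rfl, rfl, h1, h2, h3⟩

theorem Reach.mono (hF : F ⊆ F') (hR : R' ⊆ R) (h : G.Reach F R a b) : G.Reach F' R' a b :=
  Relation.ReflTransGen.mono (fun _ _ ⟨d, h1, h2, h3, h4, h5⟩ =>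
    ⟨d, h1, h2, hF h3, fun h => h4 (hR h), fun h => h5 (hR h)⟩) _ _ h

theorem toGraph_adj_iff : G.toGraph.Adj a b ↔ ∃ d, G.base d = a ∧ G.base (dartFlip E d) = b :=
  ⟨fun ⟨e, b, h1, h2⟩ => ⟨(e, b), h1, h2⟩, fun ⟨d, h1, h2⟩ => ⟨d.1, d.2, h1, h2⟩⟩

theorem toGraph_isLoopAt_iff {e : E} {x : V} : G.toGraph.IsLoopAt e x ↔
    G.base (e, false) = x ∧ G.base (e, true) = x := by
  constructor
  · rintro ⟨b, h1, h2⟩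
    cases b
    · exact ⟨h1, h2⟩
    · exact ⟨h2, h1⟩
  · exact fun ⟨h1, h2⟩ => ⟨false, h1, h2⟩

theorem isTwoConn_iff : G.toGraph.IsTwoConn ↔ Nonempty V ∧ G.ConnOff ∅ ∧ (∀ x, G.ConnOff {x}) ∧
    ∀ d, G.base d ≠ G.base (dartFlip E d) := by
  have h1 : ∀ x, (fun a b => G.toGraph.Adj a b ∧ a ≠ x ∧ b ≠ x) = G.Step Set.univ {x} := by
    intro x
    funext a b
    rw [toGraph_adj_iff]
    simp only [Step, Set.mem_univ, true_and, Set.mem_singleton_iff, eq_iff_iff]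
    exact ⟨fun ⟨⟨d, h1, h2⟩, h⟩ => ⟨d, h1, h2, h⟩, fun ⟨d, h1, h2, h⟩ => ⟨⟨d, h1, h2⟩, h⟩⟩
  have h2 : G.toGraph.Adj = G.Step Set.univ ∅ := by
    funext a b
    rw [eq_iff_iff, toGraph_adj_iff]
    simp [Step]
  constructor
  · rintro ⟨⟨⟨v, -⟩, hc⟩, hcut, hl⟩
    refine ⟨⟨v⟩, fun a b _ _ => ?_, fun x a b ha hb => ?_, fun d hd => ?_⟩
    · rw [Reach, ← h2]
      exact hc a (Set.mem_univ a) b (Set.mem_univ b)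
    · by_contra hab
      rw [Reach, ← h1] at hab
      exact hcut x ⟨Set.mem_univ x, a, Set.mem_univ a, b, Set.mem_univ b, ha, hb, hab⟩
    · exact hl d.1 (G.base d) ⟨d.2, rfl, hd.symm⟩
  · rintro ⟨⟨v⟩, hc, hcut, hl⟩
    refine ⟨⟨⟨v, Set.mem_univ v⟩, fun a _ b _ => ?_⟩, ?_, ?_⟩
    · rw [h2]
      exact hc a b (Set.notMem_empty a) (Set.notMem_empty b)
    · rintro x ⟨-, a, -, b, -, ha, hb, hab⟩
      rw [h1] at hab
      exact hab (hcut x a b ha hb)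
    · rintro e x ⟨b, h1, h2⟩
      exact hl (e, b) (h1.trans h2.symm)

/-- The two ends of a dart in a 2-connected graph are joined off this dart, unless there is nothing
else in the graph. -/
theorem Reach.off_dart (hc : ∀ x, G.ConnOff {x}) (hl : ∀ d, G.base d ≠ G.base (dartFlip E d))
    (d : E × Bool) (h : (∃ w, w ≠ G.base d ∧ w ≠ G.base (dartFlip E d)) ∨ ∃ e, e ≠ d.1) :
    G.Reach {d.1}ᶜ ∅ (G.base d) (G.base (dartFlip E d)) := by
  -- A walk that avoids one end of d cannot use the edge of d.
  have key : ∀ (d' : E × Bool), d'.1 = d.1 → ∀ w, w ≠ G.base d' → w ≠ G.base (dartFlip E d') →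
      G.Reach {d.1}ᶜ ∅ (G.base d') w := by
    intro d' hd' w hw hw'
    refine Relation.ReflTransGen.mono ?_ _ _ (hc (G.base (dartFlip E d')) (G.base d') w (hl d') hw')
    rintro a b ⟨x, rfl, rfl, -, h2, h3⟩
    refine ⟨x, rfl, rfl, fun hx => ?_, Set.notMem_empty _, Set.notMem_empty _⟩
    have hx : x.1 = d'.1 := (Set.mem_singleton_iff.1 hx).trans hd'.symm
    rcases eq_or_eq_dartFlip hx with rfl | rfl
    · exact h3 rfl
    · exact h2 rfl
  by_cases hw : ∃ w, w ≠ G.base d ∧ w ≠ G.base (dartFlip E d)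
  · obtain ⟨w, hw1, hw2⟩ := hw
    exact (key d rfl w hw1 hw2).trans
      (key (dartFlip E d) rfl w hw2 (by rwa [dartFlip_dartFlip])).symm
  -- Without a third vertex, any other edge is parallel to d.
  · obtain ⟨e, he⟩ := h.resolve_left hw
    push Not at hw
    have hpar : ∃ x : E × Bool, x.1 = e ∧ G.base x = G.base d := by
      by_cases h1 : G.base (e, false) = G.base d
      · exact ⟨_, rfl, h1⟩
      · refine ⟨(e, true), rfl, ?_⟩
        by_contra h2
        exact hl (e, false) ((hw _ h1).trans (hw _ h2).symm)
    obtain ⟨x, rfl, hx⟩ := hpar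
    have h2 := hw (G.base (dartFlip E x)) (by rw [← hx]; exact (hl x).symm)
    rw [← hx, ← h2]
    exact Reach.of_dart x he (Set.notMem_empty _) (Set.notMem_empty _)

-- The unit flows along the darts of a walk add up to a chain whose only source and sink are the
-- ends of the walk; `netFlow` counts what leaves a vertex.
open Classical in
theorem Reach.exists_chain [Fintype E] (h : G.Reach F R a b) : ∃ y : E × Bool → ℤ,
    (∀ d, y (dartFlip E d) = -y d) ∧ (∀ d, d.1 ∉ F → y d = 0) ∧
    ∀ v, G.netFlow y v = (if a = v then 1 else 0) - (if b = v then 1 else 0) := by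
  induction h with
  | refl => exact ⟨0, by simp, by simp, by simp [netFlow]⟩
  | tail _ hs ih =>
    obtain ⟨y, h1, h2, h3⟩ := ih
    obtain ⟨d, rfl, rfl, hd, -, -⟩ := hs
    refine ⟨y + dartUnit d, fun x => ?_, fun x hx => ?_, fun v => ?_⟩
    · simp only [Pi.add_apply, h1, dartUnit_flip]; ring
    · rw [Pi.add_apply, h2 x hx, dartUnit_of_ne (fun h' => hx (h' ▸ hd) : x.1 ≠ d.1), add_zero]
    · rw [netFlow_add, h3, netFlow_dartUnit]; ring

/-- A walk off d from its far end back to its base closes d to a cycle. -/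
theorem exists_flow_apply_eq_one [Fintype E] {d : E × Bool}
    (h : G.Reach {d.1}ᶜ ∅ (G.base d) (G.base (dartFlip E d))) :
    ∃ y ∈ G.dartFlows ℤ, y d = 1 := by
  classical
  obtain ⟨y, h1, h2, h3⟩ := h.symm.exists_chain
  refine ⟨y + dartUnit d, ⟨fun x => ?_, fun v => ?_⟩, ?_⟩
  · simp only [Pi.add_apply, h1, dartUnit_flip]; ring
  · rw [netFlow_add, h3, netFlow_dartUnit]; ring
  · rw [Pi.add_apply, h2 d (by simp), dartUnit_self, zero_add]

/-- A 2-connected graph without non-zero flows has at most one edge. -/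
theorem card_of_flow_eq_zero [Fintype V] [Fintype E] (hne : Nonempty V) (hc : G.ConnOff ∅)
    (hc' : ∀ x, G.ConnOff {x}) (hl : ∀ d, G.base d ≠ G.base (dartFlip E d))
    (h : ∀ y ∈ G.dartFlows ℤ, y = 0) :
    (Nat.card V = 1 ∧ IsEmpty E) ∨ (Nat.card V = 2 ∧ Nat.card E = 1) := by
  rcases isEmpty_or_nonempty E with hE | ⟨⟨e⟩⟩
  · refine Or.inl ⟨?_, hE⟩
    rw [Nat.card_eq_one_iff_unique]
    refine ⟨⟨fun a b => ?_⟩, hne⟩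
    have := hc a b (Set.notMem_empty a) (Set.notMem_empty b)
    refine Relation.ReflTransGen.head_induction_on this rfl fun h' _ _ => ?_
    obtain ⟨d, -⟩ := h'
    exact hE.elim d.1
  · have hno : ¬ ((∃ w, w ≠ G.base (e, false) ∧ w ≠ G.base (dartFlip E (e, false))) ∨
        ∃ e', e' ≠ e) := by
      intro h'
      obtain ⟨y, hy, hy1⟩ := exists_flow_apply_eq_one (Reach.off_dart hc' hl (e, false) h')
      rw [h y hy] at hy1
      exact zero_ne_one hy1
    push Not at hno
    refine Or.inr ⟨?_, Nat.card_eq_one_iff_unique.2 ⟨⟨fun a b => (hno.2 a).trans (hno.2 b).symm⟩, ⟨e⟩⟩⟩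
    rw [Nat.card_eq_two_iff]
    refine ⟨_, _, hl (e, false), ?_⟩
    ext w
    simp only [Set.mem_insert_iff, Set.mem_singleton_iff, Set.mem_univ, iff_true]
    by_cases hw : w = G.base (e, false)
    · exact Or.inl hw
    · exact Or.inr (hno.1 w hw)

end Connectivity

/-! ### Potentials -/

section Potentials

variable {V : Type u} {E : Type v} [Fintype E]

/-- `p` is a function on the corners (`p d` belongs to the corner before the dart `d`) that is
constant on each face, and changes by `y` across each edge. -/
def IsPotential (G : RotationSystem V E) (y p : E × Bool → ZMod 2) : Prop :=
  ∀ d, p (dartFlip E d) = p d + y d ∧ p (G.rot d) = p d + y d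

/-- Every flow mod 2 is the boundary of a set of faces. -/
def HasPotentials (G : RotationSystem V E) : Prop :=
  ∀ y ∈ G.dartFlows (ZMod 2), ∃ p, G.IsPotential y p

end Potentials

end RotationSystem

namespace RotationSystem

open CompEdge

/-! ### Joins: compositions without regard to the drawings -/

section Join

variable {V V₁ V₂ : Type u} {E E₁ E₂ : Type v} {G : RotationSystem V E}
  {G₁ : RotationSystem V₁ E₁} {G₂ : RotationSystem V₂ E₂} {d₁ : E₁ × Bool} {d₂ : E₂ × Bool}
  {φ : V₁ ⊕ V₂ ≃ V} {ψ : CompEdge d₁.1 d₂.1 × Bool ≃ E × Bool}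

/-- The underlying graph of `G` is that of a composition. -/
structure IsJoin (G : RotationSystem V E) (G₁ : RotationSystem V₁ E₁) (G₂ : RotationSystem V₂ E₂)
    (d₁ : E₁ × Bool) (d₂ : E₂ × Bool) (φ : V₁ ⊕ V₂ ≃ V)
    (ψ : CompEdge d₁.1 d₂.1 × Bool ≃ E × Bool) : Prop where
  flip : ∀ a, ψ (dartFlip _ a) = dartFlip E (ψ a)
  base₁ : ∀ a : E₁ × Bool,
    G.base (ψ (repl₁ d₁ (cycIn 3) (cycIn 1) a)) = φ (Sum.inl (G₁.base a)) ∧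
    G.base (ψ (repl₁ d₁ (cycOut 0) (cycOut 2) a)) = φ (Sum.inl (G₁.base a))
  base₂ : ∀ a : E₂ × Bool,
    G.base (ψ (repl₂ d₂ (cycOut 1) (cycOut 3) a)) = φ (Sum.inr (G₂.base a)) ∧
    G.base (ψ (repl₂ d₂ (cycIn 0) (cycIn 2) a)) = φ (Sum.inr (G₂.base a))

theorem IsCompositionAlong.exists_isJoin (h : G.IsCompositionAlong G₁ G₂ d₁ d₂) :
    ∃ φ ψ, IsJoin G G₁ G₂ d₁ d₂ φ ψ := by
  obtain ⟨φ, ψ, hf, h1, h2, -⟩ := h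
  exact ⟨φ, ψ, hf, fun a => ⟨(h1 a).1, (h1 a).2.1⟩, fun a => ⟨(h2 a).1, (h2 a).2.1⟩⟩

theorem repl₁_of_ne {f₂ : E₂} (x y : CompEdge d₁.1 f₂ × Bool) {a : E₁ × Bool} (h : a.1 ≠ d₁.1) :
    repl₁ d₁ x y a = (Sum.inl (Sum.inl ⟨a.1, h⟩), a.2) := by
  simp [repl₁, h]

@[simp] theorem repl₁_self {f₂ : E₂} (x y : CompEdge d₁.1 f₂ × Bool) : repl₁ d₁ x y d₁ = x := by
  simp [repl₁]

@[simp] theorem repl₁_flip {f₂ : E₂} (x y : CompEdge d₁.1 f₂ × Bool) :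
    repl₁ d₁ x y (dartFlip E₁ d₁) = y := by
  simp [repl₁, dartFlip_ne]

theorem repl₂_of_ne {f₁ : E₁} (x y : CompEdge f₁ d₂.1 × Bool) {a : E₂ × Bool} (h : a.1 ≠ d₂.1) :
    repl₂ d₂ x y a = (Sum.inl (Sum.inr ⟨a.1, h⟩), a.2) := by
  simp [repl₂, h]

@[simp] theorem repl₂_self {f₁ : E₁} (x y : CompEdge f₁ d₂.1 × Bool) : repl₂ d₂ x y d₂ = x := by
  simp [repl₂]

@[simp] theorem repl₂_flip {f₁ : E₁} (x y : CompEdge f₁ d₂.1 × Bool) :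
    repl₂ d₂ x y (dartFlip E₂ d₂) = y := by
  simp [repl₂, dartFlip_ne]

/-- Exchanging the two parts of a composition. -/
def swapCycle : Fin 4 → Fin 4 := ![0, 3, 2, 1]

theorem swapCycle_swapCycle (i : Fin 4) : swapCycle (swapCycle i) = i := by
  fin_cases i <;> rfl

/-- Exchanging the two parts of a composition. -/
def swapDart (f₁ : E₁) (f₂ : E₂) : CompEdge f₁ f₂ × Bool → CompEdge f₂ f₁ × Bool
  | (Sum.inl (Sum.inl e), b) => (Sum.inl (Sum.inr e), b)
  | (Sum.inl (Sum.inr e), b) => (Sum.inl (Sum.inl e), b)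
  | (Sum.inr i, b) => (Sum.inr (swapCycle i), !b)

theorem swapDart_swapDart (f₁ : E₁) (f₂ : E₂) (a : CompEdge f₁ f₂ × Bool) :
    swapDart f₂ f₁ (swapDart f₁ f₂ a) = a := by
  obtain ⟨(e | e) | i, b⟩ := a <;> simp [swapDart, swapCycle_swapCycle]

/-- Exchanging the two parts of a composition. -/
def swapEquiv (f₁ : E₁) (f₂ : E₂) : CompEdge f₁ f₂ × Bool ≃ CompEdge f₂ f₁ × Bool where
  toFun := swapDart f₁ f₂
  invFun := swapDart f₂ f₁
  left_inv := swapDart_swapDart f₁ f₂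
  right_inv := swapDart_swapDart f₂ f₁

namespace IsJoin

variable (h : IsJoin G G₁ G₂ d₁ d₂ φ ψ)

include h

/-- With v₁ v₂ v₃ v₄ renamed v₂ v₁ v₄ v₃ the 4-cycle is run through backwards: e₀ and e₂ are
reversed, e₁ and e₃ are reversed and exchanged. Statements about the first part thus carry over to
the second. -/
theorem swap : IsJoin G G₂ G₁ d₂ d₁ ((Equiv.sumComm V₂ V₁).trans φ)
    ((swapEquiv d₂.1 d₁.1).trans ψ) where
  flip a := by
    rw [Equiv.trans_apply, Equiv.trans_apply, ← h.flip]
    congr 1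
    obtain ⟨(e | e) | i, b⟩ := a <;> simp [swapEquiv, swapDart]
  base₁ a := by
    have key : ∀ x y, swapEquiv d₂.1 d₁.1 (repl₁ d₂ x y a) =
        repl₂ d₂ (swapEquiv d₂.1 d₁.1 x) (swapEquiv d₂.1 d₁.1 y) a := by
      intro x y
      simp only [repl₁, repl₂]
      split_ifs <;> rfl
    simp only [Equiv.trans_apply, key]
    exact h.base₂ a
  base₂ a := by
    have key : ∀ x y, swapEquiv d₂.1 d₁.1 (repl₂ d₁ x y a) =
        repl₁ d₁ (swapEquiv d₂.1 d₁.1 x) (swapEquiv d₂.1 d₁.1 y) a := by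
      intro x y
      simp only [repl₁, repl₂]
      split_ifs <;> rfl
    simp only [Equiv.trans_apply, key]
    exact h.base₁ a

theorem base_inl (e : {e : E₁ // e ≠ d₁.1}) (b : Bool) :
    G.base (ψ (Sum.inl (Sum.inl e), b)) = φ (Sum.inl (G₁.base (e.1, b))) := by
  have := (h.base₁ (e.1, b)).1
  rwa [repl₁_of_ne _ _ e.2] at this

theorem base_inr (e : {e : E₂ // e ≠ d₂.1}) (b : Bool) :
    G.base (ψ (Sum.inl (Sum.inr e), b)) = φ (Sum.inr (G₂.base (e.1, b))) := by
  have := (h.base₂ (e.1, b)).1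
  rwa [repl₂_of_ne _ _ e.2] at this

theorem base_flip_inl (e : {e : E₁ // e ≠ d₁.1}) (b : Bool) :
    G.base (dartFlip E (ψ (Sum.inl (Sum.inl e), b))) = φ (Sum.inl (G₁.base (e.1, !b))) := by
  rw [← h.flip, ← h.base_inl]; rfl

theorem base_flip_inr (e : {e : E₂ // e ≠ d₂.1}) (b : Bool) :
    G.base (dartFlip E (ψ (Sum.inl (Sum.inr e), b))) = φ (Sum.inr (G₂.base (e.1, !b))) := by
  rw [← h.flip, ← h.base_inr]; rfl

theorem base_out_zero : G.base (ψ (cycOut 0)) = φ (Sum.inl (G₁.base d₁)) := by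
  simpa using (h.base₁ d₁).2

theorem base_in_three : G.base (ψ (cycIn 3)) = φ (Sum.inl (G₁.base d₁)) := by
  simpa using (h.base₁ d₁).1

theorem base_out_two : G.base (ψ (cycOut 2)) = φ (Sum.inl (G₁.base (dartFlip E₁ d₁))) := by
  simpa using (h.base₁ (dartFlip E₁ d₁)).2

theorem base_in_one : G.base (ψ (cycIn 1)) = φ (Sum.inl (G₁.base (dartFlip E₁ d₁))) := by
  simpa using (h.base₁ (dartFlip E₁ d₁)).1

theorem base_out_one : G.base (ψ (cycOut 1)) = φ (Sum.inr (G₂.base d₂)) := by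
  simpa using (h.base₂ d₂).1

theorem base_in_zero : G.base (ψ (cycIn 0)) = φ (Sum.inr (G₂.base d₂)) := by
  simpa using (h.base₂ d₂).2

theorem base_out_three : G.base (ψ (cycOut 3)) = φ (Sum.inr (G₂.base (dartFlip E₂ d₂))) := by
  simpa using (h.base₂ (dartFlip E₂ d₂)).1

theorem base_in_two : G.base (ψ (cycIn 2)) = φ (Sum.inr (G₂.base (dartFlip E₂ d₂))) := by
  simpa using (h.base₂ (dartFlip E₂ d₂)).2

end IsJoin

/-- A vertex is one of the ends of a dart. -/
def IsEnd (G : RotationSystem V E) (d : E × Bool) (x : V) : Prop :=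
  x = G.base d ∨ x = G.base (dartFlip E d)

/-! ### Connectivity of a join and of its parts. -/

namespace IsJoin

variable (h : IsJoin G G₁ G₂ d₁ d₂ φ ψ)

include h

theorem cycle_ends (i : Fin 4) (b : Bool) :
    (∃ x y, IsEnd G₁ d₁ x ∧ IsEnd G₂ d₂ y ∧ G.base (ψ (Sum.inr i, b)) = φ (Sum.inl x) ∧
      G.base (dartFlip E (ψ (Sum.inr i, b))) = φ (Sum.inr y)) ∨
    (∃ x y, IsEnd G₁ d₁ x ∧ IsEnd G₂ d₂ y ∧ G.base (ψ (Sum.inr i, b)) = φ (Sum.inr y) ∧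
      G.base (dartFlip E (ψ (Sum.inr i, b))) = φ (Sum.inl x)) := by
  rw [← h.flip]
  have key : ∀ i, (∃ x y, IsEnd G₁ d₁ x ∧ IsEnd G₂ d₂ y ∧
      G.base (ψ (cycOut i)) = φ (Sum.inl x) ∧ G.base (ψ (cycIn i)) = φ (Sum.inr y)) ∨
      (∃ x y, IsEnd G₁ d₁ x ∧ IsEnd G₂ d₂ y ∧ G.base (ψ (cycOut i)) = φ (Sum.inr y) ∧
      G.base (ψ (cycIn i)) = φ (Sum.inl x)) := by
    intro i
    fin_cases i
    · exact Or.inl ⟨_, _, Or.inl rfl, Or.inl rfl, h.base_out_zero, h.base_in_zero⟩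
    · exact Or.inr ⟨_, _, Or.inr rfl, Or.inl rfl, h.base_out_one, h.base_in_one⟩
    · exact Or.inl ⟨_, _, Or.inr rfl, Or.inr rfl, h.base_out_two, h.base_in_two⟩
    · exact Or.inr ⟨_, _, Or.inl rfl, Or.inr rfl, h.base_out_three, h.base_in_three⟩
  cases b
  · exact key i
  · rcases key i with ⟨x, y, h1, h2, h3, h4⟩ | ⟨x, y, h1, h2, h3, h4⟩
    · exact Or.inr ⟨x, y, h1, h2, h4, h3⟩
    · exact Or.inl ⟨x, y, h1, h2, h4, h3⟩

theorem exists_cycle_dart {x : V₁} {y : V₂} (hx : IsEnd G₁ d₁ x) (hy : IsEnd G₂ d₂ y) :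
    ∃ i b, G.base (ψ (Sum.inr i, b)) = φ (Sum.inl x) ∧
      G.base (dartFlip E (ψ (Sum.inr i, b))) = φ (Sum.inr y) := by
  simp only [← h.flip]
  rcases hx with rfl | rfl <;> rcases hy with rfl | rfl
  · exact ⟨0, false, h.base_out_zero, h.base_in_zero⟩
  · exact ⟨3, true, h.base_in_three, h.base_out_three⟩
  · exact ⟨1, true, h.base_in_one, h.base_out_one⟩
  · exact ⟨2, false, h.base_out_two, h.base_in_two⟩

variable {R : Set V}

theorem reach_cycle {x : V₁} {y : V₂} (hx : IsEnd G₁ d₁ x) (hy : IsEnd G₂ d₂ y)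
    (hx' : φ (Sum.inl x) ∉ R) (hy' : φ (Sum.inr y) ∉ R) :
    G.Reach Set.univ R (φ (Sum.inl x)) (φ (Sum.inr y)) := by
  obtain ⟨i, b, h1, h2⟩ := h.exists_cycle_dart hx hy
  rw [← h1] at hx' ⊢
  rw [← h2] at hy' ⊢
  exact Reach.of_dart _ (Set.mem_univ _) hx' hy'

/-- A walk in the first part is a walk in the join, except that the removed edge d₁ is replaced by
two cycle edges through an end of d₂. Such a detour is needed only if no end of d₁ is in R, whence
the form of `hf`. -/
theorem reach_inl (hf : (∀ x, IsEnd G₁ d₁ x → φ (Sum.inl x) ∉ R) →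
    ∃ y, IsEnd G₂ d₂ y ∧ φ (Sum.inr y) ∉ R) {a b : V₁}
    (hab : G₁.Reach Set.univ {x | φ (Sum.inl x) ∈ R} a b) :
    G.Reach Set.univ R (φ (Sum.inl a)) (φ (Sum.inl b)) := by
  induction hab with
  | refl => exact Relation.ReflTransGen.refl
  | tail _ hs ih =>
    refine ih.trans ?_
    obtain ⟨d, rfl, rfl, -, h1, h2⟩ := hs
    rw [Set.mem_ofPred_eq] at h1 h2
    by_cases hd : d.1 = d₁.1
    · have hends : ∀ x, IsEnd G₁ d₁ x → φ (Sum.inl x) ∉ R := by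
        rintro x (rfl | rfl) <;> rcases eq_or_eq_dartFlip hd with rfl | rfl <;> simp_all
      have he : IsEnd G₁ d₁ (G₁.base d) ∧ IsEnd G₁ d₁ (G₁.base (dartFlip E₁ d)) := by
        rcases eq_or_eq_dartFlip hd with rfl | rfl
        · exact ⟨Or.inl rfl, Or.inr rfl⟩
        · exact ⟨Or.inr rfl, Or.inl (by rw [dartFlip_dartFlip])⟩
      obtain ⟨y, hy, hyR⟩ := hf hends
      exact (h.reach_cycle he.1 hy h1 hyR).trans (h.reach_cycle he.2 hy h2 hyR).symm
    · have e1 := h.base_inl ⟨d.1, hd⟩ d.2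
      have e2 := h.base_flip_inl ⟨d.1, hd⟩ d.2
      have e4 : dartFlip E₁ d = (d.1, !d.2) := rfl
      rw [e4] at h2 ⊢
      rw [← e1] at h1 ⊢
      rw [← e2] at h2 ⊢
      exact Reach.of_dart _ (Set.mem_univ _) h1 h2

theorem connOff (h₁ : G₁.ConnOff {x | φ (Sum.inl x) ∈ R}) (h₂ : G₂.ConnOff {x | φ (Sum.inr x) ∈ R})
    {x : V₁} {y : V₂} (hx : IsEnd G₁ d₁ x) (hy : IsEnd G₂ d₂ y)
    (hx' : φ (Sum.inl x) ∉ R) (hy' : φ (Sum.inr y) ∉ R) : G.ConnOff R := by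
  have r1 : ∀ a b, φ (Sum.inl a) ∉ R → φ (Sum.inl b) ∉ R →
      G.Reach Set.univ R (φ (Sum.inl a)) (φ (Sum.inl b)) := fun a b ha hb =>
    h.reach_inl (fun _ => ⟨y, hy, hy'⟩) (h₁ a b ha hb)
  have r2 : ∀ a b, φ (Sum.inr a) ∉ R → φ (Sum.inr b) ∉ R →
      G.Reach Set.univ R (φ (Sum.inr a)) (φ (Sum.inr b)) := fun a b ha hb =>
    h.swap.reach_inl (fun _ => ⟨x, hx, hx'⟩) (h₂ a b ha hb)
  have r3 := h.reach_cycle hx hy hx' hy'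
  intro a b ha hb
  obtain ⟨a | a, rfl⟩ := φ.surjective a <;> obtain ⟨b | b, rfl⟩ := φ.surjective b
  · exact r1 a b ha hb
  · exact (r1 a x ha hx').trans (r3.trans (r2 y b hy' hb))
  · exact (r2 a y ha hy').trans (r3.symm.trans (r1 x b hx' hb))
  · exact r2 a b ha hb

/-- If a set of vertices of the first part does not separate `G`, it does not separate this part. -/
theorem connOff_inl {R : Set V₁} (hc : G.ConnOff ((fun x => φ (Sum.inl x)) '' R)) :
    G₁.ConnOff R := by
  set R' := (fun x => φ (Sum.inl x)) '' R with hR'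
  have hmem : ∀ x, φ (Sum.inl x) ∈ R' ↔ x ∈ R := fun x =>
    ⟨fun ⟨y, hy, hxy⟩ => by
      have : y = x := by simpa using hxy
      exact this ▸ hy, fun hx => ⟨x, hx, rfl⟩⟩
  intro a b ha hb
  have hw := hc (φ (Sum.inl a)) (φ (Sum.inl b)) (by rwa [hmem]) (by rwa [hmem])
  -- A walk can leave the first part and return to it only at ends of d₁, so an excursion is
  -- replaced by the edge d₁ or by nothing. Meanwhile the invariant remembers an end of d₁, outside
  -- R, that has been reached.
  have key : ∀ c, G.Reach Set.univ R' (φ (Sum.inl a)) c →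
      (∀ x, c = φ (Sum.inl x) → G₁.Reach Set.univ R a x) ∧
      (∀ y, c = φ (Sum.inr y) → ∃ x, IsEnd G₁ d₁ x ∧ x ∉ R ∧ G₁.Reach Set.univ R a x) := by
    intro c hac
    induction hac with
    | refl =>
      refine ⟨fun x hx => ?_, fun y hy => by simp at hy⟩
      have : a = x := by simpa using hx
      rw [this]
      exact Relation.ReflTransGen.refl
    | tail _ hs ih =>
      obtain ⟨d, rfl, rfl, -, h1, h2⟩ := hs
      obtain ⟨⟨(e | e) | i, s⟩, rfl⟩ := ψ.surjective d
      · have e1 := h.base_inl e s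
        have e2 := h.base_flip_inl e s
        rw [e1] at h1 ih
        rw [e2] at h2 ⊢
        refine ⟨fun x hx => ?_, fun y hy => by simp at hy⟩
        have hx : G₁.base (e.1, !s) = x := by simpa using hx
        rw [← hx]
        rw [hmem] at h1 h2
        exact (ih.1 _ rfl).trans (Reach.of_dart (e.1, s) (Set.mem_univ _) h1 h2)
      · have e1 := h.base_inr e s
        have e2 := h.base_flip_inr e s
        rw [e1] at h1 ih
        rw [e2] at h2 ⊢
        exact ⟨fun x hx => by simp at hx, fun y _ => ih.2 _ rfl⟩
      · rcases h.cycle_ends i s with ⟨x, y, hx, hy, e1, e2⟩ | ⟨x, y, hx, hy, e1, e2⟩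
        · rw [e1] at h1 ih
          rw [e2] at h2 ⊢
          rw [hmem] at h1
          exact ⟨fun x hx => by simp at hx, fun y _ => ⟨x, hx, h1, ih.1 x rfl⟩⟩
        · rw [e1] at h1 ih
          rw [e2] at h2 ⊢
          rw [hmem] at h2
          refine ⟨fun x' hx' => ?_, fun y hy => by simp at hy⟩
          have hx' : x = x' := by simpa using hx'
          rw [← hx']
          obtain ⟨z, hz, hzR, haz⟩ := ih.2 y rfl
          refine haz.trans ?_
          rcases hz with rfl | rfl <;> rcases hx with rfl | rfl
          · exact Relation.ReflTransGen.refl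
          · exact Reach.of_dart d₁ (Set.mem_univ _) hzR h2
          · exact (Reach.of_dart d₁ (Set.mem_univ _) h2 hzR).symm
          · exact Relation.ReflTransGen.refl
  exact (key _ hw).1 b rfl

end IsJoin

end Join

end RotationSystem

namespace RotationSystem

open CompEdge

/-! ### Flows of joins -/

section JoinFlow

variable {V V₁ V₂ : Type u} {E E₁ E₂ : Type v} {G : RotationSystem V E}
  {G₁ : RotationSystem V₁ E₁} {G₂ : RotationSystem V₂ E₂} {d₁ : E₁ × Bool} {d₂ : E₂ × Bool}
  {φ : V₁ ⊕ V₂ ≃ V} {ψ : CompEdge d₁.1 d₂.1 × Bool ≃ E × Bool} {R : Type*} [AddCommGroup R]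

open Classical in
/-- The dart function on the first part of a join that is induced by a dart function on the join. -/
noncomputable def partFlow (ψ : CompEdge d₁.1 d₂.1 × Bool ≃ E × Bool) (y : E × Bool → R)
    (a : E₁ × Bool) : R :=
  if a.1 = d₁.1 then
    y (ψ (repl₁ d₁ (cycIn 3) (cycIn 1) a)) + y (ψ (repl₁ d₁ (cycOut 0) (cycOut 2) a))
  else y (ψ (repl₁ d₁ (cycIn 3) (cycIn 1) a))

theorem partFlow_self (y : E × Bool → R) :
    partFlow ψ y d₁ = y (ψ (cycIn 3)) + y (ψ (cycOut 0)) := by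
  simp [partFlow]

theorem partFlow_flip (y : E × Bool → R) :
    partFlow ψ y (dartFlip E₁ d₁) = y (ψ (cycIn 1)) + y (ψ (cycOut 2)) := by
  simp [partFlow]

theorem partFlow_of_ne (y : E × Bool → R) {a : E₁ × Bool} (h : a.1 ≠ d₁.1) :
    partFlow ψ y a = y (ψ (Sum.inl (Sum.inl ⟨a.1, h⟩), a.2)) := by
  simp [partFlow, h, repl₁_of_ne]

theorem sum_bool_dart (f : E × Bool → R) (d : E × Bool) :
    ∑ b, f (d.1, b) = f d + f (dartFlip E d) := by
  obtain ⟨e, b⟩ := d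
  cases b <;> simp [add_comm]

open Classical in
theorem sum_darts_ne [Fintype E] (f : E × Bool → R) (d : E × Bool) :
    ∑ a, f a = f d + f (dartFlip E d) + ∑ e : {e : E // e ≠ d.1}, ∑ b, f (e.1, b) := by
  rw [Fintype.sum_prod_type, Fintype.sum_eq_add_sum_subtype_ne _ d.1, sum_bool_dart]

open Classical in
theorem sum_compEdge [Fintype E₁] [Fintype E₂] {f₁ : E₁} {f₂ : E₂}
    (f : CompEdge f₁ f₂ × Bool → R) :
    ∑ a, f a = ∑ e : {e : E₁ // e ≠ f₁}, ∑ b, f (Sum.inl (Sum.inl e), b) +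
      ∑ e : {e : E₂ // e ≠ f₂}, ∑ b, f (Sum.inl (Sum.inr e), b) +
      ((f (cycOut 0) + f (cycIn 0)) + (f (cycOut 1) + f (cycIn 1)) + (f (cycOut 2) + f (cycIn 2)) +
        (f (cycOut 3) + f (cycIn 3))) := by
  rw [Fintype.sum_prod_type, Fintype.sum_sum_type, Fintype.sum_sum_type, Fin.sum_univ_four]
  simp only [Fintype.sum_bool, cycOut, cycIn]
  abel

/-- The values of a flow on a join, in terms of flows on the two parts and the value on the first
edge of the 4-cycle. -/
def joinDarts (d₁ : E₁ × Bool) (d₂ : E₂ × Bool) (y₁ : E₁ × Bool → R) (y₂ : E₂ × Bool → R) (c : R) :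
    CompEdge d₁.1 d₂.1 × Bool → R
  | (Sum.inl (Sum.inl e), b) => y₁ (e.1, b)
  | (Sum.inl (Sum.inr e), b) => y₂ (e.1, b)
  | (Sum.inr i, b) =>
    -- By conservation, the difference of consecutive cycle edges is the value of the removed edge
    -- at the vertex between them: y₂ d₂ at v₂, -y₁ d₁ at v₃, -y₂ d₂ at v₄ and y₁ d₁ at v₁.
    let z : R := (![c, c + y₂ d₂, c + y₂ d₂ - y₁ d₁, c - y₁ d₁] : Fin 4 → R) i
    bif b then -z else z

namespace IsJoin

variable [Fintype E] [Fintype E₁] (h : IsJoin G G₁ G₂ d₁ d₂ φ ψ)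

/-- Each end of d₁ carries two darts of the cycle, and `partFlow` adds their values; all other darts
correspond one to one. -/
theorem netFlow_inl [Fintype E₂] (h : IsJoin G G₁ G₂ d₁ d₂ φ ψ) (y : E × Bool → R) (v : V₁) :
    G.netFlow y (φ (Sum.inl v)) = G₁.netFlow (partFlow ψ y) v := by
  classical
  rw [netFlow, netFlow, ← ψ.sum_comp, sum_compEdge, sum_darts_ne _ d₁]
  have h1 : ∀ (e : {e : E₂ // e ≠ d₂.1}) (b : Bool),
      (if G.base (ψ (Sum.inl (Sum.inr e), b)) = φ (Sum.inl v) then y (ψ (Sum.inl (Sum.inr e), b))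
        else 0) = 0 := fun e b => by
    rw [h.base_inr]; simp
  have h2 : ∀ (e : {e : E₁ // e ≠ d₁.1}) (b : Bool),
      (if G.base (ψ (Sum.inl (Sum.inl e), b)) = φ (Sum.inl v) then y (ψ (Sum.inl (Sum.inl e), b))
        else 0) = if G₁.base (e.1, b) = v then partFlow ψ y (e.1, b) else 0 := fun e b => by
    rw [h.base_inl, partFlow_of_ne y (a := (e.1, b)) e.2]; simp
  simp only [h1, h2, h.base_out_zero, h.base_in_zero, h.base_out_one, h.base_in_one,
    h.base_out_two, h.base_in_two, h.base_out_three, h.base_in_three, partFlow_self,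
    partFlow_flip, EmbeddingLike.apply_eq_iff_eq, Sum.inl.injEq, reduceCtorEq, if_false,
    Finset.sum_const_zero, add_zero, zero_add]
  rw [add_comm]
  congr 1
  split_ifs <;> abel

end IsJoin

theorem sum_eq_zero_of_netFlow [Fintype E] {y : E × Bool → R} (h : ∀ v, G.netFlow y v = 0) :
    ∑ d, y d = 0 := by
  classical
  rw [← Finset.sum_fiberwise_of_maps_to (t := Finset.univ.image G.base) (g := G.base)
    (fun d _ => Finset.mem_image_of_mem _ (Finset.mem_univ d))]
  refine Finset.sum_eq_zero fun v _ => ?_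
  rw [Finset.sum_filter]
  exact h v

namespace IsJoin

variable [Fintype E] [Fintype E₁] [Fintype E₂] (h : IsJoin G G₁ G₂ d₁ d₂ φ ψ)

include h

theorem partFlow_mem {y : E × Bool → R} (hy : y ∈ G.dartFlows R) :
    partFlow ψ y ∈ G₁.dartFlows R := by
  classical
  have hnet : ∀ v, G₁.netFlow (partFlow ψ y) v = 0 := fun v => by
    rw [← h.netFlow_inl, hy.2]
  refine ⟨fun a => ?_, hnet⟩
  have hne : ∀ a : E₁ × Bool, a.1 ≠ d₁.1 →
      partFlow ψ y (dartFlip E₁ a) = -partFlow ψ y a := fun a ha => by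
    rw [partFlow_of_ne y ha, partFlow_of_ne y (a := dartFlip E₁ a) ha, ← hy.1, ← h.flip]; rfl
  -- Antisymmetry at the removed edge comes from global conservation: all values sum to 0, and those
  -- on the other edges cancel in pairs.
  have hself : partFlow ψ y (dartFlip E₁ d₁) = -partFlow ψ y d₁ := by
    have h0 := sum_eq_zero_of_netFlow hnet
    rw [sum_darts_ne _ d₁] at h0
    have h1 : ∀ e : {e : E₁ // e ≠ d₁.1}, ∑ b, partFlow ψ y (e.1, b) = 0 := fun e => by
      have := hne (e.1, false) e.2
      rw [dartFlip_mk] at this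
      rw [Fintype.sum_bool]
      simp only [Bool.not_false] at this
      rw [this, neg_add_cancel]
    simp only [h1, Finset.sum_const_zero, add_zero] at h0
    exact (neg_eq_of_add_eq_zero_right h0).symm
  by_cases ha : a.1 = d₁.1
  · rcases eq_or_eq_dartFlip ha with rfl | rfl
    · exact hself
    · rw [dartFlip_dartFlip, hself, neg_neg]
  · exact hne a ha

omit h [Fintype E] [Fintype E₁] [Fintype E₂] in
theorem partFlow_joinDarts (y₁ : E₁ × Bool → R) (y₂ : E₂ × Bool → R) (c : R)
    (h₁ : ∀ a, y₁ (dartFlip E₁ a) = -y₁ a) :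
    partFlow ψ (fun d => joinDarts d₁ d₂ y₁ y₂ c (ψ.symm d)) = y₁ := by
  funext a
  by_cases ha : a.1 = d₁.1
  · rcases eq_or_eq_dartFlip ha with rfl | rfl
    · rw [partFlow_self]
      simp [joinDarts, cycIn, cycOut]
    · rw [partFlow_flip, h₁]
      simp only [joinDarts, cycIn, cycOut, Equiv.symm_apply_apply, cond_true, cond_false,
        Matrix.cons_val]
      abel
  · rw [partFlow_of_ne _ ha, Equiv.symm_apply_apply]; rfl

omit h [Fintype E] [Fintype E₁] [Fintype E₂] in
theorem partFlow_swap_joinDarts (y₁ : E₁ × Bool → R) (y₂ : E₂ × Bool → R) (c : R)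
    (h₂ : ∀ a, y₂ (dartFlip E₂ a) = -y₂ a) :
    partFlow ((swapEquiv d₂.1 d₁.1).trans ψ)
      (fun d => joinDarts d₁ d₂ y₁ y₂ c (ψ.symm d)) = y₂ := by
  funext a
  by_cases ha : a.1 = d₂.1
  · rcases eq_or_eq_dartFlip ha with rfl | rfl
    · rw [partFlow_self]
      simp [joinDarts, cycIn, cycOut, swapEquiv, swapDart, swapCycle]
    · rw [partFlow_flip, h₂]
      simp [joinDarts, cycIn, cycOut, swapEquiv, swapDart, swapCycle]
  · rw [partFlow_of_ne _ ha, Equiv.trans_apply, Equiv.symm_apply_apply]; rfl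

omit [Fintype E] [Fintype E₁] [Fintype E₂] in
theorem joinDarts_flip (y₁ : E₁ × Bool → R) (y₂ : E₂ × Bool → R) (c : R)
    (h₁ : ∀ a, y₁ (dartFlip E₁ a) = -y₁ a) (h₂ : ∀ a, y₂ (dartFlip E₂ a) = -y₂ a) (d : E × Bool) :
    joinDarts d₁ d₂ y₁ y₂ c (ψ.symm (dartFlip E d)) =
      -joinDarts d₁ d₂ y₁ y₂ c (ψ.symm d) := by
  obtain ⟨a, rfl⟩ := ψ.surjective d
  rw [← h.flip, Equiv.symm_apply_apply, Equiv.symm_apply_apply]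
  obtain ⟨(e | e) | i, b⟩ := a
  · exact h₁ (e.1, b)
  · exact h₂ (e.1, b)
  · cases b <;> simp [joinDarts]

theorem joinDarts_mem {y₁ : E₁ × Bool → R} {y₂ : E₂ × Bool → R} (h₁ : y₁ ∈ G₁.dartFlows R)
    (h₂ : y₂ ∈ G₂.dartFlows R) (c : R) :
    (fun d => joinDarts d₁ d₂ y₁ y₂ c (ψ.symm d)) ∈ G.dartFlows R := by
  refine ⟨h.joinDarts_flip y₁ y₂ c h₁.1 h₂.1, fun v => ?_⟩
  obtain ⟨v | v, rfl⟩ := φ.surjective v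
  · rw [h.netFlow_inl, partFlow_joinDarts _ _ _ h₁.1, h₁.2]
  · have := h.swap.netFlow_inl (fun d => joinDarts d₁ d₂ y₁ y₂ c (ψ.symm d)) v
    rw [partFlow_swap_joinDarts _ _ _ h₂.1, h₂.2] at this
    exact this

/-- Flows of a join are given by flows on the two parts and one more value. -/
def joinFlow (R : Type*) [AddCommGroup R] :
    (G₁.dartFlows R × G₂.dartFlows R) × R →+ G.dartFlows R where
  toFun x := ⟨_, h.joinDarts_mem x.1.1.2 x.1.2.2 x.2⟩
  map_zero' := by
    ext d
    obtain ⟨⟨(e | e) | i, b⟩, rfl⟩ := ψ.surjective d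
    · simp [joinDarts]
    · simp [joinDarts]
    · fin_cases i <;> cases b <;> simp [joinDarts]
  map_add' x y := by
    ext d
    obtain ⟨⟨(e | e) | i, b⟩, rfl⟩ := ψ.surjective d
    · simp [joinDarts]
    · simp [joinDarts]
    · fin_cases i <;> cases b <;> simp [joinDarts] <;> abel

theorem joinFlow_apply (x : (G₁.dartFlows R × G₂.dartFlows R) × R) (a) :
    (h.joinFlow R x).1 (ψ a) = joinDarts d₁ d₂ x.1.1.1 x.1.2.1 x.2 a :=
  congrArg (joinDarts d₁ d₂ x.1.1.1 x.1.2.1 x.2) (ψ.symm_apply_apply a)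

theorem joinFlow_surjective : Function.Surjective (h.joinFlow R) := by
  rintro ⟨y, hy⟩
  have m1 := h.partFlow_mem hy
  have m2 := h.swap.partFlow_mem hy
  refine ⟨((⟨_, m1⟩, ⟨_, m2⟩), y (ψ (cycOut 0))), Subtype.ext (funext fun d => ?_)⟩
  obtain ⟨a, rfl⟩ := ψ.surjective d
  rw [joinFlow_apply]
  have hin : ∀ i, y (ψ (cycIn i)) = -y (ψ (cycOut i)) := fun i => by
    rw [← hy.1, ← h.flip]; rfl
  have t1 := partFlow_self (ψ := ψ) y
  have t2 : partFlow ((swapEquiv d₂.1 d₁.1).trans ψ) y d₂ = y (ψ (cycOut 1)) + y (ψ (cycIn 0)) :=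
    partFlow_self y
  have t3 : partFlow ((swapEquiv d₂.1 d₁.1).trans ψ) y (dartFlip E₂ d₂) =
      y (ψ (cycOut 3)) + y (ψ (cycIn 2)) := partFlow_flip y
  rw [m2.1, t2] at t3
  rw [hin] at t1 t2
  rw [hin, hin] at t3
  have key : ∀ i, (![y (ψ (cycOut 0)), y (ψ (cycOut 0)) +
      partFlow ((swapEquiv d₂.1 d₁.1).trans ψ) y d₂, y (ψ (cycOut 0)) +
      partFlow ((swapEquiv d₂.1 d₁.1).trans ψ) y d₂ - partFlow ψ y d₁,
      y (ψ (cycOut 0)) - partFlow ψ y d₁] : Fin 4 → R) i = y (ψ (cycOut i)) := by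
    intro i
    fin_cases i
    · rfl
    · change y (ψ (cycOut 0)) + partFlow ((swapEquiv d₂.1 d₁.1).trans ψ) y d₂ = y (ψ (cycOut 1))
      rw [t2]; abel
    · change y (ψ (cycOut 0)) + partFlow ((swapEquiv d₂.1 d₁.1).trans ψ) y d₂ - partFlow ψ y d₁
        = y (ψ (cycOut 2))
      rw [t1, t2]
      have : y (ψ (cycOut 2)) = y (ψ (cycOut 3)) - (y (ψ (cycOut 3)) + -y (ψ (cycOut 2))) := by abel
      rw [this, ← t3]
      abel
    · change y (ψ (cycOut 0)) - partFlow ψ y d₁ = y (ψ (cycOut 3))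
      rw [t1]; abel
  obtain ⟨(e | e) | i, b⟩ := a
  · exact partFlow_of_ne (ψ := ψ) y (a := (e.1, b)) e.2
  · exact partFlow_of_ne (ψ := (swapEquiv d₂.1 d₁.1).trans ψ) y (a := (e.1, b)) e.2
  · cases b
    · exact key i
    · refine (congrArg (- ·) (key i)).trans (hin i).symm

/-- With a = y₁ d₁ and b = y₂ d₂, the cycle contributes c² + (c + b)² + (c + b - a)² + (c - a)², and
the removed edges contributed a² + b² to the parts; the difference is the perfect square (2c + b -
a)². -/
theorem dartForm_joinFlow (x y : (G₁.dartFlows ℤ × G₂.dartFlows ℤ) × ℤ) :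
    dartForm (h.joinFlow ℤ x).1 (h.joinFlow ℤ y).1 =
      (dartForm x.1.1.1 y.1.1.1 + dartForm x.1.2.1 y.1.2.1) +
        (2 * x.2 + x.1.2.1 d₂ - x.1.1.1 d₁) * (2 * y.2 + y.1.2.1 d₂ - y.1.1.1 d₁) := by
  classical
  have e0 := sum_dart_mul (h.joinFlow ℤ x).2.1 (h.joinFlow ℤ y).2.1
  have e1 := sum_dart_mul x.1.1.2.1 y.1.1.2.1
  have e2 := sum_dart_mul x.1.2.2.1 y.1.2.2.1
  rw [← ψ.sum_comp, sum_compEdge] at e0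
  rw [sum_darts_ne _ d₁, x.1.1.2.1, y.1.1.2.1] at e1
  rw [sum_darts_ne _ d₂, x.1.2.2.1, y.1.2.2.1] at e2
  simp only [h.joinFlow_apply, joinDarts, cycIn, cycOut, cond_true, cond_false] at e0
  simp at e0
  simp at e1 e2
  linarith

end IsJoin

end JoinFlow

end RotationSystem

theorem Cubical.of_forall_eq_zero {M : Type u} [AddCommGroup M] {B : M → M → ℤ} (h : ∀ x : M, x = 0)
    (hB : B 0 0 = 0) : Cubical M B :=
  ⟨0, 0, fun x y => by rw [h x, h y, hB]; simp, fun c => ⟨0, ⟨⟨0, rfl⟩, fun i => i.elim0⟩,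
    fun y _ => Subsingleton.elim _ _⟩⟩

namespace RotationSystem

open CompEdge

/-! ### Short cycles -/

section ShortCycles

variable {V : Type u} {E : Type v} [Fintype E] {G : RotationSystem V E}

theorem dartForm_le_card {y : E × Bool → ℤ} (s : Finset E) (h₁ : ∀ d, |y d| ≤ 1)
    (h₂ : ∀ d, d.1 ∉ s → y d = 0) : dartForm y y ≤ s.card := by
  classical
  rw [dartForm, ← Finset.sum_subset (Finset.subset_univ s) fun e _ he => by
    rw [h₂ (e, false) he, zero_mul]]
  refine (Finset.sum_le_card_nsmul s _ 1 fun e _ => ?_).trans (by simp)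
  rw [← abs_mul_abs_self]
  exact mul_le_one₀ (h₁ _) (abs_nonneg _) (h₁ _)

omit [Fintype E] in
theorem abs_dartUnit_le (d a : E × Bool) : |dartUnit d a| ≤ 1 := by
  by_cases h : a.1 = d.1
  · rcases eq_or_eq_dartFlip h with rfl | rfl
    · simp
    · rw [dartUnit_flip, dartUnit_self]; simp
  · rw [dartUnit_of_ne h]; simp

/-- A loop, a pair of parallel edges or a triangle would carry a unit flow of norm 1, 2 or 3. The
same argument serves in `not_parallel` and `not_triangle`. -/
theorem CubicalFlow.not_loop (h : G.CubicalFlow) (d : E × Bool) :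
    G.base d ≠ G.base (dartFlip E d) := by
  classical
  intro hd
  have h0 := h.eq_zero (y := dartUnit d) ⟨dartUnit_flip d, fun v => by
    rw [netFlow_dartUnit, hd, sub_self]⟩ ((dartForm_le_card {d.1} (abs_dartUnit_le d) fun a ha =>
      dartUnit_of_ne (by simpa using ha)).trans (by simp))
  have := congrFun h0 d
  simp at this

theorem CubicalFlow.not_parallel (h : G.CubicalFlow) {d d' : E × Bool} (hne : d.1 ≠ d'.1)
    (h₁ : G.base d = G.base d') (h₂ : G.base (dartFlip E d) = G.base (dartFlip E d')) : False := by
  classical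
  have h0 := h.eq_zero (y := dartUnit d + dartUnit (dartFlip E d'))
    ⟨fun a => by simp only [Pi.add_apply, dartUnit_flip]; ring, fun v => by
      rw [netFlow_add, netFlow_dartUnit, netFlow_dartUnit, h₁, h₂, dartFlip_dartFlip]; ring⟩
    ((dartForm_le_card {d.1, d'.1} (fun a => ?_) fun a ha => ?_).trans ?_)
  · have := congrFun h0 d
    rw [Pi.add_apply, dartUnit_self, dartUnit_of_ne (by simpa using hne)] at this
    simp at this
  · rw [Pi.add_apply]
    by_cases ha : a.1 = d.1
    · rw [dartUnit_of_ne (d := dartFlip E d') (by simpa [ha] using hne), add_zero]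
      exact abs_dartUnit_le _ _
    · rw [dartUnit_of_ne ha, zero_add]
      exact abs_dartUnit_le _ _
  · simp only [Finset.mem_insert, Finset.mem_singleton, not_or] at ha
    rw [Pi.add_apply, dartUnit_of_ne ha.1, dartUnit_of_ne (by simpa using ha.2), add_zero]
  · exact_mod_cast (Finset.card_le_two).trans (by norm_num)

theorem CubicalFlow.not_triangle (h : G.CubicalFlow) {a b c : E × Bool} (hab : a.1 ≠ b.1)
    (hac : a.1 ≠ c.1) (hbc : b.1 ≠ c.1) (h₁ : G.base (dartFlip E a) = G.base b)
    (h₂ : G.base (dartFlip E b) = G.base c) (h₃ : G.base (dartFlip E c) = G.base a) : False := by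
  classical
  have h0 := h.eq_zero (y := dartUnit a + dartUnit b + dartUnit c)
    ⟨fun x => by simp only [Pi.add_apply, dartUnit_flip]; ring, fun v => by
      rw [netFlow_add, netFlow_add, netFlow_dartUnit, netFlow_dartUnit, netFlow_dartUnit,
        h₁, h₂, h₃]; ring⟩
    ((dartForm_le_card {a.1, b.1, c.1} (fun x => ?_) fun x hx => ?_).trans ?_)
  · have := congrFun h0 a
    rw [Pi.add_apply, Pi.add_apply, dartUnit_self, dartUnit_of_ne hab, dartUnit_of_ne hac] at this
    simp at this
  · simp only [Pi.add_apply]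
    by_cases hxa : x.1 = a.1
    · rw [dartUnit_of_ne (d := b) (hxa ▸ hab), dartUnit_of_ne (d := c) (hxa ▸ hac), add_zero,
        add_zero]
      exact abs_dartUnit_le _ _
    · by_cases hxb : x.1 = b.1
      · rw [dartUnit_of_ne hxa, dartUnit_of_ne (d := c) (hxb ▸ hbc), zero_add, add_zero]
        exact abs_dartUnit_le _ _
      · rw [dartUnit_of_ne hxa, dartUnit_of_ne hxb, zero_add, zero_add]
        exact abs_dartUnit_le _ _
  · simp only [Finset.mem_insert, Finset.mem_singleton, not_or] at hx
    simp [dartUnit_of_ne hx.1, dartUnit_of_ne hx.2.1, dartUnit_of_ne hx.2.2]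
  · exact_mod_cast Finset.card_le_three

end ShortCycles

/-! ### The composition class -/

section Class

variable {V V₁ V₂ : Type u} {E E₁ E₂ : Type v} {G : RotationSystem V E}
  {G₁ : RotationSystem V₁ E₁} {G₂ : RotationSystem V₂ E₂} {d₁ : E₁ × Bool} {d₂ : E₂ × Bool}
  {φ : V₁ ⊕ V₂ ≃ V} {ψ : CompEdge d₁.1 d₂.1 × Bool ≃ E × Bool}

/-- The new coordinate of `Cubical.lift` is 2c + y₂ d₂ - y₁ d₁, and the 4-cycle itself is the vector
with value 2 there. If the forms on the parts vanish, so do y₁ d₁ and y₂ d₂, and the coordinate is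
the even number 2c. -/
theorem IsJoin.cubicalFlow [Fintype E] [Fintype E₁] [Fintype E₂] (h : IsJoin G G₁ G₂ d₁ d₂ φ ψ)
    (h₁ : G₁.CubicalFlow) (h₂ : G₂.CubicalFlow) : G.CubicalFlow := by
  refine (Cubical.comp_iff (h.joinFlow ℤ) h.joinFlow_surjective fun x y => rfl).1 ?_
  refine (Cubical.prod h₁ h₂).lift (AddMonoidHom.fst _ _) Prod.fst_surjective
    { toFun := fun x => 2 * x.2 + x.1.2.1 d₂ - x.1.1.1 d₁
      map_zero' := by simp
      map_add' := fun x y => by simp; ring } (fun x y => h.dartForm_joinFlow x y)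
    (w := (0, 1)) (by simp [dartForm]) (by simp) fun x hx hs => ?_
  have hx : dartForm x.1.1.1 x.1.1.1 + dartForm x.1.2.1 x.1.2.1 = 0 := hx
  have n1 := mul_self_nonneg (x.1.1.1 d₁)
  have n2 := mul_self_nonneg (x.1.2.1 d₂)
  have l1 := sq_le_dartForm x.1.1.2.1 d₁
  have l2 := sq_le_dartForm x.1.2.2.1 d₂
  have z1 : x.1.1.1 d₁ = 0 := mul_self_eq_zero.1 (by linarith)
  have z2 : x.1.2.1 d₂ = 0 := mul_self_eq_zero.1 (by linarith)
  simp only [AddMonoidHom.coe_mk, ZeroHom.coe_mk, z1, z2] at hs ⊢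
  rw [abs_le] at hs
  omega

/-- The parts of a join inherit the tiling property if the 4-cycle has even products with all
flows. -/
theorem IsJoin.cubicalFlow_parts [Fintype E] [Fintype E₁] [Fintype E₂]
    (h : IsJoin G G₁ G₂ d₁ d₂ φ ψ) (s : G.dartFlows ℤ →+ ℤ)
    (hs : ∀ y, dartForm (h.joinFlow ℤ (0, 1)).1 y.1 = 2 * s y)
    (hc : Cubical (G.dartFlows ℤ) fun x y => dartForm x.1 y.1 - s x * s y) :
    G₁.CubicalFlow ∧ G₂.CubicalFlow := by
  -- Half the product with the 4-cycle is the extra coordinate of `dartForm_joinFlow`; projecting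
  -- along the cycle therefore leaves the orthogonal sum of the parts.
  have hs' : ∀ x, s (h.joinFlow ℤ x) = 2 * x.2 + x.1.2.1 d₂ - x.1.1.1 d₁ := fun x => by
    have := hs (h.joinFlow ℤ x)
    rw [h.dartForm_joinFlow] at this
    simp [dartForm] at this
    linarith
  have h1 := (Cubical.comp_iff (h.joinFlow ℤ) h.joinFlow_surjective fun x y => rfl).2 hc
  refine Cubical.of_prod (by simp [dartForm]) (by simp [dartForm])
    ((Cubical.comp_iff (AddMonoidHom.fst _ _) Prod.fst_surjective fun x y => ?_).1 h1)
  rw [h.dartForm_joinFlow, hs', hs']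
  simp

/-- The ends of an edge do not separate the graph. -/
def EndsConn (G : RotationSystem V E) : Prop := ∀ d, G.ConnOff {x | G.IsEnd d x}

/-- 2-connectedness in terms of walks. -/
structure TwoConn (G : RotationSystem V E) : Prop where
  nonempty : Nonempty V
  conn : G.ConnOff ∅
  connOff : ∀ x, G.ConnOff {x}
  not_loop : ∀ d, G.base d ≠ G.base (dartFlip E d)

theorem twoConn_iff : G.TwoConn ↔ G.toGraph.IsTwoConn := by
  rw [isTwoConn_iff]
  exact ⟨fun ⟨h1, h2, h3, h4⟩ => ⟨h1, h2, h3, h4⟩, fun ⟨h1, h2, h3, h4⟩ => ⟨h1, h2, h3, h4⟩⟩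

theorem isEnd_self (G : RotationSystem V E) (d : E × Bool) : G.IsEnd d (G.base d) := Or.inl rfl

theorem isEnd_flip (G : RotationSystem V E) (d : E × Bool) :
    G.IsEnd d (G.base (dartFlip E d)) := Or.inr rfl

theorem exists_isEnd_ne {d : E × Bool} (h : G.base d ≠ G.base (dartFlip E d)) (x : V) :
    ∃ y, G.IsEnd d y ∧ y ≠ x := by
  by_cases hx : G.base d = x
  · exact ⟨_, G.isEnd_flip d, fun h' => h (hx.trans h'.symm)⟩
  · exact ⟨_, G.isEnd_self d, hx⟩

/-! ### Joins preserve 2-connectedness and connectedness off the ends of an edge. -/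

namespace IsJoin

variable (h : IsJoin G G₁ G₂ d₁ d₂ φ ψ)

include h

omit h in
theorem preimage_inl (x : V₁) : {z | φ (Sum.inl z) ∈ ({φ (Sum.inl x)} : Set V)} = {x} := by
  ext z; simp

theorem connOff_singleton_inl (h₁ : G₁.TwoConn) (h₂ : G₂.TwoConn) (x : V₁) :
    G.ConnOff {φ (Sum.inl x)} := by
  obtain ⟨y, hy, hyx⟩ := exists_isEnd_ne (h₁.not_loop d₁) x
  refine h.connOff (R := {φ (Sum.inl x)}) ?_ ?_ hy (G₂.isEnd_self d₂) (by simpa using hyx) (by simp)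
  · rw [preimage_inl]; exact h₁.connOff x
  · convert h₂.conn using 1
    ext z; simp

theorem base_ne (h₁ : G₁.TwoConn) (h₂ : G₂.TwoConn) (d : E × Bool) :
    G.base d ≠ G.base (dartFlip E d) := by
  obtain ⟨⟨(e | e) | i, b⟩, rfl⟩ := ψ.surjective d
  · rw [h.base_inl, h.base_flip_inl]
    simpa using h₁.not_loop (e.1, b)
  · rw [h.base_inr, h.base_flip_inr]
    simpa using h₂.not_loop (e.1, b)
  · rcases h.cycle_ends i b with ⟨x, y, -, -, h1, h2⟩ | ⟨x, y, -, -, h1, h2⟩ <;> rw [h1, h2] <;> simp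

theorem twoConn (h₁ : G₁.TwoConn) (h₂ : G₂.TwoConn) : G.TwoConn where
  nonempty := h₁.nonempty.map fun x => φ (Sum.inl x)
  conn := h.connOff (by simpa using h₁.conn) (by simpa using h₂.conn) (G₁.isEnd_self d₁)
    (G₂.isEnd_self d₂) (Set.notMem_empty _) (Set.notMem_empty _)
  connOff x := by
    obtain ⟨x | x, rfl⟩ := φ.surjective x
    · exact h.connOff_singleton_inl h₁ h₂ x
    · exact h.swap.connOff_singleton_inl h₂ h₁ x
  not_loop := h.base_ne h₁ h₂

theorem twoConn_inl (hG : G.TwoConn) (hd : G₁.base d₁ ≠ G₁.base (dartFlip E₁ d₁)) : G₁.TwoConn where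
  nonempty := ⟨G₁.base d₁⟩
  conn := h.connOff_inl (by rw [Set.image_empty]; exact hG.conn)
  connOff x := h.connOff_inl (by rw [Set.image_singleton]; exact hG.connOff _)
  not_loop a := by
    by_cases ha : a.1 = d₁.1
    · rcases eq_or_eq_dartFlip ha with rfl | rfl
      · exact hd
      · rw [dartFlip_dartFlip]; exact hd.symm
    · have := hG.not_loop (ψ (Sum.inl (Sum.inl ⟨a.1, ha⟩), a.2))
      rw [h.base_inl, h.base_flip_inl] at this
      exact fun h' => this (congrArg (fun x => φ (Sum.inl x)) h')

theorem connOff_ends_inl [Fintype E₁] (h₁ : G₁.TwoConn) (h₂ : G₂.TwoConn) (hc₁ : G₁.CubicalFlow)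
    (he₁ : G₁.EndsConn) (e : {e : E₁ // e ≠ d₁.1}) (b : Bool) :
    G.ConnOff {x | G.IsEnd (ψ (Sum.inl (Sum.inl e), b)) x} := by
  have hset : ∀ x, G.IsEnd (ψ (Sum.inl (Sum.inl e), b)) (φ (Sum.inl x)) ↔ G₁.IsEnd (e.1, b) x := by
    intro x
    simp [IsEnd, h.base_inl, h.base_flip_inl]
  have hset' : ∀ x, ¬ G.IsEnd (ψ (Sum.inl (Sum.inl e), b)) (φ (Sum.inr x)) := by
    intro x
    simp [IsEnd, h.base_inl, h.base_flip_inl]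
  -- Since d₁ is neither a loop nor parallel to e, one of its ends survives the removal of the ends
  -- of e, and it links what is left of the first part to the second.
  obtain ⟨x, hx, hxe⟩ : ∃ x, G₁.IsEnd d₁ x ∧ ¬ G₁.IsEnd (e.1, b) x := by
    by_contra! hcon
    have c1 := hcon _ (G₁.isEnd_self d₁)
    have c2 := hcon _ (G₁.isEnd_flip d₁)
    have hne := h₁.not_loop d₁
    rcases c1 with c1 | c1 <;> rcases c2 with c2 | c2
    · exact hne (c1.trans c2.symm)
    · exact hc₁.not_parallel (d := d₁) (d' := (e.1, b)) e.2.symm c1 c2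
    · refine hc₁.not_parallel (d := d₁) (d' := dartFlip E₁ (e.1, b)) e.2.symm c1 ?_
      rw [c2, dartFlip_dartFlip]
    · exact hne (c1.trans c2.symm)
  refine h.connOff ?_ ?_ hx (G₂.isEnd_self d₂) ((hset x).not.2 hxe) (hset' _)
  · convert he₁ (e.1, b) using 1
    ext x; exact hset x
  · convert h₂.conn using 1
    ext x; simpa using hset' x

/-- A cycle edge has one end in each part. Each part loses one vertex, hence remains connected, and
keeps an end of its distinguished edge; the cycle joins these two. -/
theorem connOff_ends_cycle (h₁ : G₁.TwoConn) (h₂ : G₂.TwoConn) (d : E × Bool) {x : V₁} {y : V₂}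
    (hd : ∀ z, G.IsEnd d z ↔ z = φ (Sum.inl x) ∨ z = φ (Sum.inr y)) : G.ConnOff {x | G.IsEnd d x} := by
  obtain ⟨x', hx', hx'e⟩ := exists_isEnd_ne (h₁.not_loop d₁) x
  obtain ⟨y', hy', hy'e⟩ := exists_isEnd_ne (h₂.not_loop d₂) y
  refine h.connOff ?_ ?_ hx' hy' ?_ ?_
  · convert h₁.connOff x using 1
    ext z; simp [hd]
  · convert h₂.connOff y using 1
    ext z; simp [hd]
  · simpa [hd] using hx'e
  · simpa [hd] using hy'e

theorem endsConn [Fintype E₁] [Fintype E₂] (h₁ : G₁.TwoConn) (h₂ : G₂.TwoConn)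
    (hc₁ : G₁.CubicalFlow) (hc₂ : G₂.CubicalFlow) (he₁ : G₁.EndsConn) (he₂ : G₂.EndsConn) :
    G.EndsConn := by
  intro d
  obtain ⟨⟨(e | e) | i, b⟩, rfl⟩ := ψ.surjective d
  · exact h.connOff_ends_inl h₁ h₂ hc₁ he₁ e b
  · exact h.swap.connOff_ends_inl h₂ h₁ hc₂ he₂ e b
  · rcases h.cycle_ends i b with ⟨x, y, -, -, h1, h2⟩ | ⟨x, y, -, -, h1, h2⟩
    · exact h.connOff_ends_cycle h₁ h₂ _ fun z => by rw [IsEnd, h1, h2]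
    · exact h.connOff_ends_cycle h₁ h₂ _ fun z => by rw [IsEnd, h1, h2, or_comm]

end IsJoin

theorem edge_exists_dart (hV : Nat.card V = 2) (e : E) (h : G.base (e, false) ≠ G.base (e, true))
    {a b : V} (hab : a ≠ b) : ∃ d, G.base d = a ∧ G.base (dartFlip E d) = b := by
  have : Finite V := Nat.finite_of_card_ne_zero (by rw [hV]; norm_num)
  have key : ∀ x, x = G.base (e, false) ∨ x = G.base (e, true) := by
    intro x
    have h2 : ({G.base (e, false), G.base (e, true)} : Set V) = Set.univ := by
      refine Set.eq_of_subset_of_ncard_le (Set.subset_univ _) ?_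
      rw [Set.ncard_pair h, Set.ncard_univ, hV]
    have := Set.mem_univ x
    rwa [← h2] at this
  rcases key a with rfl | rfl <;> rcases key b with rfl | rfl
  · exact absurd rfl hab
  · exact ⟨(e, false), rfl, rfl⟩
  · exact ⟨(e, true), rfl, rfl⟩
  · exact absurd rfl hab

/-- Besides the properties in the theorem, the induction carries `EndsConn`, on which the
recognition of drawings rests. -/
theorem CompositionClass.properties (h : G.CompositionClass) : Finite V ∧ Finite E ∧ G.TwoConn ∧
    G.EndsConn ∧ ∀ [Fintype E], G.CubicalFlow := by
  induction h with
  | @vertex V E G hV hE =>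
    obtain ⟨hs, hn⟩ := Nat.card_eq_one_iff_unique.1 hV
    refine ⟨Finite.of_subsingleton, inferInstance, ⟨hn, fun a b _ _ => ?_, fun x a b _ _ => ?_,
      fun d => hE.elim d.1⟩, fun d => hE.elim d.1, ?_⟩
    · rw [Subsingleton.elim a b]; exact Relation.ReflTransGen.refl
    · rw [Subsingleton.elim a b]; exact Relation.ReflTransGen.refl
    · intro _
      exact Cubical.of_forall_eq_zero (fun x => Subtype.ext (funext fun d => hE.elim d.1))
        (by simp [dartForm])
  | @edge V E G hV hE hl =>
    obtain ⟨hs, ⟨e⟩⟩ := Nat.card_eq_one_iff_unique.1 hE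
    have hc : ∀ R, G.ConnOff R := by
      intro R a b ha hb
      by_cases hab : a = b
      · rw [hab]; exact Relation.ReflTransGen.refl
      · obtain ⟨d, rfl, rfl⟩ := edge_exists_dart hV e (hl e) hab
        exact Reach.of_dart d (Set.mem_univ _) ha hb
    refine ⟨Nat.finite_of_card_ne_zero (by rw [hV]; norm_num), Finite.of_subsingleton,
      ⟨⟨G.base (e, false)⟩, hc _, fun x => hc _, ?_⟩, fun d => hc _, ?_⟩
    · rintro ⟨e, b⟩
      cases b
      · exact hl e
      · exact (hl e).symm
    · intro _
      refine Cubical.of_forall_eq_zero (fun y => Subtype.ext (funext fun d => ?_))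
        (by simp [dartForm])
      have h1 := y.2.2 (G.base d)
      have h2 : G.base d ≠ G.base (dartFlip E d) := by
        obtain ⟨e, b⟩ := d
        cases b
        · exact hl e
        · exact (hl e).symm
      classical
      rw [netFlow, Finset.sum_eq_single d] at h1
      · simpa using h1
      · intro a _ ha
        rcases eq_or_eq_dartFlip (Subsingleton.elim a.1 d.1) with rfl | rfl
        · exact absurd rfl ha
        · rw [if_neg h2.symm]
      · intro hd
        exact absurd (Finset.mem_univ d) hd
  | @comp V V₁ V₂ E E₁ E₂ G G₁ G₂ _ _ hcomp ih₁ ih₂ =>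
    obtain ⟨d₁, d₂, -, -, hal⟩ := hcomp
    obtain ⟨φ, ψ, h⟩ := hal.exists_isJoin
    obtain ⟨fV₁, fE₁, t₁, e₁, c₁⟩ := ih₁
    obtain ⟨fV₂, fE₂, t₂, e₂, c₂⟩ := ih₂
    have fE : Finite (E × Bool) := Finite.of_equiv _ ψ
    have := Fintype.ofFinite E₁
    have := Fintype.ofFinite E₂
    refine ⟨Finite.of_equiv _ φ, Finite.of_surjective (Prod.fst : E × Bool → E) Prod.fst_surjective,
      h.twoConn t₁ t₂, h.endsConn t₁ t₂ c₁ c₂ e₁ e₂, ?_⟩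
    intro _
    exact h.cubicalFlow c₁ c₂

end Class

end RotationSystem

namespace RotationSystem

/-! ### Plane drawings have potentials -/

section Planar

variable {V : Type u} {E : Type v} {G : RotationSystem V E}

theorem base_rot (G : RotationSystem V E) (d : E × Bool) : G.base (G.rot d) = G.base d :=
  ((G.rot_sameCycle _ _).1 (Equiv.Perm.sameCycle_apply_right.2 (Equiv.Perm.SameCycle.refl _ d))).symm

theorem mem_component_iff {x y : V} : y ∈ G.component x ↔ G.Reach Set.univ ∅ x y := by
  have h : G.toGraph.Adj = G.Step Set.univ ∅ := by
    funext a b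
    rw [eq_iff_iff, toGraph_adj_iff]
    simp [Step]
  rw [component, Reach, ← h]; rfl

theorem base_flip_mem_component {x : V} {d : E × Bool} :
    G.base (dartFlip E d) ∈ G.component x ↔ G.base d ∈ G.component x := by
  have key : ∀ d, G.base d ∈ G.component x → G.base (dartFlip E d) ∈ G.component x := by
    intro d hd
    rw [mem_component_iff] at hd ⊢
    exact hd.trans (Reach.of_dart d (Set.mem_univ _) (Set.notMem_empty _) (Set.notMem_empty _))
  exact ⟨fun h => by simpa using key _ h, key d⟩

theorem base_faceNext_mem_component {x : V} {d : E × Bool} :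
    G.base (G.faceNext d) ∈ G.component x ↔ G.base d ∈ G.component x := by
  rw [faceNext, Equiv.Perm.mul_apply, base_rot, base_flip_mem_component]

theorem faceNext_flip (d : E × Bool) : G.faceNext (dartFlip E d) = G.rot d := by
  rw [faceNext, Equiv.Perm.mul_apply, dartFlip_dartFlip]

/-- The faces of the drawing of the component of `x`. -/
abbrev Face (G : RotationSystem V E) (x : V) : Type v :=
  {F : Set (E × Bool) // ∃ a, G.base a ∈ G.component x ∧ F = {b | G.faceNext.SameCycle a b}}

/-- The face that has a given dart on its boundary. -/
def faceOf {x : V} (d : E × Bool) (h : G.base d ∈ G.component x) : G.Face x :=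
  ⟨{b | G.faceNext.SameCycle d b}, d, h, rfl⟩

theorem faceOf_faceNext {x : V} (d : E × Bool) (h : G.base d ∈ G.component x) :
    faceOf (G.faceNext d) (base_faceNext_mem_component.2 h) = faceOf d h :=
  Subtype.ext (Set.ext fun _ => Equiv.Perm.sameCycle_apply_left)

open Classical in
/-- The function on the darts that is induced by a function on the faces. -/
noncomputable def faceFun {x : V} (f : G.Face x → ZMod 2) (d : E × Bool) : ZMod 2 :=
  if h : G.base d ∈ G.component x then f (faceOf d h) else 0

theorem faceFun_faceNext {x : V} (f : G.Face x → ZMod 2) (d : E × Bool) :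
    faceFun f (G.faceNext d) = faceFun f d := by
  by_cases h : G.base d ∈ G.component x
  · rw [faceFun, faceFun, dif_pos h, dif_pos (base_faceNext_mem_component.2 h), faceOf_faceNext]
  · rw [faceFun, faceFun, dif_neg h, dif_neg (base_faceNext_mem_component.not.2 h)]

open Classical in
/-- The function on the darts that is induced by a function on the vertices. -/
noncomputable def vertexFun {x : V} (g : G.component x → ZMod 2) (d : E × Bool) : ZMod 2 :=
  if h : G.base d ∈ G.component x then g ⟨G.base d, h⟩ else 0

theorem vertexFun_eq {x : V} (g : G.component x → ZMod 2) {a b : E × Bool}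
    (h : G.base a = G.base b) : vertexFun g a = vertexFun g b := by
  by_cases ha : G.base a ∈ G.component x
  · rw [vertexFun, vertexFun, dif_pos ha, dif_pos (h ▸ ha)]
    exact congrArg g (Subtype.ext h)
  · rw [vertexFun, vertexFun, dif_neg ha, dif_neg (h ▸ ha)]

/-- The edges of the component of `x`. -/
abbrev ComponentEdge (G : RotationSystem V E) (x : V) : Type v :=
  {e : E // G.base (e, false) ∈ G.component x}

/-- The coboundary of functions on the faces. -/
noncomputable def faceBoundary (G : RotationSystem V E) (x : V) :
    (G.Face x → ZMod 2) →ₗ[ZMod 2] (G.ComponentEdge x → ZMod 2) where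
  toFun f e := faceFun f (e.1, false) + faceFun f (e.1, true)
  map_add' f g := by
    ext e
    have h1 : ∀ d, faceFun (f + g) d = faceFun f d + faceFun g d := fun d => by
      simp only [faceFun]; split_ifs <;> simp
    simp only [h1, Pi.add_apply]
    ring
  map_smul' c f := by
    ext e
    have h1 : ∀ d, faceFun (c • f) d = c * faceFun f d := fun d => by
      simp only [faceFun]; split_ifs <;> simp
    simp only [h1, Pi.smul_apply, RingHom.id_apply, smul_eq_mul]
    ring

/-- The coboundary of functions on the vertices. -/
noncomputable def vertexCoboundary (G : RotationSystem V E) (x : V) :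
    (G.component x → ZMod 2) →ₗ[ZMod 2] (G.ComponentEdge x → ZMod 2) where
  toFun g e := vertexFun g (e.1, false) + vertexFun g (e.1, true)
  map_add' f g := by
    ext e
    have h1 : ∀ d, vertexFun (f + g) d = vertexFun f d + vertexFun g d := fun d => by
      simp only [vertexFun]; split_ifs <;> simp
    simp only [h1, Pi.add_apply]
    ring
  map_smul' c f := by
    ext e
    have h1 : ∀ d, vertexFun (c • f) d = c * vertexFun f d := fun d => by
      simp only [vertexFun]; split_ifs <;> simp
    simp only [h1, Pi.smul_apply, RingHom.id_apply, smul_eq_mul]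
    ring

theorem eq_of_add_eq_zero_zmod_two {a b : ZMod 2} (h : a + b = 0) : b = a := by
  rw [← neg_eq_of_add_eq_zero_right h, ZMod.neg_eq_self_mod_two]

theorem eq_add_of_add_eq_zmod_two {a b c : ZMod 2} (h : a + b = c) : b = a + c := by
  rw [← h, ← add_assoc, CharTwo.add_self_eq_zero, zero_add]

theorem flip_eq_of_edge {x : V} {p : E × Bool → ZMod 2} {d : E × Bool}
    (hd : G.base d ∈ G.component x)
    (h : ∀ e : G.ComponentEdge x, p (e.1, false) + p (e.1, true) = 0) : p (dartFlip E d) = p d := by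
  obtain ⟨e, b⟩ := d
  cases b
  · exact eq_of_add_eq_zero_zmod_two (h ⟨e, hd⟩)
  · exact (eq_of_add_eq_zero_zmod_two (h ⟨e, base_flip_mem_component.2 hd⟩)).symm

theorem apply_eq_of_base_eq [Finite E] {α : Type*} (f : E × Bool → α) {v : V}
    (h : ∀ d, G.base d = v → f (G.rot d) = f d) {a b : E × Bool} (ha : G.base a = v)
    (hb : G.base b = v) : f b = f a := by
  obtain ⟨n, -, rfl⟩ := ((G.rot_sameCycle a b).2 (ha.trans hb.symm)).exists_pow_eq'
  have key : ∀ n : ℕ, G.base ((G.rot ^ n) a) = v ∧ f ((G.rot ^ n) a) = f a := by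
    intro n
    induction n with
    | zero => exact ⟨ha, rfl⟩
    | succ n ih =>
      rw [pow_succ', Equiv.Perm.mul_apply]
      exact ⟨(G.base_rot _).trans ih.1, (h _ ih.1).trans ih.2⟩
  exact (key n).2

/-- A function on the faces that does not change across edges is constant around each vertex and
along each edge, hence on the component. -/
theorem ker_faceBoundary_le [Finite E] {x : V} {d₀ : E × Bool} (hd₀ : G.base d₀ ∈ G.component x) :
    LinearMap.ker (G.faceBoundary x) ≤ Submodule.span (ZMod 2) {fun _ => 1} := by
  intro f hf
  rw [LinearMap.mem_ker] at hf
  have hflip : ∀ d, G.base d ∈ G.component x → faceFun f (dartFlip E d) = faceFun f d := fun d hd =>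
    flip_eq_of_edge hd fun e => congrFun hf e
  have hrot : ∀ d, G.base d ∈ G.component x → faceFun f (G.rot d) = faceFun f d := fun d hd => by
    rw [← faceNext_flip, faceFun_faceNext, hflip d hd]
  have hcyc : ∀ a b, G.base a ∈ G.component x → G.base a = G.base b →
      faceFun f b = faceFun f a := by
    intro a b ha hab
    exact apply_eq_of_base_eq (faceFun f) (fun d hd => hrot d (hd ▸ ha)) rfl hab.symm
  have hall : ∀ b, G.Reach Set.univ ∅ (G.base d₀) b → b ∈ G.component x ∧
      ∀ d, G.base d = b → faceFun f d = faceFun f d₀ := by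
    intro b hb
    induction hb with
    | refl => exact ⟨hd₀, fun d hd => hcyc _ _ hd₀ hd.symm⟩
    | tail _ hs ih =>
      obtain ⟨a, rfl, rfl, -⟩ := hs
      refine ⟨base_flip_mem_component.2 ih.1, fun d hd => ?_⟩
      rw [hcyc (dartFlip E a) d (base_flip_mem_component.2 ih.1) hd.symm, hflip a ih.1, ih.2 a rfl]
  rw [Submodule.mem_span_singleton]
  refine ⟨faceFun f d₀, ?_⟩
  ext ⟨_, a, ha, rfl⟩
  have h1 := (hall (G.base a) ((mem_component_iff.1 hd₀).symm.trans (mem_component_iff.1 ha))).2 a rfl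
  rw [Pi.smul_apply, smul_eq_mul, mul_one, ← h1, faceFun, dif_pos ha]
  rfl

theorem ker_vertexCoboundary_le (x : V) :
    LinearMap.ker (G.vertexCoboundary x) ≤ Submodule.span (ZMod 2) {fun _ => 1} := by
  intro g hg
  rw [LinearMap.mem_ker] at hg
  have hx : x ∈ G.component x := mem_component_iff.2 Relation.ReflTransGen.refl
  have hflip : ∀ d, G.base d ∈ G.component x → vertexFun g (dartFlip E d) = vertexFun g d :=
    fun d hd => flip_eq_of_edge hd fun e => congrFun hg e
  have hall : ∀ b, G.Reach Set.univ ∅ x b → ∀ hb : b ∈ G.component x, g ⟨b, hb⟩ = g ⟨x, hx⟩ := by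
    intro b hb
    induction hb with
    | refl => exact fun _ => rfl
    | tail h hs ih =>
      obtain ⟨a, rfl, rfl, -⟩ := hs
      intro hb
      have ha := base_flip_mem_component.1 hb
      have := hflip a ha
      rw [vertexFun, vertexFun, dif_pos hb, dif_pos ha] at this
      rw [this, ih ha]
  rw [Submodule.mem_span_singleton]
  refine ⟨g ⟨x, hx⟩, ?_⟩
  ext ⟨b, hb⟩
  rw [Pi.smul_apply, smul_eq_mul, mul_one, hall b (mem_component_iff.1 hb) hb]

theorem sum_componentEdge [Fintype E] (x : V) [Fintype (G.ComponentEdge x)] (F : E → ZMod 2)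
    (hF : ∀ e, G.base (e, false) ∉ G.component x → F e = 0) :
    ∑ e : G.ComponentEdge x, F e.1 = ∑ e, F e := by
  classical
  rw [← Finset.sum_subtype (Finset.univ.filter fun e => G.base (e, false) ∈ G.component x)
    (fun e => by simp) F]
  refine Finset.sum_subset (Finset.subset_univ _) fun e _ he => hF e ?_
  simpa using he

/-- `faceNext` keeps the face of a dart d and moves the base to that of the other half of d.
Reindexing along it shows that the sums over the two halves agree, and they cancel mod 2. -/
theorem faceBoundary_dotProduct [Fintype E] (x : V) [Fintype (G.ComponentEdge x)]
    (f : G.Face x → ZMod 2) (g : G.component x → ZMod 2) :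
    G.faceBoundary x f ⬝ᵥ G.vertexCoboundary x g = 0 := by
  have h1 : G.faceBoundary x f ⬝ᵥ G.vertexCoboundary x g = ∑ e : E,
      (faceFun f (e, false) + faceFun f (e, true)) *
        (vertexFun g (e, false) + vertexFun g (e, true)) := by
    refine sum_componentEdge x (fun e => (faceFun f (e, false) + faceFun f (e, true)) *
        (vertexFun g (e, false) + vertexFun g (e, true))) fun e he => ?_
    have he' : G.base (e, true) ∉ G.component x := fun h => he (base_flip_mem_component.1 h)
    simp [faceFun, he, he']
  have h2 : ∑ d : E × Bool, faceFun f d * (vertexFun g d + vertexFun g (dartFlip E d)) =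
      ∑ e : E, (faceFun f (e, false) + faceFun f (e, true)) *
        (vertexFun g (e, false) + vertexFun g (e, true)) := by
    rw [Fintype.sum_prod_type]
    refine Finset.sum_congr rfl fun e _ => ?_
    rw [Fintype.sum_bool]
    simp only [dartFlip_mk, Bool.not_true, Bool.not_false]
    ring
  have h3 : ∑ d : E × Bool, faceFun f d * vertexFun g (dartFlip E d) =
      ∑ d : E × Bool, faceFun f d * vertexFun g d := by
    rw [← Equiv.sum_comp G.faceNext fun d => faceFun f d * vertexFun g d]
    refine Finset.sum_congr rfl fun d _ => ?_
    rw [faceFun_faceNext, vertexFun_eq g (a := G.faceNext d) (b := dartFlip E d)]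
    rw [faceNext, Equiv.Perm.mul_apply, base_rot]
  rw [h1, ← h2]
  simp only [mul_add, Finset.sum_add_distrib]
  rw [h3, CharTwo.add_self_eq_zero]

/-- A component with a dart has a face, so the maximum with 1 in `faceCount` is idle. -/
theorem card_componentEdge_le [Finite V] [Finite E] {x : V} (hG : G.IsPlanar) {d₀ : E × Bool}
    (hd₀ : G.base d₀ ∈ G.component x) :
    Nat.card (G.component x) + Nat.card (G.Face x) = Nat.card (G.ComponentEdge x) + 2 := by
  have h := hG x
  have h1 : 1 ≤ Nat.card (G.Face x) := by
    have : Nonempty (G.Face x) := ⟨faceOf d₀ hd₀⟩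
    exact Nat.card_pos
  rw [show G.faceCount x = Nat.card (G.Face x) from max_eq_right h1] at h
  exact h

/-- Exactness by counting. Boundaries of face sets form a space of dimension at least F - 1,
orthogonal to the vertex coboundaries, whose dimension is at least V - 1. By Euler's formula E - (V
- 1) = F - 1, so they fill the whole orthogonal complement. -/
theorem mem_range_faceBoundary [Fintype V] [Fintype E] {x : V} (hG : G.IsPlanar) {d₀ : E × Bool}
    (hd₀ : G.base d₀ ∈ G.component x) (y : G.ComponentEdge x → ZMod 2)
    [Fintype (G.ComponentEdge x)]
    (hy : ∀ g, y ⬝ᵥ G.vertexCoboundary x g = 0) : ∃ f, G.faceBoundary x f = y := by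
  classical
  have := Fintype.ofFinite (G.Face x)
  have := Fintype.ofFinite (G.component x)
  set K := LinearMap.toMatrix' (G.vertexCoboundary x) with hK
  have hKv : ∀ g, K.mulVec g = G.vertexCoboundary x g := fun g => by
    rw [hK, ← Matrix.toLin'_apply, Matrix.toLin'_toMatrix']
  have hmem : ∀ z : G.ComponentEdge x → ZMod 2, (∀ g, z ⬝ᵥ G.vertexCoboundary x g = 0) →
      z ∈ LinearMap.ker K.transpose.mulVecLin := by
    intro z hz
    rw [LinearMap.mem_ker, Matrix.mulVecLin_apply]
    ext v
    have := hz (Pi.single v 1)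
    rw [← hKv, Matrix.dotProduct_mulVec, ← Matrix.mulVec_transpose, dotProduct_single_one] at this
    exact this
  have hle : LinearMap.range (G.faceBoundary x) ≤ LinearMap.ker K.transpose.mulVecLin := by
    rintro _ ⟨f, rfl⟩
    exact hmem _ fun g => faceBoundary_dotProduct x f g
  have hspan : ∀ {ι : Type _} [Fintype ι] (W : Submodule (ZMod 2) (ι → ZMod 2)),
      W ≤ Submodule.span (ZMod 2) {fun _ => 1} → Module.finrank (ZMod 2) W ≤ 1 := fun W hW =>
    (Submodule.finrank_mono hW).trans (by
      simpa using finrank_span_le_card (R := ZMod 2) ({fun _ => 1} : Set (_ → ZMod 2)))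
  -- The same bound once more, since faces and vertices live in different universes.
  have hspan' : ∀ {ι : Type _} [Fintype ι] (W : Submodule (ZMod 2) (ι → ZMod 2)),
      W ≤ Submodule.span (ZMod 2) {fun _ => 1} → Module.finrank (ZMod 2) W ≤ 1 := fun W hW =>
    (Submodule.finrank_mono hW).trans (by
      simpa using finrank_span_le_card (R := ZMod 2) ({fun _ => 1} : Set (_ → ZMod 2)))
  have r1 := (G.faceBoundary x).finrank_range_add_finrank_ker
  have r2 := (G.vertexCoboundary x).finrank_range_add_finrank_ker
  have r3 := K.transpose.mulVecLin.finrank_range_add_finrank_ker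
  have r4 : Module.finrank (ZMod 2) (LinearMap.range K.transpose.mulVecLin) =
      Module.finrank (ZMod 2) (LinearMap.range (G.vertexCoboundary x)) := by
    have e : K.mulVecLin = G.vertexCoboundary x := LinearMap.ext hKv
    rw [← e]
    exact K.rank_transpose
  have k1 := hspan _ (ker_faceBoundary_le hd₀)
  have k2 := hspan' _ (ker_vertexCoboundary_le (G := G) x)
  have hc := card_componentEdge_le hG hd₀
  rw [Module.finrank_fintype_fun_eq_card, ← Nat.card_eq_fintype_card] at r1 r2 r3
  have heq : LinearMap.range (G.faceBoundary x) = LinearMap.ker K.transpose.mulVecLin := by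
    refine Submodule.eq_of_le_of_finrank_le hle ?_
    omega
  have := hmem y hy
  rwa [← heq] at this

/-- Conservation makes a flow mod 2 orthogonal to all vertex coboundaries, hence the boundary of a
set of faces; the indicator of that set is the potential. It is constant along `faceNext`, so the
two conditions on a potential are the same. -/
theorem exists_potential_component [Fintype V] [Fintype E] (hG : G.IsPlanar) (x : V)
    {y : E × Bool → ZMod 2} (hy : y ∈ G.dartFlows (ZMod 2)) : ∃ p : E × Bool → ZMod 2,
    ∀ d, G.base d ∈ G.component x → p (dartFlip E d) = p d + y d ∧ p (G.rot d) = p d + y d := by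
  classical
  by_cases hne : ∃ d₀, G.base d₀ ∈ G.component x
  · obtain ⟨d₀, hd₀⟩ := hne
    have := Fintype.ofFinite (G.ComponentEdge x)
    have hyflip : ∀ d, y (dartFlip E d) = y d := fun d => by
      rw [hy.1, ZMod.neg_eq_self_mod_two]
    obtain ⟨f, hf⟩ := mem_range_faceBoundary hG hd₀ (fun e => y (e.1, false)) (by
      intro g
      have h1 : (fun e : G.ComponentEdge x => y (e.1, false)) ⬝ᵥ G.vertexCoboundary x g =
          ∑ e : E, y (e, false) * (vertexFun g (e, false) + vertexFun g (e, true)) := by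
        refine sum_componentEdge x (fun e => y (e, false) *
          (vertexFun g (e, false) + vertexFun g (e, true))) fun e he => ?_
        have he' : G.base (e, true) ∉ G.component x := fun h => he (base_flip_mem_component.1 h)
        simp [vertexFun, he, he']
      have h2 : ∑ d, y d * vertexFun g d =
          ∑ e : E, y (e, false) * (vertexFun g (e, false) + vertexFun g (e, true)) := by
        rw [Fintype.sum_prod_type]
        refine Finset.sum_congr rfl fun e _ => ?_
        have : y (e, true) = y (e, false) := hyflip (e, false)
        rw [Fintype.sum_bool, this]
        ring
      rw [h1, ← h2]
      refine sum_eq_zero_of_netFlow (G := G) fun v => ?_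
      have h3 : ∀ d, (if G.base d = v then y d * vertexFun g d else 0) =
          (if G.base d = v then y d else 0) *
            (if h : v ∈ G.component x then g ⟨v, h⟩ else 0) := by
        intro d
        by_cases hd : G.base d = v
        · subst hd
          simp [vertexFun]
        · simp [hd]
      have h4 : ∑ d, (if G.base d = v then y d else 0) = 0 := hy.2 v
      change ∑ d, (if G.base d = v then y d * vertexFun g d else 0) = 0
      simp only [h3]
      rw [← Finset.sum_mul, h4, zero_mul])
    refine ⟨faceFun f, fun d hd => ?_⟩
    have hflip : faceFun f (dartFlip E d) = faceFun f d + y d := by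
      obtain ⟨e, b⟩ := d
      cases b
      · exact eq_add_of_add_eq_zmod_two (congrFun hf ⟨e, hd⟩)
      · refine eq_add_of_add_eq_zmod_two ?_
        rw [add_comm, ← hyflip]
        exact congrFun hf ⟨e, base_flip_mem_component.2 hd⟩
    exact ⟨hflip, by rw [← hflip, ← faceNext_flip, faceFun_faceNext]⟩
  · exact ⟨0, fun d hd => absurd ⟨d, hd⟩ hne⟩

theorem IsPlanar.hasPotentials [Fintype V] [Fintype E] (hG : G.IsPlanar) : G.HasPotentials := by
  intro y hy
  choose p hp using fun x => exists_potential_component hG x hy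
  -- One representative is fixed for each component, so that the potentials chosen on the components
  -- fit together.
  let S : Setoid V := ⟨G.Reach Set.univ ∅, fun _ => Relation.ReflTransGen.refl, Reach.symm,
    Reach.trans⟩
  have hrep : ∀ v, G.Reach Set.univ ∅ (Quotient.mk S v).out v := fun v =>
    Quotient.exact (Quotient.out_eq (Quotient.mk S v))
  refine ⟨fun d => p (Quotient.mk S (G.base d)).out d, fun d => ?_⟩
  have h1 := hp (Quotient.mk S (G.base d)).out d (mem_component_iff.2 (hrep _))
  have h2 : Quotient.mk S (G.base (dartFlip E d)) = Quotient.mk S (G.base d) :=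
    (Quotient.sound (Reach.of_dart d (Set.mem_univ _) (Set.notMem_empty _)
      (Set.notMem_empty _))).symm
  refine ⟨?_, ?_⟩
  · simp only [h2]; exact h1.1
  · simp only [base_rot]; exact h1.2

end Planar

end RotationSystem

/-! ### First-return permutations -/

section FirstReturn

variable {α : Type u} [Finite α] (σ : Equiv.Perm α) (p : α → Prop)

theorem exists_firstReturn_eq (a : {a // p a}) : ∃ k : ℕ,
    (firstReturn σ p a).1 = (σ ^ (k + 1)) a.1 ∧ ∀ j < k, ¬ p ((σ ^ (j + 1)) a.1) := by
  classical
  exact ⟨Nat.find (exists_return σ p a), rfl, fun j hj => Nat.find_min _ hj⟩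

theorem firstReturn_eq_of_pow {a b : {a // p a}} (k : ℕ) (h : (σ ^ (k + 1)) a.1 = b.1)
    (hk : ∀ j < k, ¬ p ((σ ^ (j + 1)) a.1)) : firstReturn σ p a = b := by
  obtain ⟨k', h', hk'⟩ := exists_firstReturn_eq σ p a
  have h1 : ¬ k' < k := fun hlt => hk k' hlt (h' ▸ (firstReturn σ p a).2)
  have h2 : ¬ k < k' := fun hlt => hk' k hlt (h ▸ b.2)
  obtain rfl : k = k' := by omega
  exact Subtype.ext (h'.trans h)

/-- The points skipped before the return lie outside p, where y vanishes; only the increment at a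
counts. -/
theorem firstReturn_additive {A : Type*} [AddCommGroup A] (q y : α → A) (S : α → Prop)
    (hS : ∀ x, S x → S (σ x)) (hq : ∀ x, S x → q (σ x) = q x + y x)
    (hy : ∀ x, S x → ¬ p x → y x = 0) (a : {a // p a}) (ha : S a.1) :
    q (firstReturn σ p a).1 = q a.1 + y a.1 := by
  obtain ⟨k, h, hk⟩ := exists_firstReturn_eq σ p a
  have key : ∀ j ≤ k, S ((σ ^ (j + 1)) a.1) ∧ q ((σ ^ (j + 1)) a.1) = q a.1 + y a.1 := by
    intro j
    induction j with
    | zero => exact fun _ => ⟨by simpa using hS _ ha, by simpa using hq _ ha⟩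
    | succ j ih =>
      intro hj
      obtain ⟨h1, h2⟩ := ih (by omega)
      rw [pow_succ' σ (j + 1), Equiv.Perm.mul_apply]
      exact ⟨hS _ h1, by rw [hq _ h1, hy _ h1 (hk j (by omega)), add_zero, h2]⟩
  rw [h]
  exact (key k le_rfl).2

/-- If a returned to itself first, its cycle under the first-return permutation would not contain b.
-/
theorem firstReturn_pair {a b : α} (hab : a ≠ b) (h : σ.SameCycle a b) :
    (firstReturn σ (fun x => x = a ∨ x = b) ⟨a, Or.inl rfl⟩).1 = b := by
  have h1 := (firstReturn σ (fun x => x = a ∨ x = b) ⟨a, Or.inl rfl⟩).2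
  refine h1.resolve_left fun h2 => hab ?_
  have h3 := (firstReturn_sameCycle σ (fun x => x = a ∨ x = b) ⟨a, Or.inl rfl⟩ ⟨b, Or.inr rfl⟩).2 h
  have h4 : Function.IsFixedPt (firstReturn σ (fun x => x = a ∨ x = b)) ⟨a, Or.inl rfl⟩ :=
    Subtype.ext h2
  exact congrArg Subtype.val (h3.eq_of_left h4)

end FirstReturn

namespace RotationSystem

/-! ### Induced rotation systems -/

section Induced

variable {V V' : Type u} {E E' : Type v} {G : RotationSystem V E}

/-- If only a and b carry flow at their vertex, the potential jumps only at these two darts, so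
going around from a to b crosses just a. -/
theorem IsPotential.eq_add_of_pair [Finite E] {y q : E × Bool → ZMod 2} (hq : G.IsPotential y q)
    {a b : E × Bool} (hab : a ≠ b) (h : G.base a = G.base b)
    (h0 : ∀ d, G.base d = G.base a → d ≠ a → d ≠ b → y d = 0) : q b = q a + y a := by
  have := firstReturn_additive G.rot (fun x => x = a ∨ x = b) q y (fun d => G.base d = G.base a)
    (fun x hx => (G.base_rot x).trans hx) (fun x _ => (hq x).2)
    (fun x hx hx' => h0 x hx (fun h => hx' (Or.inl h)) fun h => hx' (Or.inr h))
    ⟨a, Or.inl rfl⟩ rfl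
  rwa [firstReturn_pair G.rot hab ((G.rot_sameCycle a b).2 h)] at this

variable [Finite E]

/-- The rotation system on the darts in the range of `ι`, with the inherited cyclic orders. -/
noncomputable def induced (G : RotationSystem V E) (ι : E' × Bool → E × Bool)
    (hι : Function.Injective ι) (β : E' × Bool → V')
    (hβ : ∀ a b, β a = β b ↔ G.base (ι a) = G.base (ι b)) : RotationSystem V' E' where
  base := β
  rot := (Equiv.ofInjective ι hι).symm.permCongr (firstReturn G.rot fun a => a ∈ Set.range ι)
  rot_sameCycle := by
    intro a b
    set ε := (Equiv.ofInjective ι hι).symm with hε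
    have h1 : (ε.permCongr (firstReturn G.rot fun a => a ∈ Set.range ι)).SameCycle a b ↔
        (firstReturn G.rot fun a => a ∈ Set.range ι).SameCycle (ε.symm a) (ε.symm b) := by
      have hpow : ∀ n : ℤ, (ε.permCongr (firstReturn G.rot fun a => a ∈ Set.range ι)) ^ n
          = ε.permCongr ((firstReturn G.rot fun a => a ∈ Set.range ι) ^ n) := fun n =>
        (map_zpow ε.permCongrHom _ n).symm
      simp only [Equiv.Perm.SameCycle, hpow, Equiv.permCongr_apply]
      exact exists_congr fun n => by rw [Equiv.eq_symm_apply]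
    rw [h1, firstReturn_sameCycle, G.rot_sameCycle, hβ]
    rfl

variable {ι : E' × Bool → E × Bool} {hι : Function.Injective ι} {β : E' × Bool → V'}
  {hβ : ∀ a b, β a = β b ↔ G.base (ι a) = G.base (ι b)}

theorem induced_rot (a : E' × Bool) : ι ((G.induced ι hι β hβ).rot a) =
    (firstReturn G.rot (fun a => a ∈ Set.range ι) ⟨ι a, a, rfl⟩).1 :=
  Equiv.apply_ofInjective_symm hι
    (firstReturn G.rot (fun a => a ∈ Set.range ι) ⟨ι a, a, rfl⟩)

theorem induced_rot_potential {q y : E × Bool → ZMod 2} (hq : G.IsPotential y q) {a : E' × Bool}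
    (h0 : ∀ d, G.base d = G.base (ι a) → d ∉ Set.range ι → y d = 0) :
    q (ι ((G.induced ι hι β hβ).rot a)) = q (ι a) + y (ι a) := by
  rw [induced_rot (ι := ι)]
  exact firstReturn_additive G.rot (fun a => a ∈ Set.range ι) q y
    (fun d => G.base d = G.base (ι a)) (fun x hx => (G.base_rot x).trans hx) (fun x _ => (hq x).2)
    h0 ⟨ι a, a, rfl⟩ rfl

/-- The rotation if each dart `ι a` comes from one or two consecutive darts `f a` and `g a`. -/
theorem induced_rot_of (f g : E' × Bool → E × Bool) (hfg : ∀ a, ι a = f a ∨ ι a = g a)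
    (hrot : ∀ a, f a ≠ g a → G.rot (f a) = g a) (hf : Function.Injective f)
    (hg : Function.Injective g) (hgf : ∀ a b, g a = f b → a = b)
    (hcov : ∀ a d, G.base d = G.base (ι a) → ∃ b, d = f b ∨ d = g b) (a : E' × Bool) :
    G.rot (g a) = f ((G.induced ι hι β hβ).rot a) := by
  have hbase : G.base (g a) = G.base (ι a) := by
    by_cases h : f a = g a
    · rcases hfg a with h' | h' <;> rw [h'] <;> simp [h]
    · rcases hfg a with h' | h'
      · rw [h', ← hrot a h, base_rot]
      · rw [h']
  obtain ⟨b, hb⟩ : ∃ b, G.rot (g a) = f b := by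
    obtain ⟨b, hb | hb⟩ := hcov a (G.rot (g a)) ((G.base_rot _).trans hbase)
    · exact ⟨b, hb⟩
    · by_cases h : f b = g b
      · exact ⟨b, hb.trans h.symm⟩
      · rw [← hrot b h] at hb
        have h1 := G.rot.injective hb
        have h2 := hgf _ _ h1
        subst h2
        exact absurd h1.symm h
  rw [hb]
  congr 1
  apply hι
  rw [induced_rot (ι := ι)]
  have hga : ι a ≠ g a → g a ∉ Set.range ι := by
    rintro h ⟨x, hx⟩
    rcases hfg x with h' | h'
    · have := hgf a x (hx.symm.trans h')
      subst this
      exact h hx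
    · have := hg (h'.symm.trans hx)
      subst this
      exact h h'
  have hfb : ι b ≠ f b → f b ∉ Set.range ι := by
    rintro h ⟨x, hx⟩
    rcases hfg x with h' | h'
    · have := hf (h'.symm.trans hx)
      subst this
      exact h hx
    · have := hgf x b (h'.symm.trans hx)
      subst this
      exact h hx
  -- Between ι a and ι b the rotation passes at most g a and f b. The number k of darts passed is 0,
  -- 1 or 2 according to whether these are themselves chosen by ι.
  have key : ∀ k, (G.rot ^ (k + 1)) (ι a) = ι b →
      (∀ j < k, (G.rot ^ (j + 1)) (ι a) ∉ Set.range ι) →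
      ι b = (firstReturn G.rot (fun a => a ∈ Set.range ι) ⟨ι a, a, rfl⟩).1 := by
    intro k h1 h2
    rw [firstReturn_eq_of_pow G.rot (fun a => a ∈ Set.range ι) (a := ⟨ι a, a, rfl⟩)
      (b := ⟨ι b, b, rfl⟩) k h1 h2]
  by_cases h1 : ι a = g a <;> by_cases h2 : ι b = f b
  · exact key 0 (by simpa [h1, h2] using hb) (by simp)
  · have h3 := (hfg b).resolve_left h2
    have h4 := hrot b fun h => h2 (h3.trans h.symm)
    refine key 1 (by simp [pow_succ, h1, h3, hb, h4]) fun j hj => ?_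
    obtain rfl : j = 0 := by omega
    simpa [h1, hb] using hfb h2
  · have h3 := (hfg a).resolve_right h1
    have h4 := hrot a fun h => h1 (h3.trans h)
    refine key 1 (by simp [pow_succ, h3, h4, hb, h2]) fun j hj => ?_
    obtain rfl : j = 0 := by omega
    simpa [h3, h4] using hga h1
  · have h3 := (hfg a).resolve_right h1
    have h4 := hrot a fun h => h1 (h3.trans h)
    have h5 := (hfg b).resolve_left h2
    have h6 := hrot b fun h => h2 (h5.trans h.symm)
    refine key 2 (by simp [pow_succ, h3, h4, hb, h5, h6]) fun j hj => ?_
    obtain rfl | rfl : j = 0 ∨ j = 1 := by omega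
    · simpa [h3, h4] using hga h1
    · simpa [pow_succ, h3, h4, hb] using hfb h2

end Induced

end RotationSystem

namespace RotationSystem

/-! ### Four-cycles -/

section FourCycle

variable {V : Type u} {E : Type v} {G : RotationSystem V E} {c : Fin 4 → E × Bool}

/-- The darts `c i` run along a cycle of length 4. -/
structure IsFourCycle (G : RotationSystem V E) (c : Fin 4 → E × Bool) : Prop where
  next : ∀ i, G.base (dartFlip E (c i)) = G.base (c (i + 1))
  edge_inj : ∀ i j, (c i).1 = (c j).1 → i = j
  base_inj : ∀ i j, G.base (c i) = G.base (c j) → i = j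

/-- The unit flow along a 4-cycle. -/
noncomputable def cycleFlow (c : Fin 4 → E × Bool) : E × Bool → ℤ := ∑ i, dartUnit (c i)

theorem cycleFlow_apply (d : E × Bool) : cycleFlow c d = ∑ i, dartUnit (c i) d := by
  rw [cycleFlow, Finset.sum_apply]

theorem cycleFlow_flip (d : E × Bool) : cycleFlow c (dartFlip E d) = -cycleFlow c d := by
  simp only [cycleFlow_apply, dartUnit_flip, Finset.sum_neg_distrib]

theorem cycleFlow_of_notMem {d : E × Bool} (h : ∀ i, d.1 ≠ (c i).1) : cycleFlow c d = 0 := by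
  rw [cycleFlow_apply]
  exact Finset.sum_eq_zero fun i _ => dartUnit_of_ne (h i)

theorem IsFourCycle.cycleFlow_self (hc : G.IsFourCycle c) (i : Fin 4) : cycleFlow c (c i) = 1 := by
  rw [cycleFlow_apply, Finset.sum_eq_single i, dartUnit_self]
  · exact fun j _ hj => dartUnit_of_ne fun h => hj (hc.edge_inj _ _ h).symm
  · exact fun h => absurd (Finset.mem_univ i) h

theorem dartForm_dartUnit [Fintype E] (d : E × Bool) {y : E × Bool → ℤ}
    (hy : ∀ d, y (dartFlip E d) = -y d) : dartForm (dartUnit d) y = y d := by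
  have h1 := sum_dart_mul (dartUnit_flip d) hy
  have h2 : ∑ a, dartUnit d a * y a = y d + y d := by
    classical
    simp only [dartUnit, Pi.sub_apply, sub_mul, Finset.sum_sub_distrib, Pi.single_apply, ite_mul,
      one_mul, zero_mul, Finset.sum_ite_eq', Finset.mem_univ, if_true, hy]
    ring
  linarith

theorem dartForm_cycleFlow [Fintype E] {y : E × Bool → ℤ} (hy : ∀ d, y (dartFlip E d) = -y d) :
    dartForm (cycleFlow c) y = ∑ i, y (c i) := by
  have h : ∀ i, y (c i) = ∑ e, dartUnit (c i) (e, false) * y (e, false) := fun i =>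
    (dartForm_dartUnit (c i) hy).symm
  simp only [h, dartForm, cycleFlow, Finset.sum_apply, Finset.sum_mul]
  rw [Finset.sum_comm]

theorem IsFourCycle.cycleFlow_mem [Fintype E] (hc : G.IsFourCycle c) :
    cycleFlow c ∈ G.dartFlows ℤ := by
  classical
  refine ⟨cycleFlow_flip, fun v => ?_⟩
  have h : cycleFlow c = dartUnit (c 0) + dartUnit (c 1) + dartUnit (c 2) + dartUnit (c 3) := by
    rw [cycleFlow, Fin.sum_univ_four]
  have h0 : G.base (dartFlip E (c 0)) = G.base (c 1) := hc.next 0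
  have h1 : G.base (dartFlip E (c 1)) = G.base (c 2) := hc.next 1
  have h2 : G.base (dartFlip E (c 2)) = G.base (c 3) := hc.next 2
  have h3 : G.base (dartFlip E (c 3)) = G.base (c 0) := hc.next 3
  rw [h]
  simp only [netFlow_add, netFlow_dartUnit, h0, h1, h2, h3]
  ring

/-- A 4-cycle that has an even product with each flow, and such that the flow lattice modulo this
cycle is cubical. -/
structure IsCubicalCycle [Fintype E] (G : RotationSystem V E) (c : Fin 4 → E × Bool) : Prop extends
    G.IsFourCycle c where
  exists_half : ∃ s : G.dartFlows ℤ →+ ℤ, (∀ y, ∑ i, y.1 (c i) = 2 * s y) ∧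
    Cubical (G.dartFlows ℤ) fun x y => dartForm x.1 y.1 - s x * s y

theorem IsFourCycle.rotate (hc : G.IsFourCycle c) : G.IsFourCycle fun i => c (i + 1) where
  next _ := hc.next _
  edge_inj _ _ h := add_right_cancel (hc.edge_inj _ _ h)
  base_inj _ _ h := add_right_cancel (hc.base_inj _ _ h)

theorem IsFourCycle.reverse (hc : G.IsFourCycle c) :
    G.IsFourCycle fun i => dartFlip E (c (Fin.rev i)) where
  next i := by
    rw [dartFlip_dartFlip, hc.next]
    congr 2
    revert i; decide
  edge_inj i j h := Fin.rev_injective (hc.edge_inj _ _ h)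
  base_inj i j h := by
    rw [hc.next, hc.next] at h
    exact Fin.rev_injective (add_right_cancel (hc.base_inj _ _ h))

theorem IsCubicalCycle.rotate [Fintype E] (hc : G.IsCubicalCycle c) :
    G.IsCubicalCycle fun i => c (i + 1) where
  toIsFourCycle := hc.toIsFourCycle.rotate
  exists_half := by
    obtain ⟨s, hs, h⟩ := hc.exists_half
    refine ⟨s, fun y => ?_, h⟩
    rw [← hs y]
    exact Equiv.sum_comp (Equiv.addRight (1 : Fin 4)) fun i => y.1 (c i)

theorem IsCubicalCycle.reverse [Fintype E] (hc : G.IsCubicalCycle c) :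
    G.IsCubicalCycle fun i => dartFlip E (c (Fin.rev i)) where
  toIsFourCycle := hc.toIsFourCycle.reverse
  exists_half := by
    obtain ⟨s, hs, h⟩ := hc.exists_half
    refine ⟨-s, fun y => ?_, ?_⟩
    · have := Equiv.sum_comp Fin.revPerm fun i => y.1 (c i)
      simp only [Fin.revPerm_apply] at this
      simp only [y.2.1, Finset.sum_neg_distrib, AddMonoidHom.neg_apply, this, hs]
      ring
    · simpa using h

theorem IsFourCycle.of_darts {d₀ d₁ d₂ d₃ : E × Bool}
    (e₀ : G.base (dartFlip E d₀) = G.base d₁) (e₁ : G.base (dartFlip E d₁) = G.base d₂)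
    (e₂ : G.base (dartFlip E d₂) = G.base d₃) (e₃ : G.base (dartFlip E d₃) = G.base d₀)
    (h : ∀ a ∈ [d₀, d₁, d₂, d₃], ∀ b ∈ [d₀, d₁, d₂, d₃], a.1 = b.1 → a = b)
    (h01 : G.base d₀ ≠ G.base d₁) (h02 : G.base d₀ ≠ G.base d₂) (h03 : G.base d₀ ≠ G.base d₃)
    (h12 : G.base d₁ ≠ G.base d₂) (h13 : G.base d₁ ≠ G.base d₃) (h23 : G.base d₂ ≠ G.base d₃) :
    G.IsFourCycle ![d₀, d₁, d₂, d₃] := by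
  have hb : ∀ i j, G.base (![d₀, d₁, d₂, d₃] i) = G.base (![d₀, d₁, d₂, d₃] j) → i = j := by
    intro i j hij
    fin_cases i <;> fin_cases j <;> first | rfl | exact absurd hij (by assumption) |
      exact absurd hij.symm (by assumption)
  have hm : ∀ i, ![d₀, d₁, d₂, d₃] i ∈ [d₀, d₁, d₂, d₃] := by
    intro i; fin_cases i <;> simp
  refine ⟨fun i => ?_, fun i j hij => hb i j (congrArg _ (h _ (hm i) _ (hm j) hij)), hb⟩
  fin_cases i
  exacts [e₀, e₁, e₂, e₃]

theorem exists_next [Fintype E] {w : E × Bool → ℤ} (hw : w ∈ G.dartFlows ℤ) {d : E × Bool}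
    (hd : 0 < w d) : ∃ d', G.base (dartFlip E d) = G.base d' ∧ 0 < w d' := by
  classical
  have h1 := hw.2 (G.base (dartFlip E d))
  obtain ⟨d', -, hd'⟩ := Finset.exists_pos_of_sum_zero_of_exists_nonzero _ h1
    ⟨dartFlip E d, Finset.mem_univ _, by rw [if_pos rfl, hw.1]; omega⟩
  split_ifs at hd' with h2
  · exact ⟨d', h2.symm, hd'⟩
  · exact absurd hd' (lt_irrefl _)

/-- A flow of norm 4 is a 4-cycle. -/
theorem CubicalFlow.exists_fourCycle [Fintype E] (h : G.CubicalFlow) {w : E × Bool → ℤ}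
    (hw : w ∈ G.dartFlows ℤ) (hn : dartForm w w = 4) :
    ∃ c, G.IsFourCycle c ∧ w = cycleFlow c := by
  classical
  obtain ⟨d₀, h₀⟩ : ∃ d, 0 < w d := by
    by_contra! hcon
    have : w = 0 := by
      ext d
      have h1 := hcon d
      have h2 := hcon (dartFlip E d)
      rw [hw.1] at h2
      exact le_antisymm h1 (by simpa using h2)
    rw [this] at hn
    simp [dartForm] at hn
  obtain ⟨d₁, e₀, h₁⟩ := exists_next hw h₀
  obtain ⟨d₂, e₁, h₂⟩ := exists_next hw h₁
  obtain ⟨d₃, e₂, h₃⟩ := exists_next hw h₂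
  obtain ⟨d₄, e₃, h₄⟩ := exists_next hw h₃
  -- The two halves of an edge have opposite values, so at most one of them is positive.
  have inj : ∀ {a b : E × Bool}, 0 < w a → 0 < w b → a.1 = b.1 → a = b := by
    intro a b ha hb hab
    rcases eq_or_eq_dartFlip hab with rfl | rfl
    · rfl
    · rw [hw.1] at ha; omega
  have succ : ∀ {a b : E × Bool}, G.base (dartFlip E a) = G.base b → G.base a ≠ G.base b :=
    fun hab => hab ▸ h.not_loop _
  have succ₂ : ∀ {a b x : E × Bool}, 0 < w a → 0 < w b → G.base (dartFlip E a) = G.base b →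
      G.base (dartFlip E b) = G.base x → G.base a ≠ G.base x := by
    intro a b x ha hb hab hbx hax
    refine h.not_parallel (d := a) (d' := dartFlip E b) (fun he => ?_) (hax.trans hbx.symm)
      (by rw [dartFlip_dartFlip, hab])
    exact succ hab (congrArg _ (inj ha hb he))
  have succ₃ : ∀ {a b x z : E × Bool}, 0 < w a → 0 < w b → 0 < w x →
      G.base (dartFlip E a) = G.base b → G.base (dartFlip E b) = G.base x →
      G.base (dartFlip E x) = G.base z → G.base a ≠ G.base z := by
    intro a b x z ha hb hx hab hbx hxz haz
    refine h.not_triangle (fun he => ?_) (fun he => ?_) (fun he => ?_) hab hbx (hxz.trans haz.symm)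
    · exact succ hab (congrArg _ (inj ha hb he))
    · exact succ₂ ha hb hab hbx (congrArg _ (inj ha hx he))
    · exact succ hbx (congrArg _ (inj hb hx he))
  have b01 := succ e₀
  have b12 := succ e₁
  have b23 := succ e₂
  have b02 := succ₂ h₀ h₁ e₀ e₁
  have b13 := succ₂ h₁ h₂ e₁ e₂
  have b03 := succ₃ h₀ h₁ h₂ e₀ e₁ e₂
  have hpos : ∀ a ∈ [d₀, d₁, d₂, d₃], 0 < w a := by simp [*]
  have ne : ∀ {a b : E × Bool}, 0 < w a → 0 < w b → G.base a ≠ G.base b → a.1 ≠ b.1 :=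
    fun ha hb hab he => hab (congrArg _ (inj ha hb he))
  have hcard : ({d₀.1, d₁.1, d₂.1, d₃.1} : Finset E).card = 4 := by
    rw [Finset.card_insert_of_notMem, Finset.card_insert_of_notMem, Finset.card_insert_of_notMem,
      Finset.card_singleton]
    · simpa using ne h₂ h₃ b23
    · simpa using ⟨ne h₁ h₂ b12, ne h₁ h₃ b13⟩
    · simpa using ⟨ne h₀ h₁ b01, ne h₀ h₂ b02, ne h₀ h₃ b03⟩
  have hsq : ∀ d, 0 < w d → 1 ≤ w (d.1, false) * w (d.1, false) := by
    intro d hd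
    obtain ⟨e, b⟩ := d
    cases b
    · nlinarith
    · have := hw.1 (e, false)
      simp only [dartFlip_mk, Bool.not_false] at this
      nlinarith
  -- Four distinct edges contribute at least 1 each to the norm 4. Hence each contributes exactly 1,
  -- and all other edges contribute 0.
  have hsum : ∑ e ∈ ({d₀.1, d₁.1, d₂.1, d₃.1} : Finset E), (w (e, false) * w (e, false) - 1) +
      ∑ e ∈ ({d₀.1, d₁.1, d₂.1, d₃.1} : Finset E)ᶜ, w (e, false) * w (e, false) = 0 := by
    rw [Finset.sum_sub_distrib, Finset.sum_const, hcard, sub_add_eq_add_sub,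
      Finset.sum_add_sum_compl]
    rw [dartForm] at hn
    rw [hn]; norm_num
  have hnn1 : ∀ e ∈ ({d₀.1, d₁.1, d₂.1, d₃.1} : Finset E),
      0 ≤ w (e, false) * w (e, false) - 1 := by
    intro e he
    simp only [Finset.mem_insert, Finset.mem_singleton] at he
    rcases he with rfl | rfl | rfl | rfl
    · linarith [hsq _ h₀]
    · linarith [hsq _ h₁]
    · linarith [hsq _ h₂]
    · linarith [hsq _ h₃]
  have hnn2 : ∀ e ∈ ({d₀.1, d₁.1, d₂.1, d₃.1} : Finset E)ᶜ, 0 ≤ w (e, false) * w (e, false) :=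
    fun e _ => mul_self_nonneg _
  obtain ⟨s1, s2⟩ := (add_eq_zero_iff_of_nonneg (Finset.sum_nonneg hnn1)
    (Finset.sum_nonneg hnn2)).1 hsum
  rw [Finset.sum_eq_zero_iff_of_nonneg hnn1] at s1
  rw [Finset.sum_eq_zero_iff_of_nonneg hnn2] at s2
  have hone : ∀ d, d.1 ∈ ({d₀.1, d₁.1, d₂.1, d₃.1} : Finset E) → 0 < w d → w d = 1 := by
    intro d hd hd0
    have := s1 _ hd
    obtain ⟨e, b⟩ := d
    cases b
    · nlinarith
    · have h' := hw.1 (e, false)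
      simp only [dartFlip_mk, Bool.not_false] at h'
      nlinarith
  have hzero : ∀ d, d.1 ∉ ({d₀.1, d₁.1, d₂.1, d₃.1} : Finset E) → w d = 0 := by
    intro d hd
    have := mul_self_eq_zero.1 (s2 _ (Finset.mem_compl.2 hd))
    obtain ⟨e, b⟩ := d
    cases b
    · exact this
    · have h' := hw.1 (e, false)
      simp only [dartFlip_mk, Bool.not_false] at h'
      rw [h', this, neg_zero]
  -- The walk must continue on one of the four edges already used, and closing up earlier would give
  -- a cycle that is too short.
  have hd₄ : d₄ = d₀ := by
    have hm : d₄.1 ∈ ({d₀.1, d₁.1, d₂.1, d₃.1} : Finset E) := by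
      by_contra hcon
      exact h₄.ne' (hzero _ hcon)
    simp only [Finset.mem_insert, Finset.mem_singleton] at hm
    rcases hm with hm | hm | hm | hm
    · exact inj h₄ h₀ hm
    · exact absurd (congrArg G.base (inj h₁ h₄ hm.symm)) (succ₃ h₁ h₂ h₃ e₁ e₂ e₃)
    · exact absurd (congrArg G.base (inj h₂ h₄ hm.symm)) (succ₂ h₂ h₃ e₂ e₃)
    · exact absurd (congrArg G.base (inj h₃ h₄ hm.symm)) (succ e₃)
  rw [hd₄] at e₃
  have hc : G.IsFourCycle ![d₀, d₁, d₂, d₃] := IsFourCycle.of_darts e₀ e₁ e₂ e₃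
    (fun a ha b hb => inj (hpos a ha) (hpos b hb)) b01 b02 b03 b12 b13 b23
  refine ⟨_, hc, ?_⟩
  have hcd : ∀ i, w (![d₀, d₁, d₂, d₃] i) = 1 := by
    intro i
    fin_cases i
    · exact hone _ (by simp) h₀
    · exact hone _ (by simp) h₁
    · exact hone _ (by simp) h₂
    · exact hone _ (by simp) h₃
  ext d
  by_cases hd : ∃ i, d.1 = (![d₀, d₁, d₂, d₃] i).1
  · obtain ⟨i, hi⟩ := hd
    rcases eq_or_eq_dartFlip hi with rfl | rfl
    · rw [hc.cycleFlow_self, hcd]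
    · rw [hw.1, cycleFlow_flip, hc.cycleFlow_self, hcd]
  · push Not at hd
    rw [cycleFlow_of_notMem hd]
    refine hzero d ?_
    have g0 := hd 0
    have g1 := hd 1
    have g2 := hd 2
    have g3 := hd 3
    simp only [Finset.mem_insert, Finset.mem_singleton, not_or]
    exact ⟨g0, g1, g2, g3⟩

theorem CubicalFlow.exists_cubicalCycle [Fintype E] (h : G.CubicalFlow)
    (hne : ∃ y ∈ G.dartFlows ℤ, y ≠ 0) : ∃ c, G.IsCubicalCycle c := by
  obtain ⟨w, s, hw, hs, hc⟩ := Cubical.exists_norm_four h (by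
    obtain ⟨y, hy, hy0⟩ := hne
    exact ⟨⟨y, hy⟩, fun h0 => hy0 (h.eq_zero hy (h0.le.trans (by norm_num)))⟩)
  obtain ⟨c, hc', hwc⟩ := h.exists_fourCycle w.2 hw
  refine ⟨c, hc', s, fun y => ?_, hc⟩
  rw [← dartForm_cycleFlow y.2.1, ← hwc, hs]

end FourCycle

end RotationSystem

namespace RotationSystem

open CompEdge

/-! ### The two sides of a 4-cycle -/

section Sides

variable {V : Type u} {E : Type v} {G : RotationSystem V E} {c : Fin 4 → E × Bool}

/-- The edges of a cycle. -/
def cycleEdges (c : Fin 4 → E × Bool) : Set E := Set.range fun i => (c i).1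

/-- The vertices that are joined off the cycle to its first or third vertex. -/
def sideVerts (G : RotationSystem V E) (c : Fin 4 → E × Bool) : Set V :=
  {v | G.Reach (cycleEdges c)ᶜ ∅ (G.base (c 0)) v ∨ G.Reach (cycleEdges c)ᶜ ∅ (G.base (c 2)) v}

/-- The edges off the cycle at the vertices of one side, and one more edge. -/
abbrev SideEdge (G : RotationSystem V E) (c : Fin 4 → E × Bool) : Type v :=
  Option {e : E // e ∉ cycleEdges c ∧ G.base (e, false) ∈ G.sideVerts c}

/-- The darts of a side, if those of the additional edge are `x` and `y`. -/
def sideMap (G : RotationSystem V E) (c : Fin 4 → E × Bool) (x y : E × Bool) :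
    G.SideEdge c × Bool → E × Bool
  | (none, false) => x
  | (none, true) => y
  | (some e, b) => (e.1, b)

/-- The additional edge of a side, whose ends are the first and third vertex of the cycle, is drawn
along the first two edges of the cycle. -/
def sideDart (G : RotationSystem V E) (c : Fin 4 → E × Bool) : G.SideEdge c × Bool → E × Bool :=
  G.sideMap c (c 0) (dartFlip E (c 1))

/-- Two choices for the darts of the additional edge are compared, because `induced_rot_of` needs
the injectivity of each of two such maps as well as their disjointness. -/
theorem sideMap_eq_imp {x y x' y' : E × Bool} (hx : x.1 ∈ cycleEdges c) (hy : y.1 ∈ cycleEdges c)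
    (hx' : x'.1 ∈ cycleEdges c) (hy' : y'.1 ∈ cycleEdges c) (h₁ : x ≠ y') (h₂ : y ≠ x')
    {a b : G.SideEdge c × Bool} (h : G.sideMap c x y a = G.sideMap c x' y' b) : a = b := by
  have hne : ∀ (e : {e : E // e ∉ cycleEdges c ∧ G.base (e, false) ∈ G.sideVerts c}) (b : Bool)
      (d : E × Bool), d.1 ∈ cycleEdges c → (e.1, b) ≠ d := fun e b d hd h =>
    e.2.1 (by rwa [show e.1 = d.1 from congrArg Prod.fst h])
  obtain ⟨_ | e, _ | _⟩ := a <;> obtain ⟨_ | e', _ | _⟩ := b <;> simp only [sideMap] at h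
  · rfl
  · exact absurd h h₁
  · exact absurd h.symm (hne e' _ _ hx)
  · exact absurd h.symm (hne e' _ _ hx)
  · exact absurd h h₂
  · rfl
  · exact absurd h.symm (hne e' _ _ hy)
  · exact absurd h.symm (hne e' _ _ hy)
  · exact absurd h (hne e _ _ hx')
  · exact absurd h (hne e _ _ hy')
  · rw [Subtype.ext (congrArg Prod.fst h)]
  · simp at h
  · exact absurd h (hne e _ _ hx')
  · exact absurd h (hne e _ _ hy')
  · simp at h
  · rw [Subtype.ext (congrArg Prod.fst h)]

theorem mem_cycleEdges (i : Fin 4) : (c i).1 ∈ cycleEdges c := ⟨i, rfl⟩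

theorem exists_of_mem_cycleEdges {d : E × Bool} (h : d.1 ∈ cycleEdges c) :
    ∃ i, d = c i ∨ d = dartFlip E (c i) := by
  obtain ⟨i, hi⟩ := h
  exact ⟨i, eq_or_eq_dartFlip hi.symm⟩

theorem cycleEdges_rotate : cycleEdges (fun i => c (i + 1)) = cycleEdges c :=
  (Equiv.addRight (1 : Fin 4)).surjective.range_comp fun i => (c i).1

theorem cycleEdges_reverse : cycleEdges (fun i => dartFlip E (c (Fin.rev i))) = cycleEdges c :=
  Fin.revPerm.surjective.range_comp fun i => (c i).1

theorem base_mem_sideVerts_iff {d : E × Bool} (h : d.1 ∉ cycleEdges c) :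
    G.base (dartFlip E d) ∈ G.sideVerts c ↔ G.base d ∈ G.sideVerts c := by
  have key : ∀ d : E × Bool, d.1 ∉ cycleEdges c → G.base d ∈ G.sideVerts c →
      G.base (dartFlip E d) ∈ G.sideVerts c := fun d hd h' =>
    h'.imp (fun hr => hr.trans (Reach.of_dart d hd (Set.notMem_empty _) (Set.notMem_empty _)))
      fun hr => hr.trans (Reach.of_dart d hd (Set.notMem_empty _) (Set.notMem_empty _))
  refine ⟨fun h' => ?_, key d h⟩
  simpa using key (dartFlip E d) h h'

theorem base_zero_mem : G.base (c 0) ∈ G.sideVerts c := Or.inl Relation.ReflTransGen.refl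

theorem base_two_mem : G.base (c 2) ∈ G.sideVerts c := Or.inr Relation.ReflTransGen.refl

namespace IsFourCycle

variable (hc : G.IsFourCycle c)

include hc

theorem sideDart_mem : ∀ a, G.base (G.sideDart c a) ∈ G.sideVerts c
  | (none, false) => base_zero_mem
  | (none, true) => by
    have : G.base (dartFlip E (c 1)) = G.base (c 2) := hc.next 1
    rw [sideDart, sideMap, this]
    exact base_two_mem
  | (some e, false) => e.2.2
  | (some e, true) => (base_mem_sideVerts_iff e.2.1).2 e.2.2

theorem dart_ne_flip (i j : Fin 4) : c i ≠ dartFlip E (c j) := by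
  intro h
  obtain rfl := hc.edge_inj i j (by rw [h, dartFlip_fst])
  exact dartFlip_ne _ h.symm

theorem sideDart_injective : Function.Injective (G.sideDart c) := fun _ _ h =>
  sideMap_eq_imp (y := dartFlip E (c 1)) (y' := dartFlip E (c 1)) (mem_cycleEdges 0)
    (mem_cycleEdges 1) (mem_cycleEdges 0) (mem_cycleEdges 1) (hc.dart_ne_flip 0 1) (hc.dart_ne_flip 0 1).symm h

end IsFourCycle

/-- One side of a 4-cycle, with an edge drawn along the first two edges of the cycle. -/
noncomputable def side [Finite E] (hc : G.IsFourCycle c) :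
    RotationSystem (G.sideVerts c) (G.SideEdge c) :=
  G.induced (G.sideDart c) hc.sideDart_injective (fun a => ⟨_, hc.sideDart_mem a⟩)
    fun _ _ => Subtype.ext_iff

variable [Fintype E]

/-- A walk off the cycle between two consecutive vertices, closed by the cycle edge between them, is
a flow whose product with the cycle is ±1, which is odd. -/
theorem IsCubicalCycle.not_reach (hc : G.IsCubicalCycle c) (i : Fin 4) :
    ¬ G.Reach (cycleEdges c)ᶜ ∅ (G.base (c i)) (G.base (c (i + 1))) := by
  classical
  intro hr
  obtain ⟨y, h1, h2, h3⟩ := hr.exists_chain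
  have hf : y + dartUnit (dartFlip E (c i)) ∈ G.dartFlows ℤ := by
    refine ⟨fun d => by simp only [Pi.add_apply, h1, dartUnit_flip]; ring, fun v => ?_⟩
    rw [netFlow_add, h3, netFlow_dartUnit, dartFlip_dartFlip, hc.next]
    ring
  obtain ⟨s, hs, -⟩ := hc.exists_half
  have := hs ⟨_, hf⟩
  rw [Finset.sum_eq_single i] at this
  · simp only [Pi.add_apply] at this
    have hd := dartUnit_flip (dartFlip E (c i)) (dartFlip E (c i))
    rw [dartFlip_dartFlip, dartUnit_self] at hd
    rw [h2 _ (fun h => h (mem_cycleEdges i)), hd] at this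
    omega
  · intro j _ hj
    simp only [Pi.add_apply]
    rw [h2 _ (fun h => h (mem_cycleEdges j)), dartUnit_of_ne, add_zero]
    exact fun h => hj (hc.edge_inj _ _ h)
  · exact fun h => absurd (Finset.mem_univ i) h

/-- A common vertex of the two sides would join a vertex of {v₁, v₃} to one of {v₂, v₄} off the
cycle, and these are always consecutive on the cycle. -/
theorem IsCubicalCycle.notMem_rotate (hc : G.IsCubicalCycle c) {v : V} (hv : v ∈ G.sideVerts c) :
    v ∉ G.sideVerts fun i => c (i + 1) := by
  intro hv'
  rw [sideVerts, cycleEdges_rotate] at hv'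
  have n0 : ¬ G.Reach (cycleEdges c)ᶜ ∅ (G.base (c 0)) (G.base (c 1)) := hc.not_reach 0
  have n1 : ¬ G.Reach (cycleEdges c)ᶜ ∅ (G.base (c 1)) (G.base (c 2)) := hc.not_reach 1
  have n2 : ¬ G.Reach (cycleEdges c)ᶜ ∅ (G.base (c 2)) (G.base (c 3)) := hc.not_reach 2
  have n3 : ¬ G.Reach (cycleEdges c)ᶜ ∅ (G.base (c 3)) (G.base (c 0)) := hc.not_reach 3
  rcases hv with h | h <;> rcases hv' with h' | h'
  · exact n0 (h.trans h'.symm)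
  · exact n3 (h'.trans h.symm)
  · exact n1 (h'.trans h.symm)
  · exact n2 (h.trans h'.symm)

omit [Fintype E] in
theorem IsFourCycle.base_mem (c : Fin 4 → E × Bool) (i : Fin 4) :
    G.base (c i) ∈ G.sideVerts c ∨ G.base (c i) ∈ G.sideVerts fun i => c (i + 1) := by
  fin_cases i
  · exact Or.inl base_zero_mem
  · exact Or.inr (base_zero_mem (c := fun i => c (i + 1)))
  · exact Or.inl base_two_mem
  · exact Or.inr (base_two_mem (c := fun i => c (i + 1)))

omit [Fintype E] in
theorem IsFourCycle.mem_or_mem (hc : G.IsFourCycle c) (hconn : G.ConnOff ∅) (v : V) :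
    v ∈ G.sideVerts c ∨ v ∈ G.sideVerts fun i => c (i + 1) := by
  have h := hconn (G.base (c 0)) v (Set.notMem_empty _) (Set.notMem_empty _)
  induction h with
  | refl => exact base_mem c 0
  | tail _ hs ih =>
    obtain ⟨d, rfl, rfl, -⟩ := hs
    by_cases hd : d.1 ∈ cycleEdges c
    · obtain ⟨i, rfl | rfl⟩ := exists_of_mem_cycleEdges hd
      · rw [hc.next]
        exact base_mem c _
      · rw [dartFlip_dartFlip]
        exact base_mem c _
    · refine ih.imp (base_mem_sideVerts_iff hd).2 (base_mem_sideVerts_iff ?_).2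
      rwa [cycleEdges_rotate]

/-- The vertices of the graph are those of the two sides. -/
noncomputable def IsCubicalCycle.vertexEquiv (hc : G.IsCubicalCycle c) (hconn : G.ConnOff ∅) :
    G.sideVerts c ⊕ (G.sideVerts fun i => c (i + 1)) ≃ V :=
  Equiv.ofBijective (Sum.elim Subtype.val Subtype.val) <| by
    constructor
    · rintro (⟨a, ha⟩ | ⟨a, ha⟩) (⟨b, hb⟩ | ⟨b, hb⟩) (rfl : a = b)
      · rfl
      · exact absurd hb (hc.notMem_rotate ha)
      · exact absurd ha (hc.notMem_rotate hb)
      · rfl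
    · intro v
      rcases hc.mem_or_mem hconn v with h | h
      · exact ⟨Sum.inl ⟨v, h⟩, rfl⟩
      · exact ⟨Sum.inr ⟨v, h⟩, rfl⟩

/-- The additional edge of a side of a 4-cycle, directed from the first to the third vertex. -/
def sideRoot (G : RotationSystem V E) (c : Fin 4 → E × Bool) : G.SideEdge c × Bool := (none, false)

/-- The darts of the graph, in terms of the two sides of a 4-cycle. -/
def joinDart (G : RotationSystem V E) (c : Fin 4 → E × Bool) :
    CompEdge (G.sideRoot c).1 (G.sideRoot fun i => c (i + 1)).1 × Bool → E × Bool
  | (Sum.inl (Sum.inl e), b) => G.sideDart c (e.1, b)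
  | (Sum.inl (Sum.inr e), b) => G.sideDart (fun i => c (i + 1)) (e.1, b)
  | (Sum.inr i, false) => c i
  | (Sum.inr i, true) => dartFlip E (c i)

omit [Fintype E] in
theorem joinDart_flip (a) : G.joinDart c (dartFlip _ a) = dartFlip E (G.joinDart c a) := by
  obtain ⟨(⟨_ | e, he⟩ | ⟨_ | e, he⟩) | i, _ | _⟩ := a
  case inl.inl.none.false | inl.inl.none.true | inl.inr.none.false | inl.inr.none.true =>
    exact absurd rfl he
  case inr.true => exact (dartFlip_dartFlip _).symm
  all_goals rfl

theorem IsCubicalCycle.joinDart_injective (hc : G.IsCubicalCycle c) :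
    Function.Injective (G.joinDart c) := by
  have h1 : ∀ (e : {e : E // e ∉ cycleEdges c ∧ G.base (e, false) ∈ G.sideVerts c})
      (e' : {e : E // e ∉ cycleEdges (fun i => c (i + 1)) ∧
        G.base (e, false) ∈ G.sideVerts fun i => c (i + 1)}), e.1 ≠ e'.1 := fun e e' h =>
    hc.notMem_rotate e.2.2 (h ▸ e'.2.2)
  have h2 : ∀ (e : {e : E // e ∉ cycleEdges c ∧ G.base (e, false) ∈ G.sideVerts c}) (i : Fin 4),
      e.1 ≠ (c i).1 := fun e i h => e.2.1 (h ▸ mem_cycleEdges i)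
  have h3 : ∀ (e : {e : E // e ∉ cycleEdges (fun i => c (i + 1)) ∧
        G.base (e, false) ∈ G.sideVerts fun i => c (i + 1)}) (i : Fin 4),
      e.1 ≠ (c i).1 := fun e i h =>
    e.2.1 ((Set.ext_iff.1 cycleEdges_rotate _).2 ⟨i, h.symm⟩)
  have h4 : ∀ i b, (G.joinDart c (Sum.inr i, b)).1 = (c i).1 := by
    rintro i (_ | _) <;> rfl
  rintro ⟨(⟨_ | e, he⟩ | ⟨_ | e, he⟩) | i, b⟩ ⟨(⟨_ | e', he'⟩ | ⟨_ | e', he'⟩) | j, b'⟩ h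
  all_goals first | exact absurd rfl he | exact absurd rfl he' | skip
  · have h5 : (e.1, b) = (e'.1, b') := h
    rw [Prod.mk.injEq] at h5
    obtain rfl := h5.2
    obtain rfl := Subtype.ext h5.1
    rfl
  · exact absurd (congrArg Prod.fst h) (h1 e e')
  · exact absurd ((congrArg Prod.fst h).trans (h4 j b')) (h2 e j)
  · exact absurd (congrArg Prod.fst h).symm (h1 e' e)
  · have h5 : (e.1, b) = (e'.1, b') := h
    rw [Prod.mk.injEq] at h5
    obtain rfl := h5.2
    obtain rfl := Subtype.ext h5.1
    rfl
  · exact absurd ((congrArg Prod.fst h).trans (h4 j b')) (h3 e j)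
  · exact absurd ((congrArg Prod.fst h).symm.trans (h4 i b)) (h2 e' i)
  · exact absurd ((congrArg Prod.fst h).symm.trans (h4 i b)) (h3 e' i)
  · have h5 := (h4 i b).symm.trans ((congrArg Prod.fst h).trans (h4 j b'))
    obtain rfl := hc.edge_inj _ _ h5
    cases b <;> cases b'
    · rfl
    · exact absurd h.symm (dartFlip_ne _)
    · exact absurd h (dartFlip_ne _)
    · rfl

omit [Fintype E] in
theorem IsFourCycle.joinDart_surjective (hc : G.IsFourCycle c) (hconn : G.ConnOff ∅) :
    Function.Surjective (G.joinDart c) := by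
  rintro ⟨e, b⟩
  by_cases he : e ∈ cycleEdges c
  · obtain ⟨i, hi | hi⟩ := exists_of_mem_cycleEdges (d := (e, b)) he
    · exact ⟨(Sum.inr i, false), hi.symm⟩
    · exact ⟨(Sum.inr i, true), hi.symm⟩
  · rcases hc.mem_or_mem hconn (G.base (e, false)) with h | h
    · exact ⟨(Sum.inl (Sum.inl ⟨some ⟨e, he, h⟩, nofun⟩), b), rfl⟩
    · exact ⟨(Sum.inl (Sum.inr ⟨some ⟨e, by rwa [cycleEdges_rotate], h⟩, nofun⟩), b), rfl⟩

/-- The darts of the graph are those of the two sides and those of the 4-cycle. -/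
noncomputable def IsCubicalCycle.dartEquiv (hc : G.IsCubicalCycle c) (hconn : G.ConnOff ∅) :
    CompEdge (G.sideRoot c).1 (G.sideRoot fun i => c (i + 1)).1 × Bool ≃ E × Bool :=
  Equiv.ofBijective (G.joinDart c) ⟨hc.joinDart_injective, hc.joinDart_surjective hconn⟩

omit [Fintype E] in
theorem joinDart_repl₁_none_true (x y) :
    repl₁ (G.sideRoot c) (f₂ := (G.sideRoot fun i => c (i + 1)).1) x y (none, true) = y :=
  repl₁_flip x y

omit [Fintype E] in
theorem joinDart_repl₂_none_true (x y) :
    repl₂ (f₁ := (G.sideRoot c).1) (G.sideRoot fun i => c (i + 1)) x y (none, true) = y :=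
  repl₂_flip x y

theorem IsCubicalCycle.isJoin (hc : G.IsCubicalCycle c) (hconn : G.ConnOff ∅) :
    IsJoin G (side hc.toIsFourCycle) (side hc.toIsFourCycle.rotate) (G.sideRoot c)
      (G.sideRoot fun i => c (i + 1)) (hc.vertexEquiv hconn) (hc.dartEquiv hconn) where
  flip := joinDart_flip
  base₁ := by
    rintro ⟨_ | e, _ | _⟩
    · erw [repl₁_self, repl₁_self]
      exact ⟨hc.next 3, rfl⟩
    · rw [joinDart_repl₁_none_true, joinDart_repl₁_none_true]
      exact ⟨rfl, (hc.next 1).symm⟩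
    all_goals
      erw [repl₁_of_ne _ _ (Option.some_ne_none e), repl₁_of_ne _ _ (Option.some_ne_none e)]
      exact ⟨rfl, rfl⟩
  base₂ := by
    rintro ⟨_ | e, _ | _⟩
    · erw [repl₂_self, repl₂_self]
      exact ⟨rfl, hc.next 0⟩
    · rw [joinDart_repl₂_none_true, joinDart_repl₂_none_true]
      exact ⟨(hc.next 2).symm, rfl⟩
    all_goals
      erw [repl₂_of_ne _ _ (Option.some_ne_none e), repl₂_of_ne _ _ (Option.some_ne_none e)]
      exact ⟨rfl, rfl⟩

theorem IsCubicalCycle.side_twoConn (hc : G.IsCubicalCycle c) (hG : G.TwoConn) :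
    (side hc.toIsFourCycle).TwoConn := by
  refine (hc.isJoin hG.conn).twoConn_inl hG fun h => ?_
  have h1 : G.base (c 0) = G.base (dartFlip E (c 1)) := congrArg Subtype.val h
  rw [hc.next] at h1
  exact absurd (hc.base_inj 0 2 h1) (by decide)

/-- In the coordinates of `joinFlow` the unit flow along the cycle is zero on both parts and has c =
1. -/
theorem IsCubicalCycle.side_cubicalFlow [Fintype (G.SideEdge c)] (hc : G.IsCubicalCycle c)
    (hconn : G.ConnOff ∅) : (side hc.toIsFourCycle).CubicalFlow := by
  have := Fintype.ofFinite (G.SideEdge fun i => c (i + 1))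
  obtain ⟨s, hs, hs'⟩ := hc.exists_half
  have h := hc.isJoin hconn
  refine (h.cubicalFlow_parts s (fun y => ?_) hs').1
  rw [← hs, ← dartForm_cycleFlow y.2.1]
  congr 1
  ext d
  obtain ⟨a, rfl⟩ := (hc.dartEquiv hconn).surjective d
  rw [h.joinFlow_apply]
  obtain ⟨(⟨_ | e, he⟩ | ⟨_ | e, he⟩) | i, b⟩ := a
  · exact absurd rfl he
  · exact (cycleFlow_of_notMem fun i hi => e.2.1 ⟨i, hi.symm⟩).symm
  · exact absurd rfl he
  · exact (cycleFlow_of_notMem fun i hi =>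
      e.2.1 ((Set.ext_iff.1 cycleEdges_rotate _).2 ⟨i, hi.symm⟩)).symm
  · cases b
    · refine Eq.trans ?_ (hc.cycleFlow_self i).symm
      fin_cases i <;> simp [joinDarts]
    · refine Eq.trans ?_ ((cycleFlow_flip (c := c) (c i)).trans
        (congrArg (- ·) (hc.cycleFlow_self i))).symm
      fin_cases i <;> simp [joinDarts]

end Sides

end RotationSystem

namespace RotationSystem

open CompEdge

/-! ### Potentials and 4-cycles -/

section SidePotentials

variable {V : Type u} {E : Type v} {G : RotationSystem V E} {c : Fin 4 → E × Bool}

theorem IsFourCycle.dart_at (hc : G.IsFourCycle c) (i : Fin 4) {d : E × Bool}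
    (h : G.base d = G.base (c (i + 1))) :
    d.1 ∉ cycleEdges c ∨ d = c (i + 1) ∨ d = dartFlip E (c i) := by
  by_cases hd : d.1 ∈ cycleEdges c
  · obtain ⟨j, rfl | rfl⟩ := exists_of_mem_cycleEdges hd
    · rw [hc.base_inj _ _ h]; exact Or.inr (Or.inl rfl)
    · rw [hc.next] at h
      rw [add_right_cancel (hc.base_inj _ _ h)]; exact Or.inr (Or.inr rfl)
  · exact Or.inl hd

theorem base_mem_of_false {d : E × Bool} (h : d.1 ∉ cycleEdges c) (hd : G.base d ∈ G.sideVerts c) :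
    G.base (d.1, false) ∈ G.sideVerts c := by
  obtain ⟨e, _ | _⟩ := d
  · exact hd
  · exact (base_mem_sideVerts_iff (d := (e, false)) h).1 hd

/-- A dart off the cycle, as a dart of a side. -/
def offDart {d : E × Bool} (h : d.1 ∉ cycleEdges c) (hd : G.base d ∈ G.sideVerts c) :
    G.SideEdge c × Bool := (some ⟨d.1, h, base_mem_of_false h hd⟩, d.2)

variable [Fintype E]

theorem IsCubicalCycle.eq_of_base_mem (hc : G.IsCubicalCycle c) {d : E × Bool}
    (hd : G.base d ∈ G.sideVerts c) :
    d ∈ Set.range (G.sideDart c) ∨ d = dartFlip E (c 3) ∨ d = c 2 := by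
  have n1 : G.base (c 1) ∉ G.sideVerts c := fun h =>
    hc.notMem_rotate h (base_zero_mem (c := fun i => c (i + 1)))
  have n3 : G.base (c 3) ∉ G.sideVerts c := fun h =>
    hc.notMem_rotate h (base_two_mem (c := fun i => c (i + 1)))
  by_cases h : d.1 ∈ cycleEdges c
  · obtain ⟨i, rfl | rfl⟩ := exists_of_mem_cycleEdges h
    · fin_cases i
      · exact Or.inl ⟨(none, false), rfl⟩
      · exact absurd hd n1
      · exact Or.inr (Or.inr rfl)
      · exact absurd hd n3
    · rw [hc.next] at hd
      fin_cases i
      · exact absurd hd n1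
      · exact Or.inl ⟨(none, true), rfl⟩
      · exact absurd hd n3
      · exact Or.inr (Or.inl rfl)
  · exact Or.inl ⟨offDart h hd, rfl⟩

/-- The pairs x, x' and y, y' are the consecutive cycle darts at the first and third vertex, in the
order of the drawing. Each pair contains the dart along which the additional edge is drawn, so
contracting the pairs gives the rotation of the side. The order is left open because it differs for
the two sides. -/
theorem IsCubicalCycle.side_rot_of (hc : G.IsCubicalCycle c) {x y x' y' : E × Bool}
    (h0 : c 0 = x ∨ c 0 = x') (h1 : dartFlip E (c 1) = y ∨ dartFlip E (c 1) = y')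
    (h2 : c 2 = y ∨ c 2 = y') (h3 : dartFlip E (c 3) = x ∨ dartFlip E (c 3) = x')
    (hx : x.1 ∈ cycleEdges c) (hy : y.1 ∈ cycleEdges c) (hx' : x'.1 ∈ cycleEdges c)
    (hy' : y'.1 ∈ cycleEdges c) (hxy : x ≠ y) (hxy' : x' ≠ y') (hxy₁ : x' ≠ y) (hxy₂ : y' ≠ x)
    (hrx : G.rot x = x') (hry : G.rot y = y') (a : G.SideEdge c × Bool) :
    G.rot (G.sideMap c x' y' a) = G.sideMap c x y ((side hc.toIsFourCycle).rot a) := by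
  have hfg : ∀ a, G.sideDart c a = G.sideMap c x y a ∨ G.sideDart c a = G.sideMap c x' y' a := by
    rintro ⟨_ | e, _ | _⟩
    · exact h0
    · exact h1
    · exact Or.inl rfl
    · exact Or.inl rfl
  refine induced_rot_of (G.sideMap c x y) (G.sideMap c x' y') hfg ?_
    (fun _ _ h => sideMap_eq_imp hx hy hx hy hxy hxy.symm h)
    (fun _ _ h => sideMap_eq_imp hx' hy' hx' hy' hxy' hxy'.symm h)
    (fun _ _ h => sideMap_eq_imp hx' hy' hx hy hxy₁ hxy₂ h) ?_ a
  · rintro ⟨_ | e, _ | _⟩ h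
    · exact hrx
    · exact hry
    · exact absurd rfl h
    · exact absurd rfl h
  · intro a d hd
    have hd' : G.base d ∈ G.sideVerts c := hd ▸ hc.sideDart_mem a
    rcases hc.eq_of_base_mem hd' with ⟨b, rfl⟩ | rfl | rfl
    · exact ⟨b, hfg b⟩
    · exact ⟨(none, false), h3⟩
    · exact ⟨(none, true), h2⟩

theorem dartFlows_cast {y : E × Bool → ℤ} (hy : y ∈ G.dartFlows ℤ) :
    (fun d => (y d : ZMod 2)) ∈ G.dartFlows (ZMod 2) := by
  classical
  refine ⟨fun d => by simp only [hy.1, Int.cast_neg], fun v => ?_⟩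
  have := congrArg (Int.cast : ℤ → ZMod 2) (hy.2 v)
  rw [netFlow] at this ⊢
  push_cast at this
  exact this

/-- A flow on one side of a 4-cycle extends along the first two edges of the cycle. -/
theorem IsCubicalCycle.exists_extension [Fintype (G.SideEdge c)] (hc : G.IsCubicalCycle c)
    (hconn : G.ConnOff ∅) {y : G.SideEdge c × Bool → ZMod 2}
    (hy : y ∈ (side hc.toIsFourCycle).dartFlows (ZMod 2)) :
    ∃ z ∈ G.dartFlows (ZMod 2), (∀ a, z (G.sideDart c a) = y a) ∧
      z (c 1) = y (G.sideRoot c) ∧ z (c 2) = 0 ∧ z (c 3) = 0 ∧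
      ∀ d, d.1 ∉ cycleEdges c → G.base d ∉ G.sideVerts c → z d = 0 := by
  have := Fintype.ofFinite (G.SideEdge fun i => c (i + 1))
  have h := hc.isJoin hconn
  -- The zero flow on the other side and the value of y at the additional edge as c make the last
  -- two cycle edges carry nothing.
  have hz := h.joinFlow_apply ((⟨y, hy⟩, 0), y (G.sideRoot c))
  have hzm := (h.joinFlow (ZMod 2) ((⟨y, hy⟩, 0), y (G.sideRoot c))).2
  set z := (h.joinFlow (ZMod 2) ((⟨y, hy⟩, 0), y (G.sideRoot c))).1
  have z0 : z (c 0) = y (G.sideRoot c) := hz (Sum.inr 0, false)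
  have z1 : z (c 1) = y (G.sideRoot c) := (hz (Sum.inr 1, false)).trans (add_zero _)
  have z2 : z (c 2) = 0 := (hz (Sum.inr 2, false)).trans (by simp [joinDarts])
  have z3 : z (c 3) = 0 := (hz (Sum.inr 3, false)).trans (by simp [joinDarts])
  refine ⟨z, hzm, ?_, z1, z2, z3, fun d hd hd' => ?_⟩
  · rintro ⟨_ | e, b⟩
    · cases b
      · exact z0
      · refine (hzm.1 (c 1)).trans ?_
        rw [z1]
        exact (hy.1 (G.sideRoot c)).symm
    · exact hz (Sum.inl (Sum.inl ⟨some e, nofun⟩), b)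
  · have hd1 : d.1 ∉ cycleEdges fun i => c (i + 1) := by rwa [cycleEdges_rotate]
    exact hz (Sum.inl (Sum.inr ⟨(offDart hd1 ((hc.mem_or_mem hconn _).resolve_left hd')).1, nofun⟩),
      d.2)

/-- The additional edge is drawn along a path of two cycle edges, so a potential for the extended
flow restricts to the darts of the side. -/
theorem IsCubicalCycle.side_hasPotentials [Fintype (G.SideEdge c)] (hc : G.IsCubicalCycle c)
    (hconn : G.ConnOff ∅) (hpot : G.HasPotentials) : (side hc.toIsFourCycle).HasPotentials := by
  intro y hy
  obtain ⟨z, hz, hzy, z1, z2, z3, hz0⟩ := hc.exists_extension hconn hy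
  obtain ⟨q, hq⟩ := hpot z hz
  have z3' : z (dartFlip E (c 3)) = 0 := by rw [hz.1, z3, neg_zero]
  have z2' : z (dartFlip E (c 2)) = 0 := by rw [hz.1, z2, neg_zero]
  have z0 : z (c 0) = y (G.sideRoot c) := hzy (G.sideRoot c)
  refine ⟨fun a => q (G.sideDart c a), fun a => ⟨?_, ?_⟩⟩
  · have hpair : q (c 1) = q (dartFlip E (c 0)) + z (dartFlip E (c 0)) := by
      refine hq.eq_add_of_pair (hc.dart_ne_flip 1 0).symm (hc.next 0) fun d hd hd0 hd1 => ?_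
      rcases hc.dart_at 0 (hd.trans (hc.next 0)) with h | h | h
      · refine hz0 d h fun hm => hc.notMem_rotate hm ?_
        rw [hd, hc.next]
        exact base_zero_mem (c := fun i => c (i + 1))
      · exact absurd h hd1
      · exact absurd h hd0
    have hroot : q (dartFlip E (c 1)) = q (c 0) + y (G.sideRoot c) := by
      rw [(hq (c 1)).1, hpair, (hq (c 0)).1, hz.1, z1, z0, ZMod.neg_eq_self_mod_two, add_assoc,
        CharTwo.add_self_eq_zero, add_zero]
    obtain ⟨_ | e, b⟩ := a
    · cases b
      · exact hroot
      · refine (eq_add_of_add_eq_zmod_two ?_ : q (c 0) = q (dartFlip E (c 1)) + y (none, true))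
        have : y (none, true) = y (G.sideRoot c) :=
          (hy.1 (G.sideRoot c)).trans (ZMod.neg_eq_self_mod_two _)
        rw [hroot, this, add_right_comm, CharTwo.add_self_eq_zero, zero_add]
    · rw [← hzy]
      exact (hq (e.1, b)).1
  · change q (G.sideDart c ((side hc.toIsFourCycle).rot a)) = q (G.sideDart c a) + y a
    rw [← hzy]
    refine induced_rot_potential hq fun d hd hd' => ?_
    have hm : G.base d ∈ G.sideVerts c := hd ▸ hc.sideDart_mem a
    rcases hc.eq_of_base_mem hm with h | rfl | rfl
    · exact absurd h hd'
    · exact z3'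
    · exact z2

/-- The corners at the first and third vertex of the cycle, if the ends of the additional edge do
not separate the side. -/
theorem IsCubicalCycle.potential_eq [Fintype (G.SideEdge c)] (hc : G.IsCubicalCycle c)
    (h2c : (side hc.toIsFourCycle).TwoConn) (hends : (side hc.toIsFourCycle).EndsConn)
    (hcub : (side hc.toIsFourCycle).CubicalFlow) {y p : E × Bool → ZMod 2}
    (hp : G.IsPotential y p) (hy : ∀ d, d.1 ∉ cycleEdges c → y d = 0) {d d' : E × Bool}
    (hd : d.1 ∉ cycleEdges c) (hdb : G.base d = G.base (c 0) ∨ G.base d = G.base (c 2))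
    (hd' : d'.1 ∉ cycleEdges c) (hdb' : G.base d' = G.base (c 0) ∨ G.base d' = G.base (c 2)) :
    p d = p d' := by
  have hend : ∀ a : G.SideEdge c × Bool, (side hc.toIsFourCycle).IsEnd (G.sideRoot c)
      ((side hc.toIsFourCycle).base a) ↔
      G.base (G.sideDart c a) = G.base (c 0) ∨ G.base (G.sideDart c a) = G.base (c 2) := by
    intro a
    have h1 : G.base (dartFlip E (c 1)) = G.base (c 2) := hc.next 1
    rw [← h1]
    exact or_congr Subtype.ext_iff Subtype.ext_iff
  have hmem : ∀ {d : E × Bool}, (G.base d = G.base (c 0) ∨ G.base d = G.base (c 2)) →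
      G.base d ∈ G.sideVerts c := by
    rintro d (h | h) <;> rw [h]
    · exact base_zero_mem
    · exact base_two_mem
  -- The side has neither loops nor edges parallel to the additional edge, so an edge off the cycle
  -- at v₁ or v₃ leads to a vertex that is no end of the additional edge.
  have hoff : ∀ {d : E × Bool} (hd : d.1 ∉ cycleEdges c)
      (hdb : G.base d = G.base (c 0) ∨ G.base d = G.base (c 2)),
      ¬ (side hc.toIsFourCycle).IsEnd (G.sideRoot c)
        ((side hc.toIsFourCycle).base (dartFlip _ (offDart hd (hmem hdb)))) := by
    intro d hd hdb hcon
    set a := offDart hd (hmem hdb) with ha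
    have hd0 : (side hc.toIsFourCycle).IsEnd (G.sideRoot c) ((side hc.toIsFourCycle).base a) :=
      (hend a).2 hdb
    have hne : a.1 ≠ (G.sideRoot c).1 := nofun
    rcases hd0 with k0 | k0 <;> rcases hcon with k1 | k1
    · exact h2c.not_loop a (k0.trans k1.symm)
    · exact hcub.not_parallel hne k0 k1
    · exact hcub.not_parallel (d := a) (d' := dartFlip _ (G.sideRoot c)) hne k0
        (by rw [dartFlip_dartFlip]; exact k1)
    · exact h2c.not_loop a (k0.trans k1.symm)
  -- At the other vertices of the side there are no cycle darts, hence no flow, and the potential is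
  -- constant around them.
  have hvert : ∀ {v : G.sideVerts c}, ¬ (side hc.toIsFourCycle).IsEnd (G.sideRoot c) v →
      ∀ {x x' : E × Bool}, G.base x = v.1 → G.base x' = v.1 → p x' = p x := by
    intro v hv x x' hx hx'
    refine apply_eq_of_base_eq p (fun d hd => ?_) hx hx'
    rw [(hp d).2, hy d, add_zero]
    intro hdc
    have hm : G.base d ∈ G.sideVerts c := hd ▸ v.2
    have h1 : G.base d ≠ G.base (c 0) := fun h => hv (Or.inl (Subtype.ext (hd.symm.trans h)))
    have h2 : G.base d ≠ G.base (c 2) := fun h =>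
      hv (Or.inr (Subtype.ext (hd.symm.trans (h.trans (hc.next 1).symm))))
    have n1 : G.base d ≠ G.base (c 1) := fun h =>
      hc.notMem_rotate hm (h ▸ base_zero_mem (c := fun i => c (i + 1)))
    have n3 : G.base d ≠ G.base (c 3) := fun h =>
      hc.notMem_rotate hm (h ▸ base_two_mem (c := fun i => c (i + 1)))
    have hall : ∀ i, G.base d ≠ G.base (c i) := by
      intro i; fin_cases i
      exacts [h1, n1, h2, n3]
    obtain ⟨i, rfl | rfl⟩ := exists_of_mem_cycleEdges hdc
    · exact hall i rfl
    · exact hall _ (hc.next i)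
  have hflip : ∀ {d : E × Bool}, d.1 ∉ cycleEdges c → p (dartFlip E d) = p d := fun hd => by
    rw [(hp _).1, hy _ hd, add_zero]
  -- The side without v₁ and v₃ is connected, and the potential does not change along a walk there.
  have hreach := hends (G.sideRoot c) _ _ (hoff hd hdb) (hoff hd' hdb')
  have key : ∀ b, (side hc.toIsFourCycle).Reach Set.univ
      {x | (side hc.toIsFourCycle).IsEnd (G.sideRoot c) x}
      ((side hc.toIsFourCycle).base (dartFlip _ (offDart hd (hmem hdb)))) b →
      ∀ x, G.base x = b.1 → p x = p (dartFlip E d) := by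
    intro b hb
    induction hb with
    | refl => exact fun x hx => hvert (hoff hd hdb) rfl hx
    | tail _ hs ih =>
      obtain ⟨a, rfl, rfl, -, h1, h2⟩ := hs
      intro x hx
      obtain ⟨_ | e, s⟩ := a
      · refine absurd ?_ h1
        cases s
        · exact Or.inl rfl
        · exact Or.inr rfl
      · rw [hvert (x := dartFlip E (e.1, s)) h2 rfl hx, hflip e.2.1]
        exact ih _ rfl
  rw [← hflip hd, ← hflip hd']
  exact (key _ hreach _ rfl).symm

/-- Two vertices of the cycle are joined off the cycle. -/
theorem IsCubicalCycle.reach_off (hc : G.IsCubicalCycle c)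
    (h2c : (side hc.toIsFourCycle).TwoConn) {d : E × Bool} (hd : d.1 ∉ cycleEdges c)
    (hdm : G.base d ∈ G.sideVerts c) :
    G.Reach (cycleEdges c)ᶜ ∅ (G.base (c 0)) (G.base (c 2)) := by
  have h := Reach.off_dart h2c.connOff h2c.not_loop (G.sideRoot c)
    (Or.inr ⟨(offDart hd hdm).1, nofun⟩)
  have key : ∀ b, (side hc.toIsFourCycle).Reach {(G.sideRoot c).1}ᶜ ∅
      ((side hc.toIsFourCycle).base (G.sideRoot c)) b →
      G.Reach (cycleEdges c)ᶜ ∅ (G.base (c 0)) b.1 := by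
    intro b hb
    induction hb with
    | refl => exact Relation.ReflTransGen.refl
    | tail _ hs ih =>
      obtain ⟨⟨_ | e, s⟩, rfl, rfl, h1, -⟩ := hs
      · exact absurd rfl h1
      · exact ih.trans (Reach.of_dart (e.1, s) e.2.1 (Set.notMem_empty _) (Set.notMem_empty _))
  rw [← show G.base (dartFlip E (c 1)) = G.base (c 2) from hc.next 1]
  exact key _ h

end SidePotentials

end RotationSystem

namespace RotationSystem

open CompEdge

/-! ### Recognizing compositions -/

section Recognition

variable {V : Type u} {E : Type v} {G : RotationSystem V E} {c : Fin 4 → E × Bool}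
  {p : E × Bool → ZMod 2}

theorem add_one_ne_self (a : ZMod 2) : a + 1 ≠ a := by
  revert a; decide

theorem add_one_add_one (a : ZMod 2) : a + 1 + 1 = a := by
  revert a; decide

theorem eq_or_eq_add_one (a b : ZMod 2) : b = a ∨ b = a + 1 := by
  revert a b; decide

/-- A potential of the unit flow along a cycle. -/
def IsCyclePotential (G : RotationSystem V E) (c : Fin 4 → E × Bool) (p : E × Bool → ZMod 2) :
    Prop :=
  G.IsPotential (fun d => (cycleFlow c d : ZMod 2)) p

theorem IsCyclePotential.flip_eq (hp : G.IsCyclePotential c p) (d : E × Bool) :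
    p (dartFlip E d) = p d + (cycleFlow c d : ZMod 2) := (hp d).1

theorem IsCyclePotential.rot_eq (hp : G.IsCyclePotential c p) (d : E × Bool) :
    p (G.rot d) = p d + (cycleFlow c d : ZMod 2) := (hp d).2

theorem cycleFlow_cast_of_notMem {d : E × Bool} (h : d.1 ∉ cycleEdges c) :
    (cycleFlow c d : ZMod 2) = 0 := by
  rw [cycleFlow_of_notMem fun i hi => h ⟨i, hi.symm⟩, Int.cast_zero]

theorem cycleFlow_reverse (d : E × Bool) :
    cycleFlow (fun i => dartFlip E (c (Fin.rev i))) d = -cycleFlow c d := by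
  have h : ∀ a b : E × Bool, dartUnit (dartFlip E a) b = -dartUnit a b := by
    intro a b
    simp [dartUnit]
  simp only [cycleFlow_apply, h, Finset.sum_neg_distrib]
  rw [← Equiv.sum_comp Fin.revPerm fun i => dartUnit (c i) d]
  rfl

theorem IsCyclePotential.reverse (hp : G.IsCyclePotential c p) :
    G.IsCyclePotential (fun i => dartFlip E (c (Fin.rev i))) p := by
  intro d
  have h : ((cycleFlow (fun i => dartFlip E (c (Fin.rev i))) d : ℤ) : ZMod 2) =
      (cycleFlow c d : ℤ) := by
    rw [cycleFlow_reverse, Int.cast_neg, ZMod.neg_eq_self_mod_two]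
  exact ⟨(hp d).1.trans (congrArg _ h.symm), (hp d).2.trans (congrArg _ h.symm)⟩

namespace IsFourCycle

variable (hc : G.IsFourCycle c)

include hc

theorem cast_cycleFlow_self (i : Fin 4) : (cycleFlow c (c i) : ZMod 2) = 1 := by
  rw [hc.cycleFlow_self, Int.cast_one]

theorem cast_cycleFlow_flip (i : Fin 4) : (cycleFlow c (dartFlip E (c i)) : ZMod 2) = 1 := by
  rw [cycleFlow_flip, hc.cycleFlow_self]
  rfl

variable [Finite E] (hp : G.IsCyclePotential c p)

include hp

/-- The potential is constant along each of the two sides of the cycle: it passes from c i to its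
other half with a jump of 1, and around the next vertex with another one. -/
theorem potential_succ (i : Fin 4) : p (c (i + 1)) = p (c i) := by
  have h := IsPotential.eq_add_of_pair hp (a := dartFlip E (c i)) (b := c (i + 1))
    (hc.dart_ne_flip _ _).symm (hc.next i) fun d hd h0 h1 => ?_
  · rw [h, hp.flip_eq (c i), hc.cast_cycleFlow_self, hc.cast_cycleFlow_flip, add_one_add_one]
  · rcases hc.dart_at i (hd.trans (hc.next i)) with h | h | h
    · exact cycleFlow_cast_of_notMem h
    · exact absurd h h1
    · exact absurd h h0

theorem potential_eq (i : Fin 4) : p (c i) = p (c 0) := by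
  have h0 : p (c 1) = p (c 0) := hc.potential_succ hp 0
  have h1 : p (c 2) = p (c 1) := hc.potential_succ hp 1
  have h2 : p (c 3) = p (c 2) := hc.potential_succ hp 2
  fin_cases i
  exacts [rfl, h0, h1.trans h0, h2.trans (h1.trans h0)]

theorem potential_flip (i : Fin 4) : p (dartFlip E (c i)) = p (c 0) + 1 := by
  rw [hp.flip_eq (c i), hc.cast_cycleFlow_self, hc.potential_eq hp]

/-- The corner after the incoming cycle dart has the value p (c 0). If all corners before off-cycle
darts at this vertex have the other value, the next dart must be the outgoing cycle dart. -/
theorem rot_flip (i : Fin 4) (h : ∀ d, d.1 ∉ cycleEdges c → G.base d = G.base (c (i + 1)) →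
    p d = p (c 0) + 1) : G.rot (dartFlip E (c i)) = c (i + 1) := by
  have hb : G.base (G.rot (dartFlip E (c i))) = G.base (c (i + 1)) := by
    rw [base_rot, hc.next]
  have hv : p (G.rot (dartFlip E (c i))) = p (c 0) := by
    rw [hp.rot_eq _, hc.cast_cycleFlow_flip, hc.potential_flip hp, add_one_add_one]
  rcases hc.dart_at i hb with h' | h' | h'
  · exact absurd ((h _ h' hb).symm.trans hv) (add_one_ne_self _)
  · exact h'
  · rw [h', hc.potential_flip hp] at hv
    exact absurd hv (add_one_ne_self _)

theorem rot_succ (i : Fin 4) (h : ∀ d, d.1 ∉ cycleEdges c → G.base d = G.base (c (i + 1)) →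
    p d = p (c 0)) : G.rot (c (i + 1)) = dartFlip E (c i) := by
  have hb : G.base (G.rot (c (i + 1))) = G.base (c (i + 1)) := G.base_rot _
  have hv : p (G.rot (c (i + 1))) = p (c 0) + 1 := by
    rw [hp.rot_eq _, hc.cast_cycleFlow_self, hc.potential_eq hp]
  rcases hc.dart_at i hb with h' | h' | h'
  · exact absurd (hv.symm.trans (h _ h' hb)) (add_one_ne_self _)
  · rw [h', hc.potential_eq hp] at hv
    exact absurd hv.symm (add_one_ne_self _)
  · exact h'

end IsFourCycle

variable [Fintype E]

/-- The two sides of a 4-cycle are drawn on different sides of it. -/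
theorem IsCubicalCycle.potential_rotate_eq (hc : G.IsCubicalCycle c) (hG : G.TwoConn)
    (hpot : G.HasPotentials) (hp : G.IsCyclePotential c p) {s : ZMod 2}
    (h₁ : ∀ d, d.1 ∉ cycleEdges c → G.base d = G.base (c 0) ∨ G.base d = G.base (c 2) →
      p d = p (c 0) + 1)
    (h₂ : ∀ d, d.1 ∉ cycleEdges c → G.base d = G.base (c 1) ∨ G.base d = G.base (c 3) → p d = s)
    (hn₁ : ∃ d : E × Bool, d.1 ∉ cycleEdges c ∧
      (G.base d = G.base (c 0) ∨ G.base d = G.base (c 2)))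
    (hn₂ : ∃ d : E × Bool, d.1 ∉ cycleEdges c ∧
      (G.base d = G.base (c 1) ∨ G.base d = G.base (c 3))) : s = p (c 0) := by
  have := Fintype.ofFinite (G.SideEdge c)
  -- z is a closed curve that follows the first two cycle edges and returns through the first side;
  -- it avoids the second side.
  obtain ⟨z, hz, -, z1, z2, z3, hz0, z0⟩ : ∃ z ∈ G.dartFlows (ZMod 2), True ∧ z (c 1) = 1 ∧
      z (c 2) = 0 ∧ z (c 3) = 0 ∧
      (∀ d, d.1 ∉ cycleEdges c → G.base d ∉ G.sideVerts c → z d = 0) ∧ z (c 0) = 1 := by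
    obtain ⟨d, hd, hd'⟩ := hn₁
    have hdm : G.base d ∈ G.sideVerts c := by
      rcases hd' with h | h <;> rw [h]
      · exact base_zero_mem
      · exact base_two_mem
    have h2c := hc.side_twoConn hG
    obtain ⟨y, hy, hy1⟩ := exists_flow_apply_eq_one (Reach.off_dart h2c.connOff h2c.not_loop
      (G.sideRoot c) (Or.inr ⟨(offDart hd hdm).1, nofun⟩))
    obtain ⟨z, hz, hzy, z1, z2, z3, hz0⟩ := hc.exists_extension hG.conn (dartFlows_cast hy)
    refine ⟨z, hz, trivial, z1.trans (by rw [hy1, Int.cast_one]), z2, z3, hz0,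
      (hzy (G.sideRoot c)).trans (by rw [hy1, Int.cast_one])⟩
  obtain ⟨q, hq⟩ := hpot z hz
  have zflip : ∀ d, z (dartFlip E d) = z d := fun d => by rw [hz.1, ZMod.neg_eq_self_mod_two]
  have hreach : G.Reach (cycleEdges c)ᶜ ∅ (G.base (c 1)) (G.base (c 3)) := by
    obtain ⟨d, hd, hd'⟩ := hn₂
    have h := hc.rotate.reach_off (hc.rotate.side_twoConn hG) (d := d)
      (by rwa [cycleEdges_rotate]) (by
        rcases hd' with h | h <;> rw [h]
        · exact base_zero_mem (c := fun i => c (i + 1))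
        · exact base_two_mem (c := fun i => c (i + 1)))
    rwa [cycleEdges_rotate] at h
  have hnot : ∀ {v}, G.Reach (cycleEdges c)ᶜ ∅ (G.base (c 1)) v → v ∉ G.sideVerts c := by
    intro v hv hv'
    refine hc.notMem_rotate hv' (Or.inl ?_)
    rw [cycleEdges_rotate]
    exact hv
  -- At v₂ the flows z and c agree, so their potentials differ there by a constant.
  have hsum : ∀ d, G.base d = G.base (c 1) → q d = p d + (q (c 1) + p (c 1)) := by
    intro d hd
    have h := apply_eq_of_base_eq (G := G) (fun d => q d + p d) (fun d hd => ?_) rfl hd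
    · rw [← h]
      generalize q d = a; generalize p d = b
      revert a b; decide
    · have hzd : z d = (cycleFlow c d : ZMod 2) := by
        rcases hc.dart_at 0 hd with h | h | h
        · rw [cycleFlow_cast_of_notMem h, hz0 d h (hd ▸ hnot Relation.ReflTransGen.refl)]
        · rw [h]
          exact z1.trans (hc.cast_cycleFlow_self 1).symm
        · rw [h, zflip, z0, hc.cast_cycleFlow_flip]
      change q (G.rot d) + p (G.rot d) = q d + p d
      rw [(hq d).2, hp.rot_eq d, hzd]
      generalize q d = a; generalize p d = b; generalize ((cycleFlow c d : ℤ) : ZMod 2) = e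
      revert a b e; decide
  set k := q (c 1) + p (c 1)
  -- The second side is connected off the cycle from v₂ to v₄ and z vanishes on it, so q carries the
  -- value s + k from the off-cycle darts at v₂ to all corners at v₄.
  have key : ∀ v, G.Reach (cycleEdges c)ᶜ ∅ (G.base (c 1)) v →
      v = G.base (c 1) ∨ ∀ d, G.base d = v → q d = s + k := by
    intro v hv
    induction hv with
    | refl => exact Or.inl rfl
    | tail hr hs ih =>
      obtain ⟨d, rfl, rfl, hd, -, -⟩ := hs
      by_cases hv : G.base (dartFlip E d) = G.base (c 1)
      · exact Or.inl hv
      refine Or.inr fun x hx => ?_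
      have hqd : q d = s + k := by
        rcases ih with h | h
        · rw [hsum d h, h₂ d hd (Or.inl h)]
        · exact h d rfl
      have hr' := hr.trans (Reach.of_dart d hd (Set.notMem_empty _) (Set.notMem_empty _))
      have hqf : q (dartFlip E d) = s + k := by
        rw [(hq d).1, hqd, hz0 d hd (hnot hr), add_zero]
      rw [← hqf]
      refine apply_eq_of_base_eq q (fun a ha => ?_) rfl hx
      rw [(hq a).2]
      have ham : G.base a ∉ G.sideVerts c := ha ▸ hnot hr'
      have hza : z a = 0 := by
        by_cases hac : a.1 ∈ cycleEdges c
        · obtain ⟨i, rfl | rfl⟩ := exists_of_mem_cycleEdges hac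
          · fin_cases i
            · exact absurd base_zero_mem ham
            · exact absurd ha.symm hv
            · exact z2
            · exact z3
          · rw [zflip]
            fin_cases i
            · exact absurd (ha.symm.trans (hc.next 0)) hv
            · exact absurd ((congrArg (· ∈ G.sideVerts c) (hc.next 1)).mpr base_two_mem) ham
            · exact z2
            · exact z3
        · exact hz0 a hac ham
      rw [hza, add_zero]
  have h3 : q (c 3) = s + k := by
    rcases key _ hreach with h | h
    · exact absurd (hc.base_inj 3 1 h) (by decide)
    · exact h _ rfl
  -- Going on from v₄ to v₁ along the last cycle edge, on which z vanishes, and then across e₀, the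
  -- value s + k of q is compared with its known value on the other side of e₀ at v₂.
  have hrot : G.rot (dartFlip E (c 3)) = c 0 :=
    hc.rot_flip hp 3 fun d hd hb => h₁ d hd (Or.inl hb)
  have h4 : q (c 0) = s + k := by
    rw [← hrot, (hq _).2, (hq _).1, zflip, z3, add_zero, add_zero, h3]
  have h5 : q (dartFlip E (c 0)) = s + k + 1 := by rw [(hq _).1, h4, z0]
  rw [hsum _ (hc.next 0), hc.potential_flip hp] at h5
  linear_combination -h5

end Recognition

end RotationSystem

namespace RotationSystem

open CompEdge

/-! ### 2-connected graphs with cubical flow lattices -/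

section Main

variable {V : Type u} {E : Type v} [Fintype E] {G : RotationSystem V E} {c : Fin 4 → E × Bool}
  {p : E × Bool → ZMod 2}

theorem IsCubicalCycle.dartEquiv_repl₁ (hc : G.IsCubicalCycle c) (hconn : G.ConnOff ∅) (x y)
    (a : G.SideEdge c × Bool) : hc.dartEquiv hconn (repl₁ (G.sideRoot c) x y a) =
      G.sideMap c (G.joinDart c x) (G.joinDart c y) a := by
  obtain ⟨_ | e, _ | _⟩ := a
  · erw [repl₁_self]; rfl
  · rw [joinDart_repl₁_none_true]; rfl
  all_goals
    erw [repl₁_of_ne _ _ (Option.some_ne_none e)]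
    rfl

theorem IsCubicalCycle.dartEquiv_repl₂ (hc : G.IsCubicalCycle c) (hconn : G.ConnOff ∅) (x y)
    (a : G.SideEdge (fun i => c (i + 1)) × Bool) :
    hc.dartEquiv hconn (repl₂ (G.sideRoot fun i => c (i + 1)) x y a) =
      G.sideMap (fun i => c (i + 1)) (G.joinDart c x) (G.joinDart c y) a := by
  obtain ⟨_ | e, _ | _⟩ := a
  · erw [repl₂_self]; rfl
  · rw [joinDart_repl₂_none_true]; rfl
  all_goals
    erw [repl₂_of_ne _ _ (Option.some_ne_none e)]
    rfl

/-- When the edges of the two parts leave the cycle on prescribed different sides, the two cycle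
darts at each vertex are consecutive, in the order that a composition demands. -/
theorem IsCubicalCycle.isCompositionAlong (hc : G.IsCubicalCycle c) (hconn : G.ConnOff ∅)
    (hp : G.IsCyclePotential c p)
    (h₁ : ∀ d, d.1 ∉ cycleEdges c → G.base d = G.base (c 0) ∨ G.base d = G.base (c 2) →
      p d = p (c 0) + 1)
    (h₂ : ∀ d, d.1 ∉ cycleEdges c → G.base d = G.base (c 1) ∨ G.base d = G.base (c 3) →
      p d = p (c 0)) :
    G.IsCompositionAlong (side hc.toIsFourCycle) (side hc.toIsFourCycle.rotate) (G.sideRoot c)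
      (G.sideRoot fun i => c (i + 1)) := by
  have h := hc.isJoin hconn
  have r3 : G.rot (dartFlip E (c 3)) = c 0 := hc.rot_flip hp 3 fun d hd hb => h₁ d hd (Or.inl hb)
  have r1 : G.rot (dartFlip E (c 1)) = c 2 := hc.rot_flip hp 1 fun d hd hb => h₁ d hd (Or.inr hb)
  have r0 : G.rot (c 1) = dartFlip E (c 0) := hc.rot_succ hp 0 fun d hd hb => h₂ d hd (Or.inl hb)
  have r2 : G.rot (c 3) = dartFlip E (c 2) := hc.rot_succ hp 2 fun d hd hb => h₂ d hd (Or.inr hb)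
  have ne : ∀ {i j : Fin 4}, i ≠ j → (c i).1 ≠ (c j).1 := fun hij h => hij (hc.edge_inj _ _ h)
  have hm : ∀ i, (c i).1 ∈ cycleEdges fun i => c (i + 1) := fun i => by
    rw [cycleEdges_rotate]; exact mem_cycleEdges i
  refine ⟨hc.vertexEquiv hconn, hc.dartEquiv hconn, h.flip,
    fun a => ⟨(h.base₁ a).1, (h.base₁ a).2, ?_⟩, fun a => ⟨(h.base₂ a).1, (h.base₂ a).2, ?_⟩,
    r3, r1, r0, r2⟩
  · rw [hc.dartEquiv_repl₁, hc.dartEquiv_repl₁]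
    exact hc.side_rot_of (x := dartFlip E (c 3)) (y := dartFlip E (c 1)) (x' := c 0) (y' := c 2)
      (Or.inr rfl) (Or.inl rfl) (Or.inr rfl) (Or.inl rfl) (mem_cycleEdges 3) (mem_cycleEdges 1)
      (mem_cycleEdges 0) (mem_cycleEdges 2)
      (fun h => ne (i := 3) (j := 1) (by decide) (congrArg Prod.fst ((dartFlip E).injective h)))
      (fun h => ne (i := 0) (j := 2) (by decide) (congrArg Prod.fst h))
      (hc.dart_ne_flip 0 1) (hc.dart_ne_flip 2 3) r3 r1 a
  · rw [hc.dartEquiv_repl₂, hc.dartEquiv_repl₂]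
    exact hc.rotate.side_rot_of (x := c 1) (y := c 3) (x' := dartFlip E (c 0))
      (y' := dartFlip E (c 2)) (Or.inl rfl) (Or.inr rfl) (Or.inl rfl) (Or.inr rfl) (hm 1) (hm 3)
      (hm 0) (hm 2)
      (fun h => ne (i := 1) (j := 3) (by decide) (congrArg Prod.fst h))
      (fun h => ne (i := 0) (j := 2) (by decide) (congrArg Prod.fst ((dartFlip E).injective h)))
      (hc.dart_ne_flip 3 0).symm (hc.dart_ne_flip 1 2).symm r0 r2 a

/-- One of the two orientations of a cycle suits the drawings of its sides. -/
theorem IsCubicalCycle.exists_orientation (hc : G.IsCubicalCycle c) (hG : G.TwoConn)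
    (hpot : G.HasPotentials) (hp : G.IsCyclePotential c p) {s₁ s₂ : ZMod 2}
    (h₁ : ∀ d, d.1 ∉ cycleEdges c → G.base d = G.base (c 0) ∨ G.base d = G.base (c 2) → p d = s₁)
    (h₂ : ∀ d, d.1 ∉ cycleEdges c → G.base d = G.base (c 1) ∨ G.base d = G.base (c 3) → p d = s₂) :
    ∃ c' : Fin 4 → E × Bool, G.IsCubicalCycle c' ∧ G.IsCyclePotential c' p ∧
      (∀ d, d.1 ∉ cycleEdges c' → G.base d = G.base (c' 0) ∨ G.base d = G.base (c' 2) →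
        p d = p (c' 0) + 1) ∧
      ∀ d, d.1 ∉ cycleEdges c' → G.base d = G.base (c' 1) ∨ G.base d = G.base (c' 3) →
        p d = p (c' 0) := by
  -- Reversing the cycle adds 1 to the reference value p (c 0) and exchanges v₂ and v₄, so one of
  -- the two directions has the first part where it should be.
  set c' : Fin 4 → E × Bool := fun i => dartFlip E (c (Fin.rev i)) with hc'
  have b0 : G.base (c' 0) = G.base (c 0) := hc.next 3
  have b1 : G.base (c' 1) = G.base (c 3) := hc.next 2
  have b2 : G.base (c' 2) = G.base (c 2) := hc.next 1
  have b3 : G.base (c' 3) = G.base (c 1) := hc.next 0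
  have hp0 : p (c' 0) = p (c 0) + 1 := hc.potential_flip hp 3
  have he : cycleEdges c' = cycleEdges c := cycleEdges_reverse
  have hgood : (∀ d, d.1 ∉ cycleEdges c → G.base d = G.base (c 0) ∨ G.base d = G.base (c 2) →
        p d = p (c 0) + 1) → (∀ d, d.1 ∉ cycleEdges c →
        G.base d = G.base (c 1) ∨ G.base d = G.base (c 3) → p d = p (c 0)) → _ := fun k₁ k₂ =>
    (⟨c, hc, hp, k₁, k₂⟩ : ∃ c' : Fin 4 → E × Bool, G.IsCubicalCycle c' ∧
      G.IsCyclePotential c' p ∧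
      (∀ d, d.1 ∉ cycleEdges c' → G.base d = G.base (c' 0) ∨ G.base d = G.base (c' 2) →
        p d = p (c' 0) + 1) ∧
      ∀ d, d.1 ∉ cycleEdges c' → G.base d = G.base (c' 1) ∨ G.base d = G.base (c' 3) →
        p d = p (c' 0))
  have hgood' : (∀ d, d.1 ∉ cycleEdges c → G.base d = G.base (c 0) ∨ G.base d = G.base (c 2) →
        p d = p (c 0)) → (∀ d, d.1 ∉ cycleEdges c →
        G.base d = G.base (c 1) ∨ G.base d = G.base (c 3) → p d = p (c 0) + 1) → _ := fun k₁ k₂ =>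
    (⟨c', hc.reverse, hp.reverse, by rwa [he, b0, b2, hp0, add_one_add_one], by
      rw [he, b1, b3, hp0]; exact fun d hd hb => k₂ d hd hb.symm⟩ :
      ∃ c' : Fin 4 → E × Bool, G.IsCubicalCycle c' ∧
      G.IsCyclePotential c' p ∧
      (∀ d, d.1 ∉ cycleEdges c' → G.base d = G.base (c' 0) ∨ G.base d = G.base (c' 2) →
        p d = p (c' 0) + 1) ∧
      ∀ d, d.1 ∉ cycleEdges c' → G.base d = G.base (c' 1) ∨ G.base d = G.base (c' 3) →
        p d = p (c' 0))
  -- Only when both parts have edges off the cycle at its vertices is there something to prove;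
  -- otherwise the condition for the empty part is vacuous and the direction is chosen to suit the
  -- other.
  by_cases n₁ : ∃ d : E × Bool, d.1 ∉ cycleEdges c ∧
      (G.base d = G.base (c 0) ∨ G.base d = G.base (c 2))
  · by_cases n₂ : ∃ d : E × Bool, d.1 ∉ cycleEdges c ∧
      (G.base d = G.base (c 1) ∨ G.base d = G.base (c 3))
    · rcases eq_or_eq_add_one (p (c 0)) s₁ with rfl | rfl
      · refine hgood' h₁ ?_
        have := hc.reverse.potential_rotate_eq (s := s₂) hG hpot hp.reverse
          (by rwa [he, b0, b2, hp0, add_one_add_one])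
          (by rw [he, b1, b3]; exact fun d hd hb => h₂ d hd hb.symm)
          (by rwa [he, b0, b2]) (by rw [he, b1, b3]; simpa only [or_comm] using n₂)
        rw [this, hp0] at h₂
        exact h₂
      · refine hgood h₁ ?_
        have := hc.potential_rotate_eq hG hpot hp h₁ h₂ n₁ n₂
        rwa [this] at h₂
    · have k₂ : ∀ {s : ZMod 2} (d : E × Bool), d.1 ∉ cycleEdges c →
          G.base d = G.base (c 1) ∨ G.base d = G.base (c 3) → p d = s :=
        fun d hd hb => absurd ⟨d, hd, hb⟩ n₂
      rcases eq_or_eq_add_one (p (c 0)) s₁ with rfl | rfl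
      · exact hgood' h₁ k₂
      · exact hgood h₁ k₂
  · have k₁ : ∀ {s : ZMod 2} (d : E × Bool), d.1 ∉ cycleEdges c →
        G.base d = G.base (c 0) ∨ G.base d = G.base (c 2) → p d = s :=
      fun d hd hb => absurd ⟨d, hd, hb⟩ n₁
    rcases eq_or_eq_add_one (p (c 0)) s₂ with rfl | rfl
    · exact hgood k₁ h₂
    · exact hgood' k₁ h₂

/-- The edge of c 0 stands for the additional edge, and that of c 1 is left over. -/
theorem IsFourCycle.card_sideEdge_lt (hc : G.IsFourCycle c) :
    Nat.card (G.SideEdge c) < Nat.card E := by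
  have := Fintype.ofFinite (G.SideEdge c)
  rw [Nat.card_eq_fintype_card, Nat.card_eq_fintype_card]
  refine Fintype.card_lt_of_injective_not_surjective
    (fun e : G.SideEdge c => e.elim (c 0).1 Subtype.val) ?_ fun hs => ?_
  · rintro (_ | e) (_ | e') h
    · rfl
    · exact absurd ⟨0, h⟩ e'.2.1
    · exact absurd ⟨0, Eq.symm h⟩ e.2.1
    · rw [Subtype.ext h]
  · obtain ⟨_ | e, h⟩ := hs (c 1).1
    · exact absurd (hc.edge_inj 0 1 h) (by decide)
    · exact e.2.1 ⟨1, Eq.symm h⟩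

theorem exists_forall_eq {α β : Type*} [Nonempty β] {P : α → Prop} {f : α → β}
    (h : ∀ a b, P a → P b → f a = f b) : ∃ s, ∀ a, P a → f a = s := by
  by_cases hP : ∃ a, P a
  · obtain ⟨a, ha⟩ := hP
    exact ⟨f a, fun b hb => h b a hb ha⟩
  · exact ⟨Classical.arbitrary β, fun a ha => absurd ⟨a, ha⟩ hP⟩

end Main

theorem TwoConn.compositionClass_of_card (n : ℕ) : ∀ {V : Type u} {E : Type v} [Finite V]
    [Fintype E] (G : RotationSystem V E), Nat.card E = n → G.TwoConn → G.HasPotentials →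
    G.CubicalFlow → G.CompositionClass := by
  induction n using Nat.strong_induction_on with
  | _ n ih =>
    intro V E _ _ G hn hG hpot hcub
    by_cases hne : ∃ y ∈ G.dartFlows ℤ, y ≠ 0
    · have key : ∀ {c : Fin 4 → E × Bool} (hc : G.IsCubicalCycle c),
          (side hc.toIsFourCycle).CompositionClass := by
        intro c hc
        have := Fintype.ofFinite (G.SideEdge c)
        exact ih _ (hn ▸ hc.card_sideEdge_lt) _ rfl (hc.side_twoConn hG)
          (hc.side_hasPotentials hG.conn hpot) (hc.side_cubicalFlow hG.conn)
      -- The sides are already known to belong to the class, so the ends of their additional edges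
      -- do not separate them, as `potential_eq` requires.
      have hconst : ∀ {c : Fin 4 → E × Bool} (hc : G.IsCubicalCycle c) {y p : E × Bool → ZMod 2},
          G.IsPotential y p → (∀ d, d.1 ∉ cycleEdges c → y d = 0) → ∃ s, ∀ d,
          (d.1 ∉ cycleEdges c ∧ (G.base d = G.base (c 0) ∨ G.base d = G.base (c 2))) →
            p d = s := by
        intro c hc y p hp hy
        have := Fintype.ofFinite (G.SideEdge c)
        obtain ⟨-, -, t, e, k⟩ := (key hc).properties
        exact exists_forall_eq fun a b ha hb =>
          hc.potential_eq t e k hp hy ha.1 ha.2 hb.1 hb.2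
      obtain ⟨c, hc⟩ := hcub.exists_cubicalCycle hne
      obtain ⟨p, hp⟩ := hpot _ (dartFlows_cast hc.cycleFlow_mem)
      obtain ⟨s₁, h₁⟩ := hconst hc hp fun d hd => cycleFlow_cast_of_notMem hd
      obtain ⟨s₂, h₂⟩ := hconst hc.rotate hp fun d hd =>
        cycleFlow_cast_of_notMem (by rwa [cycleEdges_rotate] at hd)
      rw [cycleEdges_rotate] at h₂
      obtain ⟨c', hc', hp', k₁, k₂⟩ := hc.exists_orientation hG hpot hp
        (fun d hd hb => h₁ d ⟨hd, hb⟩) (fun d hd hb => h₂ d ⟨hd, hb⟩)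
      exact .comp G _ _ (key hc') (key hc'.rotate) ⟨_, _, (hc'.side_twoConn hG).not_loop _,
        (hc'.rotate.side_twoConn hG).not_loop _, hc'.isCompositionAlong hG.conn hp' k₁ k₂⟩
    · push Not at hne
      have := Fintype.ofFinite V
      rcases card_of_flow_eq_zero hG.nonempty hG.conn hG.connOff hG.not_loop hne with
        ⟨h1, h2⟩ | ⟨h1, h2⟩
      · exact .vertex G h1 h2
      · exact .edge G h1 h2 fun e => hG.not_loop (e, false)

theorem TwoConn.compositionClass {V : Type u} {E : Type v} [Finite V] [Fintype E]
    {G : RotationSystem V E} (hG : G.TwoConn) (hpot : G.HasPotentials) (hcub : G.CubicalFlow) :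
    G.CompositionClass :=
  compositionClass_of_card _ G rfl hG hpot hcub

end RotationSystem

namespace RotationSystem

/-! ### 2-connected subgraphs -/

section Sub

variable {V : Type u} {E : Type v} {G : RotationSystem V E} {S S' : Set V} {F F' : Set E}

/-- The vertices in `S` and the edges in `F` form a 2-connected subgraph. -/
structure SubTwoConn (G : RotationSystem V E) (S : Set V) (F : Set E) : Prop where
  mem : ∀ d, d.1 ∈ F → G.base d ∈ S
  nonempty : S.Nonempty
  conn : ∀ a ∈ S, ∀ b ∈ S, G.Reach F ∅ a b
  connOff : ∀ x, ∀ a ∈ S, ∀ b ∈ S, a ≠ x → b ≠ x → G.Reach F {x} a b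
  not_loop : ∀ d, d.1 ∈ F → G.base d ≠ G.base (dartFlip E d)

/-- The subgraph with given vertices and edges. -/
def subgraph (G : RotationSystem V E) (S : Set V) (F : Set E) (h : ∀ d, d.1 ∈ F → G.base d ∈ S) :
    Graph V E where
  vertexSet := S
  edgeSet := F
  IsLink e x y := e ∈ F ∧ G.toGraph.IsLink e x y
  isLink_symm := fun _ he => ⟨fun _ _ h => ⟨he, h.2.symm⟩⟩
  eq_or_eq_of_isLink_of_isLink := fun _ _ _ _ _ h h' => h.2.left_eq_or_eq h'.2
  edge_mem_iff_exists_isLink := fun e => ⟨fun he => ⟨_, _, he, false, rfl, rfl⟩, fun ⟨_, _, h⟩ => h.1⟩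
  left_mem_of_isLink := by
    rintro e x y ⟨he, b, rfl, -⟩
    exact h (e, b) he

theorem subgraph_le {h : ∀ d, d.1 ∈ F → G.base d ∈ S} : G.subgraph S F h ≤ G.toGraph where
  vertexSet_mono := fun _ _ => Set.mem_univ _
  isLink_mono := fun _ _ _ h => h.2

theorem le_iff_of_le {B B' : Graph V E} (hB : B ≤ G.toGraph) (hB' : B' ≤ G.toGraph) : B ≤ B' ↔
    B.vertexSet ⊆ B'.vertexSet ∧ B.edgeSet ⊆ B'.edgeSet :=
  (Graph.Compatible.of_le_le hB hB').le_iff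

theorem isLink_iff_of_le {B : Graph V E} (hB : B ≤ G.toGraph) {e : E} {x y : V} :
    B.IsLink e x y ↔ e ∈ B.edgeSet ∧ G.toGraph.IsLink e x y :=
  ⟨fun h => ⟨h.edge_mem, h.mono hB⟩, fun h => (Graph.IsSubgraph.isLink_iff hB h.1).2 h.2⟩

theorem base_mem_of_le {B : Graph V E} (hB : B ≤ G.toGraph) {d : E × Bool} (hd : d.1 ∈ B.edgeSet) :
    G.base d ∈ B.vertexSet :=
  ((isLink_iff_of_le hB).2 ⟨hd, d.2, rfl, rfl⟩ :
    B.IsLink d.1 (G.base d) (G.base (d.1, !d.2))).left_mem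

theorem Reach.of_notMem (h : ∀ d, d.1 ∈ F → G.base d ∈ S) {x : V} (hx : x ∉ S) {a b : V}
    (hr : G.Reach F ∅ a b) : G.Reach F {x} a b := by
  refine Relation.ReflTransGen.mono ?_ _ _ hr
  rintro _ _ ⟨d, rfl, rfl, hd, -, -⟩
  exact ⟨d, rfl, rfl, hd, fun h' => hx (h' ▸ h d hd), fun h' => hx (h' ▸ h (dartFlip E d) hd)⟩

theorem isTwoConn_iff_of_le {B : Graph V E} (hB : B ≤ G.toGraph) :
    B.IsTwoConn ↔ G.SubTwoConn B.vertexSet B.edgeSet := by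
  have hadj : ∀ a b, B.Adj a b ↔ ∃ d, G.base d = a ∧ G.base (dartFlip E d) = b ∧ d.1 ∈ B.edgeSet := by
    intro a b
    constructor
    · rintro ⟨e, he⟩
      obtain ⟨he, s, h1, h2⟩ := (isLink_iff_of_le hB).1 he
      exact ⟨(e, s), h1, h2, he⟩
    · rintro ⟨d, h1, h2, hd⟩
      exact ⟨d.1, (isLink_iff_of_le hB).2 ⟨hd, d.2, h1, h2⟩⟩
  have h1 : ∀ x, (fun a b => B.Adj a b ∧ a ≠ x ∧ b ≠ x) = G.Step B.edgeSet {x} := by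
    intro x
    funext a b
    rw [hadj]
    simp only [Step, Set.mem_singleton_iff, eq_iff_iff]
    exact ⟨fun ⟨⟨d, h1, h2, h3⟩, h⟩ => ⟨d, h1, h2, h3, h⟩,
      fun ⟨d, h1, h2, h3, h⟩ => ⟨⟨d, h1, h2, h3⟩, h⟩⟩
  have h2 : B.Adj = G.Step B.edgeSet ∅ := by
    funext a b
    rw [eq_iff_iff, hadj]
    simp [Step]
  constructor
  · rintro ⟨⟨hne, hc⟩, hcut, hl⟩
    rw [h2] at hc
    refine ⟨fun d => base_mem_of_le hB, hne, hc, fun x a ha b hb hax hbx => ?_, fun d hd hd' => ?_⟩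
    · by_cases hx : x ∈ B.vertexSet
      · by_contra hab
        rw [Reach, ← h1] at hab
        exact hcut x ⟨hx, a, ha, b, hb, hax, hbx, hab⟩
      · exact Reach.of_notMem (fun d => base_mem_of_le hB) hx (hc a ha b hb)
    · exact hl d.1 (G.base d) ((isLink_iff_of_le hB).2 ⟨hd, d.2, rfl, hd'.symm⟩)
  · rintro ⟨-, hne, hc, hcut, hl⟩
    refine ⟨⟨hne, by rw [h2]; exact hc⟩, ?_, ?_⟩
    · rintro x ⟨-, a, ha, b, hb, hax, hbx, hab⟩
      rw [h1] at hab
      exact hab (hcut x a ha b hb hax hbx)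
    · intro e x he
      obtain ⟨he, b, h1, h2⟩ := (isLink_iff_of_le hB).1 he
      exact hl (e, b) he (h1.trans h2.symm)

theorem SubTwoConn.isTwoConn (h : G.SubTwoConn S F) : (G.subgraph S F h.mem).IsTwoConn :=
  (isTwoConn_iff_of_le subgraph_le).2 h

/-- Being a maximal 2-connected subgraph, in terms of the sets of vertices and edges. -/
theorem SubTwoConn.subset_of_maximal {B : Graph V E}
    (hB : Maximal (fun H : Graph V E => H ≤ G.toGraph ∧ H.IsTwoConn) B) (h : G.SubTwoConn S F)
    (hS : B.vertexSet ⊆ S) (hF : B.edgeSet ⊆ F) : G.subgraph S F h.mem ≤ B :=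
  hB.2 ⟨subgraph_le, h.isTwoConn⟩ ((le_iff_of_le hB.1.1 subgraph_le).2 ⟨hS, hF⟩)

theorem reach_of_walk {W : Set V} {R : Set V} {a b : V}
    (q : (SimpleGraph.fromRel (G.Step Fᶜ ∅)).Walk a b) (hW : ∀ z ∈ q.support, z ∈ W)
    (hR : ∀ z ∈ q.support, z ∉ R) :
    G.Reach (F ∪ {e | ∃ d : E × Bool, d.1 = e ∧ G.base d ∈ W ∧ G.base (dartFlip E d) ∈ W ∧
      G.base d ≠ G.base (dartFlip E d)}) R a b := by
  induction q with
  | nil => exact Relation.ReflTransGen.refl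
  | @cons a c b h q ih =>
    have h1 := ih (fun z hz => hW z (List.mem_cons_of_mem _ hz))
      fun z hz => hR z (List.mem_cons_of_mem _ hz)
    refine Reach.trans ?_ h1
    obtain ⟨hne, hs⟩ := (SimpleGraph.fromRel_adj _ _ _).1 h
    obtain ⟨d, rfl, rfl, -⟩ : G.Step Fᶜ ∅ a c := hs.elim id Step.symm
    have ha : G.base d ∈ (SimpleGraph.Walk.cons h q).support := by simp
    have hc : G.base (dartFlip E d) ∈ (SimpleGraph.Walk.cons h q).support := by simp
    exact Reach.of_dart d (Or.inr ⟨d, rfl, hW _ ha, hW _ hc, hne⟩) (hR _ ha) (hR _ hc)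

/-- Adding an ear to a 2-connected subgraph. -/
theorem SubTwoConn.exists_ear (h : G.SubTwoConn S F) {u v : V} (hu : u ∈ S) (hv : v ∈ S)
    (huv : u ≠ v) (hr : G.Reach Fᶜ ∅ u v) :
    ∃ S' F', G.SubTwoConn S' F' ∧ S ⊆ S' ∧ F ⊆ F' ∧ ¬ F' ⊆ F := by
  classical
  -- Passing to a simple graph gives a path without repeated vertices; loops drop out.
  have hreach : (SimpleGraph.fromRel (G.Step Fᶜ ∅)).Reachable u v := by
    rw [SimpleGraph.reachable_iff_reflTransGen]
    clear hv huv
    induction hr with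
    | refl => exact Relation.ReflTransGen.refl
    | @tail b c _ hs ih =>
      by_cases hbc : b = c
      · rwa [← hbc]
      · exact ih.tail ((SimpleGraph.fromRel_adj _ _ _).2 ⟨hbc, Or.inl hs⟩)
  obtain ⟨p, hp⟩ := hreach.exists_isPath
  set W : Set V := {z | z ∈ p.support} with hW
  -- All edges between different vertices of the path are added, not only those of the path:
  -- parallel edges and chords do no harm, and no edges need to be chosen.
  set F' := F ∪ {e | ∃ d : E × Bool, d.1 = e ∧ G.base d ∈ W ∧ G.base (dartFlip E d) ∈ W ∧
      G.base d ≠ G.base (dartFlip E d)} with hF'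
  have hFF' : F ⊆ F' := Set.subset_union_left
  have htake : ∀ {w} (hw : w ∈ p.support) {R : Set V}, (∀ z ∈ (p.takeUntil w hw).support, z ∉ R) →
      G.Reach F' R u w := fun hw _ hR =>
    reach_of_walk _ (fun z hz => p.support_takeUntil_subset_support hw hz) hR
  have hdrop : ∀ {w} (hw : w ∈ p.support) {R : Set V}, (∀ z ∈ (p.dropUntil w hw).support, z ∉ R) →
      G.Reach F' R w v := fun hw _ hR =>
    reach_of_walk _ (fun z hz => p.support_dropUntil_subset_support hw hz) hR
  have hmem : ∀ d : E × Bool, d.1 ∈ F' → G.base d ∈ S ∪ W := by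
    rintro d (hd | ⟨d', hd', h1, h2, -⟩)
    · exact Or.inl (h.mem d hd)
    · rcases eq_or_eq_dartFlip hd'.symm with rfl | rfl
      · exact Or.inr h1
      · exact Or.inr h2
  have hto : ∀ w ∈ S ∪ W, ∃ b ∈ S, G.Reach F' ∅ w b := by
    rintro w (hw | hw)
    · exact ⟨w, hw, Relation.ReflTransGen.refl⟩
    · exact ⟨u, hu, (htake hw fun _ _ => Set.notMem_empty _).symm⟩
  -- A simple path contains x on at most one side of w, so from w one of its two ends can be reached
  -- without x.
  have hto' : ∀ x, ∀ w ∈ S ∪ W, w ≠ x → ∃ b ∈ S, b ≠ x ∧ G.Reach F' {x} w b := by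
    rintro x w (hw | hw) hwx
    · exact ⟨w, hw, hwx, Relation.ReflTransGen.refl⟩
    by_cases h1 : x ∈ (p.takeUntil w hw).support
    · have h2 : x ∉ (p.dropUntil w hw).support := by
        intro h2
        have h3 := (SimpleGraph.Walk.mem_support_iff _).1 h2
        have h4 := hp.support_nodup
        rw [← p.take_spec hw, SimpleGraph.Walk.support_append] at h4
        exact (List.nodup_append.1 h4).2.2 x h1 x (h3.resolve_left (Ne.symm hwx)) rfl
      refine ⟨v, hv, fun hvx => h2 (hvx ▸ SimpleGraph.Walk.end_mem_support _), hdrop hw ?_⟩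
      exact fun z hz hzx => h2 (Set.mem_singleton_iff.1 hzx ▸ hz)
    · refine ⟨u, hu, fun hux => h1 (hux ▸ SimpleGraph.Walk.start_mem_support _),
        (htake hw ?_).symm⟩
      exact fun z hz hzx => h1 (Set.mem_singleton_iff.1 hzx ▸ hz)
  refine ⟨S ∪ W, F', ⟨hmem, h.nonempty.mono Set.subset_union_left, fun a ha b hb => ?_,
    fun x a ha b hb hax hbx => ?_, ?_⟩, Set.subset_union_left, hFF', fun hsub => ?_⟩
  · obtain ⟨a', ha', h1⟩ := hto a ha
    obtain ⟨b', hb', h2⟩ := hto b hb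
    exact h1.trans (((h.conn a' ha' b' hb').mono hFF' le_rfl).trans h2.symm)
  · obtain ⟨a', ha', hax', h1⟩ := hto' x a ha hax
    obtain ⟨b', hb', hbx', h2⟩ := hto' x b hb hbx
    exact h1.trans (((h.connOff x a' ha' b' hb' hax' hbx').mono hFF' le_rfl).trans h2.symm)
  · rintro d (hd | ⟨d', hd', -, -, h3⟩)
    · exact h.not_loop d hd
    · rcases eq_or_eq_dartFlip hd'.symm with rfl | rfl
      · exact h3
      · rw [dartFlip_dartFlip]; exact h3.symm
  · cases p with
    | nil => exact huv rfl
    | @cons _ c _ hadj q =>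
      obtain ⟨hne, hs⟩ := (SimpleGraph.fromRel_adj _ _ _).1 hadj
      obtain ⟨d, h1, h2, hd, -⟩ : G.Step Fᶜ ∅ u c := hs.elim id Step.symm
      refine hd (hsub (Or.inr ⟨d, rfl, ?_, ?_, by rwa [h1, h2]⟩))
      · rw [h1, hW]; simp
      · rw [h2, hW]; simp

/-- Two vertices of a block are not joined outside of the block. -/
theorem eq_of_reach_off {B : Graph V E}
    (hB : Maximal (fun H : Graph V E => H ≤ G.toGraph ∧ H.IsTwoConn) B) {u v : V}
    (hu : u ∈ B.vertexSet) (hv : v ∈ B.vertexSet) (hr : G.Reach B.edgeSetᶜ ∅ u v) : u = v := by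
  by_contra huv
  obtain ⟨S', F', h, hS, hF, hF'⟩ :=
    ((isTwoConn_iff_of_le hB.1.1).1 hB.1.2).exists_ear hu hv huv hr
  exact hF' (h.subset_of_maximal hB hS hF).edgeSet_mono

theorem netFlow_congr [Fintype E] {R : Type*} [AddCommGroup R] {y z : E × Bool → R} {v : V}
    (h : ∀ d, G.base d = v → y d = z d) : G.netFlow y v = G.netFlow z v := by
  classical
  exact Finset.sum_congr rfl fun d _ => by
    split_ifs with hd
    · exact h d hd
    · rfl

open Classical in
/-- The restriction of a flow to a block is a flow. -/
theorem indicator_mem_dartFlows [Fintype E] {B : Graph V E}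
    (hB : Maximal (fun H : Graph V E => H ≤ G.toGraph ∧ H.IsTwoConn) B) {x : E × Bool → ℤ}
    (hx : x ∈ G.dartFlows ℤ) : (fun d => if d.1 ∈ B.edgeSet then x d else 0) ∈ G.dartFlows ℤ := by
  set y : E × Bool → ℤ := fun d => if d.1 ∈ B.edgeSet then 0 else x d with hy
  have hyflip : ∀ d, y (dartFlip E d) = -y d := by
    intro d
    simp only [hy, dartFlip_fst, hx.1]
    split_ifs <;> simp
  suffices hym : y ∈ G.dartFlows ℤ by
    convert (G.dartFlows ℤ).sub_mem hx hym using 1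
    ext d
    simp only [hy, Pi.sub_apply]
    split_ifs <;> simp
  have hoff : ∀ v, v ∉ B.vertexSet → G.netFlow y v = 0 := by
    intro v hv
    rw [← hx.2 v]
    refine netFlow_congr fun d hd => ?_
    simp only [hy]
    rw [if_neg fun h => hv (hd ▸ base_mem_of_le hB.1.1 h)]
  refine ⟨hyflip, fun v => ?_⟩
  by_cases hv : v ∈ B.vertexSet
  swap
  · exact hoff v hv
  -- t is the part of the flow outside the block that is joined to v. It meets the block only in v,
  -- so it is conserved at all other vertices; as its values cancel in total by antisymmetry, it is
  -- conserved at v too.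
  set t : E × Bool → ℤ := fun d => if G.Reach B.edgeSetᶜ ∅ v (G.base d) then y d else 0 with ht
  have htflip : ∀ d, t (dartFlip E d) = -t d := by
    intro d
    by_cases hd : d.1 ∈ B.edgeSet
    · have h1 : y d = 0 := if_pos hd
      have h2 : y (dartFlip E d) = 0 := if_pos hd
      simp [ht, h1, h2]
    · have h1 : G.Reach B.edgeSetᶜ ∅ v (G.base (dartFlip E d)) ↔
          G.Reach B.edgeSetᶜ ∅ v (G.base d) := by
        have h2 := Reach.of_dart (G := G) (F := B.edgeSetᶜ) (R := ∅) d hd (Set.notMem_empty _)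
          (Set.notMem_empty _)
        exact ⟨fun h => h.trans h2.symm, fun h => h.trans h2⟩
      simp only [ht, h1, hyflip]
      split_ifs <;> simp
  have hsum : ∑ d, t d = 0 := by
    have h1 := Equiv.sum_comp (dartFlip E) t
    simp only [htflip, Finset.sum_neg_distrib] at h1
    omega
  have hsplit : ∑ d, t d = G.netFlow y v + ∑ d, (if G.base d = v then 0 else t d) := by
    rw [netFlow, ← Finset.sum_add_distrib]
    refine Finset.sum_congr rfl fun d _ => ?_
    split_ifs with h
    · rw [add_zero, ht]
      exact if_pos (h ▸ Relation.ReflTransGen.refl)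
    · rw [zero_add]
  have hrest : ∑ d, (if G.base d = v then 0 else t d) = 0 := by
    refine sum_eq_zero_of_netFlow (G := G) fun w => ?_
    by_cases hw : G.Reach B.edgeSetᶜ ∅ v w ∧ w ≠ v
    · rw [← hoff w fun hwB => hw.2 (eq_of_reach_off hB hv hwB hw.1).symm]
      refine netFlow_congr fun d hd => ?_
      rw [if_neg (hd ▸ hw.2), ht]
      exact if_pos (hd ▸ hw.1)
    · have h0 : G.netFlow (0 : E × Bool → ℤ) w = 0 := by simp [netFlow]
      refine (netFlow_congr fun d hd => ?_).trans h0
      split_ifs with h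
      · rfl
      · exact if_neg fun h' => hw ⟨hd ▸ h', hd ▸ h⟩
  rw [hsplit, hrest, add_zero] at hsum
  exact hsum

end Sub

end RotationSystem

namespace RotationSystem

/-! ### Blocks -/

section Restrict

variable {V : Type u} {E : Type v} [Fintype E] {G : RotationSystem V E} {B : Graph V E}
  {R : Type*} [AddCommGroup R]

/-- The dart of the graph that is given by a dart of a subgraph. -/
def subDart (B : Graph V E) (a : B.edgeSet × Bool) : E × Bool := (a.1.1, a.2)

theorem subDart_rot_restrict (hB : B ≤ G.toGraph) (a : B.edgeSet × Bool) :
    subDart B ((G.restrict B hB).rot a) =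
      (firstReturn G.rot (fun a => a.1 ∈ B.edgeSet) ⟨subDart B a, a.1.2⟩).1 := rfl

theorem restrict_reach (hB : B ≤ G.toGraph) {R : Set V} {a b : B.vertexSet}
    (h : G.Reach B.edgeSet R a.1 b.1) :
    (G.restrict B hB).Reach Set.univ {x | x.1 ∈ R} a b := by
  have key : ∀ c, G.Reach B.edgeSet R a.1 c → ∀ hc : c ∈ B.vertexSet,
      (G.restrict B hB).Reach Set.univ {x | x.1 ∈ R} a ⟨c, hc⟩ := by
    intro c hac
    induction hac with
    | refl => exact fun _ => Relation.ReflTransGen.refl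
    | tail _ hs ih =>
      obtain ⟨d, rfl, rfl, hd, h1, h2⟩ := hs
      intro hc
      have h3 := Reach.of_dart (G := G.restrict B hB) (F := Set.univ) (R := {x | x.1 ∈ R})
        (⟨d.1, hd⟩, d.2) (Set.mem_univ _) h1 h2
      exact (ih (base_mem_of_le hB hd)).trans h3
  exact key b.1 h b.2

theorem restrict_twoConn (hB : B ≤ G.toGraph) (h : B.IsTwoConn) : (G.restrict B hB).TwoConn := by
  have h := (isTwoConn_iff_of_le hB).1 h
  refine ⟨h.nonempty.to_subtype, fun a b _ _ => ?_, fun x a b ha hb => ?_, fun d hd => ?_⟩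
  · exact restrict_reach hB (h.conn _ a.2 _ b.2)
  · refine (restrict_reach hB (h.connOff x.1 _ a.2 _ b.2 (fun h => ha (Subtype.ext h))
      fun h => hb (Subtype.ext h))).mono le_rfl ?_
    rintro y rfl
    rfl
  · exact h.not_loop (subDart B d) d.1.2 (congrArg Subtype.val hd)

theorem sum_edgeSet [Fintype B.edgeSet] {M : Type*} [AddCommMonoid M] (f : E → M)
    (hf : ∀ e, e ∉ B.edgeSet → f e = 0) : ∑ e : B.edgeSet, f e.1 = ∑ e, f e := by
  classical
  have h := Finset.sum_subtype (Finset.univ.filter fun e => e ∈ B.edgeSet)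
    (p := fun e => e ∈ B.edgeSet) (F := ‹Fintype B.edgeSet›) (fun e => by simp) f
  refine h.symm.trans (Finset.sum_subset (Finset.subset_univ _) fun e _ he => hf e ?_)
  simpa using he

theorem restrict_netFlow [Fintype B.edgeSet] (hB : B ≤ G.toGraph) {y : E × Bool → R}
    (h0 : ∀ d, d.1 ∉ B.edgeSet → y d = 0) (v : B.vertexSet) :
    (G.restrict B hB).netFlow (fun a => y (subDart B a)) v = G.netFlow y v.1 := by
  classical
  rw [netFlow, netFlow, Fintype.sum_prod_type, Fintype.sum_prod_type]
  refine Eq.trans ?_ (sum_edgeSet (B := B)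
    (fun e => ∑ b : Bool, if G.base (e, b) = v.1 then y (e, b) else 0) fun e he =>
      Finset.sum_eq_zero fun b _ => by rw [h0 (e, b) he, ite_self])
  refine Finset.sum_congr rfl fun e _ => Finset.sum_congr rfl fun b _ => ?_
  by_cases h : (G.restrict B hB).base (e, b) = v
  · have h1 : G.base (e.1, b) = v.1 := congrArg Subtype.val h
    rw [if_pos h, if_pos h1]
    rfl
  · have h1 : ¬G.base (e.1, b) = v.1 := fun h' => h (Subtype.ext h')
    rw [if_neg h, if_neg h1]

open Classical in
/-- The extension by zero of a dart function on a subgraph. -/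
noncomputable def extend (B : Graph V E) : (B.edgeSet × Bool → R) →+ (E × Bool → R) where
  toFun y d := if h : d.1 ∈ B.edgeSet then y (⟨d.1, h⟩, d.2) else 0
  map_zero' := by ext d; simp
  map_add' y z := by ext d; by_cases h : d.1 ∈ B.edgeSet <;> simp [h]

omit [Fintype E] in
theorem extend_of_mem (y : B.edgeSet × Bool → R) {d : E × Bool} (h : d.1 ∈ B.edgeSet) :
    extend B y d = y (⟨d.1, h⟩, d.2) := dif_pos h

omit [Fintype E] in
theorem extend_of_notMem (y : B.edgeSet × Bool → R) {d : E × Bool} (h : d.1 ∉ B.edgeSet) :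
    extend B y d = 0 := dif_neg h

omit [Fintype E] in
@[simp] theorem extend_subDart (y : B.edgeSet × Bool → R) (a : B.edgeSet × Bool) :
    extend B y (subDart B a) = y a := extend_of_mem y a.1.2

theorem extend_mem [Fintype B.edgeSet] (hB : B ≤ G.toGraph) {y : B.edgeSet × Bool → R}
    (hy : y ∈ (G.restrict B hB).dartFlows R) : extend B y ∈ G.dartFlows R := by
  classical
  refine ⟨fun d => ?_, fun v => ?_⟩
  · by_cases hd : d.1 ∈ B.edgeSet
    · rw [extend_of_mem y hd, extend_of_mem y (d := dartFlip E d) hd]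
      exact hy.1 (⟨d.1, hd⟩, d.2)
    · rw [extend_of_notMem y hd, extend_of_notMem y (d := dartFlip E d) hd, neg_zero]
  · by_cases hv : v ∈ B.vertexSet
    · rw [← restrict_netFlow hB (fun d => extend_of_notMem y) ⟨v, hv⟩]
      simp only [extend_subDart]
      exact hy.2 _
    · refine Finset.sum_eq_zero fun d _ => ?_
      split_ifs with h
      · exact extend_of_notMem y fun hd => hv (h ▸ base_mem_of_le hB hd)
      · rfl

theorem comp_subDart_mem [Fintype B.edgeSet] (hB : B ≤ G.toGraph) {y : E × Bool → R}
    (hy : y ∈ G.dartFlows R) (h0 : ∀ d, d.1 ∉ B.edgeSet → y d = 0) :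
    (fun a => y (subDart B a)) ∈ (G.restrict B hB).dartFlows R :=
  ⟨fun a => hy.1 (subDart B a), fun v => by rw [restrict_netFlow hB h0, hy.2]⟩

theorem restrict_hasPotentials [Fintype B.edgeSet] (hB : B ≤ G.toGraph) (hG : G.HasPotentials) :
    (G.restrict B hB).HasPotentials := by
  intro y hy
  obtain ⟨q, hq⟩ := hG _ (extend_mem hB hy)
  refine ⟨fun a => q (subDart B a), fun a => ⟨?_, ?_⟩⟩
  · have h := (hq (subDart B a)).1
    rwa [extend_subDart] at h
  · change q (subDart B ((G.restrict B hB).rot a)) = q (subDart B a) + y a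
    rw [subDart_rot_restrict, ← extend_subDart y a]
    exact firstReturn_additive G.rot (fun a => a.1 ∈ B.edgeSet) q (extend B y) (fun _ => True)
      (fun _ _ => trivial) (fun x _ => (hq x).2) (fun x _ hx => extend_of_notMem y hx)
      ⟨subDart B a, a.1.2⟩ trivial

theorem dartForm_subDart [Fintype B.edgeSet] (y z : E × Bool → ℤ)
    (h0 : ∀ d, d.1 ∉ B.edgeSet → y d = 0) :
    dartForm (fun a => y (subDart B a)) (fun a => z (subDart B a)) = dartForm y z :=
  sum_edgeSet (fun e => y (e, false) * z (e, false)) fun e he => by rw [h0 (e, false) he, zero_mul]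

/-- Blocks inherit the tiling property. -/
theorem restrict_cubicalFlow [Fintype B.edgeSet]
    (hB : Maximal (fun H : Graph V E => H ≤ G.toGraph ∧ H.IsTwoConn) B) (hG : G.CubicalFlow) :
    (G.restrict B hB.1.1).CubicalFlow := by
  classical
  -- Flows that vanish on the block are the orthogonal complement of the flows on the block.
  let N : AddSubgroup (G.dartFlows ℤ) :=
    { carrier := {x | ∀ d, d.1 ∈ B.edgeSet → x.1 d = 0}
      zero_mem' := fun _ _ => rfl
      add_mem' := fun {x y} hx hy d hd => by
        change x.1 d + y.1 d = 0
        rw [hx d hd, hy d hd, add_zero]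
      neg_mem' := fun {x} hx d hd => by
        change -x.1 d = 0
        rw [hx d hd, neg_zero] }
  let r : (G.restrict B hB.1.1).dartFlows ℤ × N →+ G.dartFlows ℤ :=
    { toFun := fun x => ⟨extend B x.1.1, extend_mem hB.1.1 x.1.2⟩ + x.2.1
      map_zero' := by ext d; simp
      map_add' := fun x y => by
        ext d
        simp only [Prod.fst_add, Prod.snd_add, AddSubgroup.coe_add, map_add, Pi.add_apply]
        ring }
  have hr : ∀ x d, (r x).1 d = extend B x.1.1 d + x.2.1.1 d := fun _ _ => rfl
  have hsurj : Function.Surjective r := by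
    intro x
    have hx := indicator_mem_dartFlows hB x.2
    set x' : E × Bool → ℤ := fun d => if d.1 ∈ B.edgeSet then x.1 d else 0 with hx'
    have h0 : ∀ d, d.1 ∉ B.edgeSet → x' d = 0 := fun d hd => if_neg hd
    have h1 : ∀ d, d.1 ∈ B.edgeSet → x' d = x.1 d := fun d hd => if_pos hd
    refine ⟨(⟨_, comp_subDart_mem hB.1.1 hx h0⟩, ⟨x - ⟨x', hx⟩, fun d hd => ?_⟩), ?_⟩
    · change x.1 d - x' d = 0
      rw [h1 d hd, sub_self]
    · ext d
      rw [hr]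
      change extend B (fun a => x' (subDart B a)) d + (x.1 d - x' d) = x.1 d
      by_cases hd : d.1 ∈ B.edgeSet
      · rw [extend_of_mem _ hd]
        change x' d + _ = _
        ring
      · rw [extend_of_notMem _ hd, h0 d hd]; ring
  have h2 := (Cubical.comp_iff (BM := fun x y => dartForm x.1.1 y.1.1 + dartForm x.2.1.1 y.2.1.1)
    r hsurj fun x y => ?_).2 hG
  · exact (Cubical.of_prod (M := (G.restrict B hB.1.1).dartFlows ℤ) (N := N)
      (B₁ := fun x y => dartForm x.1 y.1) (B₂ := fun x y => dartForm x.1.1 y.1.1)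
      (by simp [dartForm]) (by simp [dartForm]) h2).1
  · have h3 : dartForm x.1.1 y.1.1 = dartForm (extend B x.1.1) (extend B y.1.1) := by
      rw [← dartForm_subDart _ _ fun d hd => extend_of_notMem x.1.1 hd]
      simp only [extend_subDart]
    rw [h3, dartForm, dartForm, dartForm, ← Finset.sum_add_distrib]
    refine Finset.sum_congr rfl fun e _ => ?_
    rw [hr, hr]
    by_cases he : e ∈ B.edgeSet
    · rw [x.2.2 (e, false) he, y.2.2 (e, false) he]; ring
    · rw [extend_of_notMem x.1.1 (d := (e, false)) he, extend_of_notMem y.1.1 (d := (e, false)) he]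
      ring

end Restrict

/-! ### The blocks partition the edges of a loopless graph, and the flow lattice is their orthogonal
sum. -/

section Blocks

variable {V : Type u} {E : Type v} {G : RotationSystem V E}

theorem finite_graph [Finite V] [Finite E] : Finite (Graph V E) :=
  Finite.of_injective (fun B : Graph V E => (B.vertexSet, B.IsLink)) fun _ _ h =>
    Graph.ext (Prod.ext_iff.1 h).1 fun e x y =>
      iff_of_eq (congrFun (congrFun (congrFun (Prod.ext_iff.1 h).2 e) x) y)

theorem subTwoConn_edge {d : E × Bool} (hd : G.base d ≠ G.base (dartFlip E d)) :
    G.SubTwoConn {x | G.IsEnd d x} {d.1} := by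
  have hends : ∀ a : E × Bool, a.1 ∈ ({d.1} : Set E) → a = d ∨ a = dartFlip E d := fun a ha =>
    eq_or_eq_dartFlip (Set.mem_singleton_iff.1 ha)
  have hc : ∀ R : Set V, ∀ a, G.IsEnd d a → ∀ b, G.IsEnd d b → a ∉ R → b ∉ R →
      G.Reach {d.1} R a b := by
    have h1 : ∀ R : Set V, G.base d ∉ R → G.base (dartFlip E d) ∉ R →
        G.Reach {d.1} R (G.base d) (G.base (dartFlip E d)) := fun R => Reach.of_dart d rfl
    rintro R a (rfl | rfl) b (rfl | rfl) ha hb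
    · exact Relation.ReflTransGen.refl
    · exact h1 R ha hb
    · exact (h1 R hb ha).symm
    · exact Relation.ReflTransGen.refl
  refine ⟨fun a ha => ?_, ⟨_, G.isEnd_self d⟩, fun a ha b hb =>
    hc ∅ a ha b hb (Set.notMem_empty _) (Set.notMem_empty _), fun x a ha b hb hax hbx =>
    hc {x} a ha b hb hax hbx, fun a ha => ?_⟩
  · rcases hends a ha with rfl | rfl
    · exact G.isEnd_self _
    · exact G.isEnd_flip d
  · rcases hends a ha with rfl | rfl
    · exact hd
    · rw [dartFlip_dartFlip]; exact hd.symm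

/-- The union of two 2-connected subgraphs with a common edge. -/
theorem SubTwoConn.union {S S' : Set V} {F F' : Set E} (h : G.SubTwoConn S F)
    (h' : G.SubTwoConn S' F') {e : E} (he : e ∈ F) (he' : e ∈ F') :
    G.SubTwoConn (S ∪ S') (F ∪ F') := by
  -- The common edge has two ends, and one of them differs from x.
  have hcommon : ∀ x, ∃ w ∈ S, w ∈ S' ∧ w ≠ x := by
    intro x
    obtain ⟨w, hw, hwx⟩ := exists_isEnd_ne (h.not_loop (e, false) he) x
    refine ⟨w, ?_, ?_, hwx⟩ <;> rcases hw with rfl | rfl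
    · exact h.mem _ he
    · exact h.mem _ he
    · exact h'.mem _ he'
    · exact h'.mem _ he'
  have m1 : F ⊆ F ∪ F' := Set.subset_union_left
  have m2 : F' ⊆ F ∪ F' := Set.subset_union_right
  refine ⟨fun d hd => hd.imp (h.mem d) (h'.mem d), h.nonempty.mono Set.subset_union_left,
    fun a ha b hb => ?_, fun x a ha b hb hax hbx => ?_, fun d hd => hd.elim (h.not_loop d)
    (h'.not_loop d)⟩
  · obtain ⟨w, hw, hw', -⟩ := hcommon a
    have key : ∀ z ∈ S ∪ S', G.Reach (F ∪ F') ∅ z w := fun z hz => hz.elim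
      (fun hz => (h.conn z hz w hw).mono m1 le_rfl) fun hz => (h'.conn z hz w hw').mono m2 le_rfl
    exact (key a ha).trans (key b hb).symm
  · obtain ⟨w, hw, hw', hwx⟩ := hcommon x
    have key : ∀ z ∈ S ∪ S', z ≠ x → G.Reach (F ∪ F') {x} z w := fun z hz hzx => hz.elim
      (fun hz => (h.connOff x z hz w hw hzx hwx).mono m1 le_rfl)
      fun hz => (h'.connOff x z hz w hw' hzx hwx).mono m2 le_rfl
    exact (key a ha hax).trans (key b hb hbx).symm

theorem exists_block_of_edge [Finite V] [Finite E] {d : E × Bool}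
    (hd : G.base d ≠ G.base (dartFlip E d)) :
    ∃ B : Graph V E, Maximal (fun H : Graph V E => H ≤ G.toGraph ∧ H.IsTwoConn) B ∧
      d.1 ∈ B.edgeSet := by
  have := finite_graph (V := V) (E := E)
  have h := subTwoConn_edge hd
  obtain ⟨B, hle, hB⟩ := Finite.exists_le_maximal
    (p := fun H : Graph V E => H ≤ G.toGraph ∧ H.IsTwoConn) ⟨subgraph_le, h.isTwoConn⟩
  exact ⟨B, hB, Graph.IsSubgraph.edgeSet_mono hle rfl⟩

theorem block_eq_of_edge {B B' : Graph V E}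
    (hB : Maximal (fun H : Graph V E => H ≤ G.toGraph ∧ H.IsTwoConn) B)
    (hB' : Maximal (fun H : Graph V E => H ≤ G.toGraph ∧ H.IsTwoConn) B') {e : E}
    (he : e ∈ B.edgeSet) (he' : e ∈ B'.edgeSet) : B = B' := by
  have h := ((isTwoConn_iff_of_le hB.1.1).1 hB.1.2).union
    ((isTwoConn_iff_of_le hB'.1.1).1 hB'.1.2) he he'
  have h1 := h.subset_of_maximal hB Set.subset_union_left Set.subset_union_left
  have h2 : B' ≤ G.subgraph _ _ h.mem :=
    (le_iff_of_le hB'.1.1 subgraph_le).2 ⟨Set.subset_union_right, Set.subset_union_right⟩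
  exact (hB'.eq_of_le hB.1 (h2.trans h1)).symm

/-- The tiling property for a graph without loops follows from that for the blocks. -/
theorem cubicalFlow_of_blocks [Finite V] [Fintype E] (hl : ∀ d, G.base d ≠ G.base (dartFlip E d))
    (h : ∀ (B : Graph V E) (hB : Maximal (fun H : Graph V E => H ≤ G.toGraph ∧ H.IsTwoConn) B)
      [Fintype B.edgeSet], (G.restrict B hB.1.1).CubicalFlow) : G.CubicalFlow := by
  classical
  have := finite_graph (V := V) (E := E)
  let κ := {B : Graph V E // Maximal (fun H : Graph V E => H ≤ G.toGraph ∧ H.IsTwoConn) B}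
  have := Fintype.ofFinite κ
  have hfin : ∀ k : κ, Fintype k.1.edgeSet := fun k => Fintype.ofFinite _
  have hblock : ∀ e : E, ∃ k : κ, e ∈ k.1.edgeSet := fun e => by
    obtain ⟨B, hB, he⟩ := exists_block_of_edge (hl (e, false))
    exact ⟨⟨B, hB⟩, he⟩
  choose k hk using hblock
  have hk' : ∀ (e : E) (j : κ), e ∈ j.1.edgeSet → j = k e := fun e j he =>
    Subtype.ext (block_eq_of_edge j.2 (k e).2 he (hk e))
  let r : (∀ j : κ, (G.restrict j.1 j.2.1.1).dartFlows ℤ) →+ G.dartFlows ℤ :=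
    { toFun := fun y => ∑ j, ⟨extend j.1 (y j).1, extend_mem j.2.1.1 (y j).2⟩
      map_zero' := Finset.sum_eq_zero fun j _ => Subtype.ext (map_zero _)
      map_add' := fun x y => by
        rw [← Finset.sum_add_distrib]
        exact Finset.sum_congr rfl fun j _ => Subtype.ext (map_add _ _ _) }
  -- Each edge lies in exactly one block, so only one summand is non-zero at a given dart.
  have hr : ∀ y d, (r y).1 d = extend (k d.1).1 (y (k d.1)).1 d := by
    intro y d
    change (∑ j, (⟨extend j.1 (y j).1, extend_mem j.2.1.1 (y j).2⟩ : G.dartFlows ℤ)).1 d = _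
    rw [AddSubgroup.val_finsetSum, Finset.sum_apply, Finset.sum_eq_single (k d.1)]
    · exact fun j _ hj => extend_of_notMem _ fun hd => hj (hk' _ _ hd)
    · exact fun h => absurd (Finset.mem_univ _) h
  have hsurj : Function.Surjective r := by
    intro x
    have hx := fun j : κ => indicator_mem_dartFlows j.2 x.2
    refine ⟨fun j => ⟨_, comp_subDart_mem j.2.1.1 (hx j) fun d hd => if_neg hd⟩, ?_⟩
    ext d
    rw [hr, extend_of_mem _ (hk d.1)]
    exact if_pos (hk d.1)
  refine (Cubical.comp_iff r hsurj fun x y => ?_).1 (Cubical.pi fun j : κ => h j.1 j.2)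
  have h1 : ∀ j : κ, dartForm (x j).1 (y j).1 =
      ∑ e, (extend j.1 (x j).1 (e, false)) * (extend j.1 (y j).1 (e, false)) := by
    intro j
    change _ = dartForm (extend j.1 (x j).1) (extend j.1 (y j).1)
    rw [← dartForm_subDart _ _ fun d hd => extend_of_notMem (x j).1 hd]
    simp only [extend_subDart]
  simp only [h1]
  rw [Finset.sum_comm, dartForm]
  refine Finset.sum_congr rfl fun e _ => ?_
  rw [hr, hr, Finset.sum_eq_single (k e)]
  · intro j _ hj
    rw [extend_of_notMem _ fun hd => hj (hk' _ _ hd), zero_mul]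
  · exact fun h => absurd (Finset.mem_univ _) h

theorem isBlock_loop {d : E × Bool} (hd : G.base d = G.base (dartFlip E d)) :
    G.toGraph.IsBlock (G.subgraph {G.base d} {d.1} fun a ha => by
      rcases eq_or_eq_dartFlip (Set.mem_singleton_iff.1 ha) with rfl | rfl
      · rfl
      · exact hd.symm) :=
  Or.inr ⟨subgraph_le, d.1, G.base d, ⟨d.2, rfl, hd.symm⟩, rfl, rfl⟩

end Blocks

end RotationSystem

open RotationSystem in
theorem mainTheorem6 {V : Type u} {E : Type v} [Fintype V] [Fintype E]
    (G : RotationSystem V E) (hG : G.IsPlanar) :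
    (IsTwoCubeTilingLattice G.flow ↔
      ∀ (B : Graph V E) (hB : G.toGraph.IsBlock B), (G.restrict B hB.le).CompositionClass) ∧
    ((G.toGraph.IsTwoConn ∧ IsTwoCubeTilingLattice G.flow) ↔ G.CompositionClass) := by
  have hpot := hG.hasPotentials
  rw [isTwoCubeTilingLattice_iff, ← twoConn_iff]
  refine ⟨⟨fun hc B hB => ?_, fun h => ?_⟩, fun h => h.1.compositionClass hpot h.2, fun h => ?_⟩
  · have := Fintype.ofFinite B.edgeSet
    rcases hB with hB | ⟨-, e, x, he, -⟩
    · exact (restrict_twoConn hB.1.1 hB.1.2).compositionClass (restrict_hasPotentials hB.1.1 hpot)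
        (restrict_cubicalFlow hB hc)
    -- A loop carries a flow of norm 1, so this kind of block does not occur.
    · obtain ⟨h1, h2⟩ := toGraph_isLoopAt_iff.1 he
      exact absurd (h1.trans h2.symm) (hc.not_loop (e, false))
  · refine cubicalFlow_of_blocks (fun d hd => ?_) fun B hB _ => ?_
    -- A loop with its vertex is a block, and members of the class have no loops.
    · obtain ⟨-, -, t, -⟩ := (h _ (isBlock_loop hd)).properties
      exact t.not_loop (⟨d.1, rfl⟩, d.2) (Subtype.ext hd)
    · exact (h B (Or.inl hB)).properties.2.2.2.2
  · obtain ⟨-, -, t, -, k⟩ := h.properties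
    exact ⟨t, k⟩
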